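/- Let $n\ge 2$ be an integer. Identify a real polynomial $\sum_{i=0}^n v_i x^i$ with its coefficient vector $\mathbf v=(v_0,\dots,v_n)\in\mathbb R^{n+1}$. A \emph{height function} is a continuous function $h:\mathbb R^{n+1}\to[0,\infty)$ such that for all $\mathbf v$: $h(t\mathbf v)=|t|h(\mathbf v)$ for all real $t$; $h(\mathbf v)=0$ if and only if $\mathbf v=\mathbf 0$; $h(v_n,\dots,v_0)=h(v_0,\dots,v_n)$; and $h(v_0,-v_1,\dots,(-1)^n v_n)=h(v_0,v_1,\dots,v_n)$ (for example the naive height, the length or the Mahler measure). Fix a height function $h$. For a polynomial $P$ of degree $n$ let $D(P)$ be its discriminant. For $\delta>0$ let $f_0(\delta)$ be the $(n+1)$-dimensional Lebesgue measure of the set of all $\mathbf a\in\mathbb R^{n+1}$ with $a_n\neq 0$ such that all complex roots of $p=\sum_{i=0}^n a_i x^i$ are real, $h(\mathbf a)\le 1$ and $|D(p)|\le\delta$. For real $Q>1$ and $v\ge 0$ let $\mathcal P^{(0)}_n(Q,v)$ be the set of all integer polynomials $P$ of degree exactly $n$ with $h(P)\le Q$, with all complex roots real, and with $|D(P)|\le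 Q^{2n-2-2v}$. Then there is a constant $\lambda_0>0$, depending only on $n$ and $h$, such that \[ f_0(\delta)\sim\lambda_0\,\delta^{\frac{n+2}{2n}}\qquad\text{as }\delta\to 0^+, \] and with the same constant, for every $\epsilon\in(0,1)$, \[ \#\mathcal P^{(0)}_n(Q,v)\sim\lambda_0\,Q^{\,n+1-\frac{n+2}{n}v}\qquad\text{as } Q\to\infty, \] uniformly in $v\in\left[\epsilon,(1-\epsilon)\frac{n}{n+2}\right]$; that is, the ratio of the two sides tends to $1$ uniformly on this interval. -/

import Mathlib

open Filter Topology MeasureTheory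
open scoped Polynomial

noncomputable section

/-- A height function on real polynomials `∑ vᵢ xⁱ` of degree at most `n`, as a function of the
coefficient vector `(v₀, …, vₙ)`. The naive height, the length and the Mahler measure are
examples. -/
structure IsHeightFunction (n : ℕ) (h : (Fin (n + 1) → ℝ) → ℝ) : Prop where
  continuous : Continuous h
  nonneg : ∀ w, 0 ≤ h w
  homogeneous : ∀ (t : ℝ) (w : Fin (n + 1) → ℝ), h (t • w) = |t| * h w
  eq_zero_iff : ∀ w, h w = 0 ↔ w = 0
  reverse : ∀ w : Fin (n + 1) → ℝ, h (fun i => w i.rev) = h w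
  alternate : ∀ w : Fin (n + 1) → ℝ, h (fun i => (-1) ^ (i : ℕ) * w i) = h w

/-- The number of non-real complex roots of a real polynomial, counted with multiplicity. -/
def nonrealRootCount (P : ℝ[X]) : ℕ :=
  Multiset.countP (fun z : ℂ => z.im ≠ 0) (P.map (algebraMap ℝ ℂ)).roots

/-- Integer polynomials of degree exactly `n` and height at most `Q`. -/
def polyClass (n : ℕ) (h : (Fin (n + 1) → ℝ) → ℝ) (Q : ℝ) : Set ℤ[X] :=
  {P | P.degree = (n : WithBot ℕ) ∧ h (fun i => ((P.coeff (i : ℕ) : ℤ) : ℝ)) ≤ Q}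

/-- Those polynomials of `polyClass n h Q` with `|D(P)| ≤ Q ^ (2n - 2 - 2v)`. -/
def smallDiscrClass (n : ℕ) (h : (Fin (n + 1) → ℝ) → ℝ) (Q v : ℝ) : Set ℤ[X] :=
  {P | P ∈ polyClass n h Q ∧ |((P.discr : ℤ) : ℝ)| ≤ Q ^ (2 * (n : ℝ) - 2 - 2 * v)}

/-- Those polynomials of `smallDiscrClass n h Q v` with exactly `2s` non-real roots. -/
def smallDiscrClassSig (n : ℕ) (h : (Fin (n + 1) → ℝ) → ℝ) (s : ℕ) (Q v : ℝ) : Set ℤ[X] :=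
  {P | P ∈ smallDiscrClass n h Q v ∧ nonrealRootCount (P.map (Int.castRingHom ℝ)) = 2 * s}

/-- The real polynomial `∑ aᵢ xⁱ` with coefficient vector `a`. -/
def polyOfCoeffs (n : ℕ) (a : Fin (n + 1) → ℝ) : ℝ[X] :=
  ∑ i : Fin (n + 1), Polynomial.C (a i) * Polynomial.X ^ (i : ℕ)

/-- The set of coefficient vectors of real polynomials of degree `n` with exactly `2s` non-real
roots, height at most `1` and `|D| ≤ δ`. -/
def discrRegion (n : ℕ) (h : (Fin (n + 1) → ℝ) → ℝ) (s : ℕ) (δ : ℝ) : Set (Fin (n + 1) → ℝ) :=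
  {a | a (Fin.last n) ≠ 0 ∧ nonrealRootCount (polyOfCoeffs n a) = 2 * s ∧ h a ≤ 1 ∧
    |(polyOfCoeffs n a).discr| ≤ δ}

/-- The limit distribution function `f_s(δ)` of the normalized discriminant: the Lebesgue measure
of `discrRegion n h s δ`. -/
def limitDistr (n : ℕ) (h : (Fin (n + 1) → ℝ) → ℝ) (s : ℕ) (δ : ℝ) : ℝ :=
  (volume (discrRegion n h s δ)).toReal

end

/-! A real-rooted polynomial is given by its leading coefficient a and its ordered roots. In these
parameters the coefficient vector has Jacobian |a|^n V, with V the Vandermonde determinant of the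
roots (`abs_det_rootJac`), while |D| = |a|^(2n-2) V^2 (`abs_discr_splitPoly`). Replace the roots by
the smallest root b and the n-1 gaps. Since V is homogeneous of degree N = n(n-1)/2 in the gaps,
rescaling them by (√δ / |a|^(n-1))^(1/N) turns |D| ≤ δ into V ≤ 1, pulls out the factor δ^(1/2 +
1/n) = δ^((n+2)/(2n)), and leaves the weight |a|^(2/n-1) V (`volume_inter_distinctRegion_eq`). As δ
→ 0 the roots coalesce, the height condition becomes a condition on a(x-b)^n, and dominated
convergence gives the limit.

Domination needs two facts. The gap vectors with V ≤ 1 may be unbounded, but they have finite volume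
(`volume_gapDelta_le_one_lt_top`). And b has to stay bounded: a nonzero polynomial of degree at most
n has no root near at least one of the integers 0, ..., n, so the space splits into n+1 cells. In
cell j the substitution q ↦ (x-j)^n q(1/(x-j)) preserves volume and |D| and makes the roots bounded
(`volume_rootCell_inter`, `cellRegion_bounded`).

For the count, an axis-parallel line crosses the boundary of the real-rooted region with |D| ≤ δ
boundedly often (`exists_finset_line`). Hence translating the lattice by a vector of the unit cube
changes the number of points in the region by O(Q^n), and averaging over translates gives the
volume. The function h need not be semialgebraic, so its bound is treated by uniform continuity,
which sandwiches the count between the volumes for heights (1 ± η)Q (`card_lattice_sandwich`). By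
homogeneity these are values of f_0 at a constant times Q^(-2v). The bound v ≥ ε sends this argument
to 0 uniformly, and v ≤ (1-ε)n/(n+2) keeps the main term of order at least Q^(n+ε), above the error.
-/

noncomputable section

/-! ### Real-rooted polynomials: coefficients, roots and discriminant -/

open Polynomial in
/-- The real polynomial `a ∏ (X - αₖ)`. -/
def splitPoly {n : ℕ} (a : ℝ) (α : Fin n → ℝ) : ℝ[X] := C a * ∏ k, (X - C (α k))

/-- The coefficient vector of `a ∏ (X - αₖ)`. -/
def splitCoeffs {n : ℕ} (a : ℝ) (α : Fin n → ℝ) : Fin (n + 1) → ℝ :=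
  fun i => (splitPoly a α).coeff i

/-- The product of `|αᵢ - αⱼ|` over all ordered pairs `i ≠ j`. -/
def rootProd {n : ℕ} (α : Fin n → ℝ) : ℝ := ∏ i, ∏ j ∈ Finset.univ.erase i, |α i - α j|

lemma polyOfCoeffs_coeff {n : ℕ} (a : Fin (n + 1) → ℝ) (i : Fin (n + 1)) :
    (polyOfCoeffs n a).coeff i = a i := by
  simp [polyOfCoeffs, Polynomial.coeff_C_mul, Polynomial.coeff_X_pow, Fin.val_inj]

lemma natDegree_polyOfCoeffs_le {n : ℕ} (a : Fin (n + 1) → ℝ) :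
    (polyOfCoeffs n a).natDegree ≤ n := by
  refine Polynomial.natDegree_sum_le_of_forall_le _ _ fun i _ => ?_
  exact (Polynomial.natDegree_C_mul_X_pow_le _ _).trans (Nat.lt_succ_iff.mp i.2)

lemma polyOfCoeffs_coeff_eq {n : ℕ} {p : ℝ[X]} (hp : p.natDegree ≤ n) :
    polyOfCoeffs n (fun i => p.coeff i) = p := by
  ext i
  by_cases hi : i < n + 1
  · exact polyOfCoeffs_coeff _ (⟨i, hi⟩ : Fin (n + 1))
  · rw [Polynomial.coeff_eq_zero_of_natDegree_lt, Polynomial.coeff_eq_zero_of_natDegree_lt]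
    · omega
    · exact (natDegree_polyOfCoeffs_le _).trans_lt (by omega)

lemma polyOfCoeffs_injective (n : ℕ) : Function.Injective (polyOfCoeffs n) := by
  intro a b hab
  ext i
  rw [← polyOfCoeffs_coeff a, hab, polyOfCoeffs_coeff]

lemma natDegree_polyOfCoeffs {n : ℕ} {a : Fin (n + 1) → ℝ} (ha : a (Fin.last n) ≠ 0) :
    (polyOfCoeffs n a).natDegree = n := by
  refine le_antisymm (natDegree_polyOfCoeffs_le a) (Polynomial.le_natDegree_of_ne_zero ?_)
  simpa using (polyOfCoeffs_coeff a (Fin.last n)).trans_ne ha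

lemma leadingCoeff_polyOfCoeffs {n : ℕ} {a : Fin (n + 1) → ℝ} (ha : a (Fin.last n) ≠ 0) :
    (polyOfCoeffs n a).leadingCoeff = a (Fin.last n) := by
  rw [Polynomial.leadingCoeff, natDegree_polyOfCoeffs ha]
  simpa using polyOfCoeffs_coeff a (Fin.last n)

lemma eval_polyOfCoeffs {n : ℕ} (a : Fin (n + 1) → ℝ) (x : ℝ) :
    (polyOfCoeffs n a).eval x = ∑ i, a i * x ^ (i : ℕ) := by
  simp [polyOfCoeffs, Polynomial.eval_finsetSum]

lemma natDegree_prod_X_sub_C {n : ℕ} (α : Fin n → ℝ) :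
    (∏ k, (Polynomial.X - Polynomial.C (α k))).natDegree = n := by
  simp [Polynomial.natDegree_finsetProd_X_sub_C_eq_card]

lemma monic_prod_X_sub_C' {n : ℕ} (α : Fin n → ℝ) :
    (∏ k, (Polynomial.X - Polynomial.C (α k))).Monic :=
  Polynomial.monic_prod_of_monic _ _ fun k _ => Polynomial.monic_X_sub_C (α k)

lemma natDegree_splitPoly_le {n : ℕ} (a : ℝ) (α : Fin n → ℝ) : (splitPoly a α).natDegree ≤ n :=
  (Polynomial.natDegree_C_mul_le _ _).trans (natDegree_prod_X_sub_C α).le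

lemma polyOfCoeffs_splitCoeffs {n : ℕ} (a : ℝ) (α : Fin n → ℝ) :
    polyOfCoeffs n (splitCoeffs a α) = splitPoly a α :=
  polyOfCoeffs_coeff_eq (natDegree_splitPoly_le a α)

lemma splitCoeffs_last {n : ℕ} (a : ℝ) (α : Fin n → ℝ) : splitCoeffs a α (Fin.last n) = a := by
  have h := (monic_prod_X_sub_C' α).coeff_natDegree
  rw [natDegree_prod_X_sub_C] at h
  simp [splitCoeffs, splitPoly, h]

lemma natDegree_splitPoly {n : ℕ} {a : ℝ} (ha : a ≠ 0) (α : Fin n → ℝ) :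
    (splitPoly a α).natDegree = n := by
  rw [← polyOfCoeffs_splitCoeffs, natDegree_polyOfCoeffs (by rwa [splitCoeffs_last])]

lemma leadingCoeff_splitPoly {n : ℕ} {a : ℝ} (ha : a ≠ 0) (α : Fin n → ℝ) :
    (splitPoly a α).leadingCoeff = a := by
  rw [← polyOfCoeffs_splitCoeffs, leadingCoeff_polyOfCoeffs (by rwa [splitCoeffs_last]),
    splitCoeffs_last]

lemma eval_splitPoly {n : ℕ} (a : ℝ) (α : Fin n → ℝ) (x : ℝ) :
    (splitPoly a α).eval x = a * ∏ k, (x - α k) := by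
  simp [splitPoly, Polynomial.eval_prod]

lemma roots_splitPoly {n : ℕ} {a : ℝ} (ha : a ≠ 0) (α : Fin n → ℝ) :
    (splitPoly a α).roots = Finset.univ.val.map α := by
  have h := Polynomial.roots_multiset_prod_X_sub_C (Finset.univ.val.map α)
  rw [Multiset.map_map] at h
  rw [splitPoly, Polynomial.roots_C_mul _ ha]
  exact h

lemma splits_splitPoly {n : ℕ} (a : ℝ) (α : Fin n → ℝ) : (splitPoly a α).Splits := by
  unfold splitPoly
  exact (Polynomial.Splits.C a).mul (Polynomial.Splits.prod fun k _ => Polynomial.Splits.X_sub_C _)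

lemma eval_derivative_splitPoly {n : ℕ} (a : ℝ) (α : Fin n → ℝ) (i : Fin n) :
    (splitPoly a α).derivative.eval (α i) = a * ∏ j ∈ Finset.univ.erase i, (α i - α j) := by
  rw [splitPoly, Polynomial.derivative_C_mul, Polynomial.derivative_prod_finset,
    Polynomial.eval_C_mul, Polynomial.eval_finsetSum, Finset.sum_eq_single i]
  · simp [Polynomial.eval_prod]
  · intro j _ hj
    simp only [Polynomial.eval_mul, Polynomial.eval_prod]
    rw [Finset.prod_eq_zero (i := i), zero_mul]
    · simpa using hj.symm
    · simp
  · simp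

/-- The resultant of p and p' is ±a·D on one side and a^(n-1) ∏ p'(αᵢ) on the other, where p'(αᵢ) =
a ∏ (αᵢ - αⱼ) over j ≠ i. One factor a cancels. -/
lemma abs_discr_splitPoly {n : ℕ} (hn : 1 ≤ n) {a : ℝ} (ha : a ≠ 0) (α : Fin n → ℝ) :
    |(splitPoly a α).discr| = |a| ^ (2 * n - 2) * rootProd α := by
  have hdeg : 0 < (splitPoly a α).degree := by
    rw [← Polynomial.natDegree_pos_iff_degree_pos, natDegree_splitPoly ha]; omega
  have h1 := Polynomial.resultant_deriv hdeg
  have h2 := Polynomial.resultant_eq_prod_eval (splitPoly a α) (splitPoly a α).derivative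
    (n - 1) ((Polynomial.natDegree_derivative_le _).trans
      (by rw [natDegree_splitPoly ha])) (splits_splitPoly a α)
  rw [natDegree_splitPoly ha] at h1 h2
  rw [h1, leadingCoeff_splitPoly ha, roots_splitPoly ha, Multiset.map_map] at h2
  have h3 := congrArg abs h2
  have h4 : (Multiset.map ((fun x => (splitPoly a α).derivative.eval x) ∘ α)
      (Finset.univ : Finset (Fin n)).val).prod
      = ∏ i, (a * ∏ j ∈ Finset.univ.erase i, (α i - α j)) := by
    rw [Finset.prod_eq_multiset_prod]
    congr 1
    exact Multiset.map_congr rfl fun i _ => eval_derivative_splitPoly a α i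
  erw [h4] at h3
  rw [Finset.prod_mul_distrib] at h3
  simp only [abs_mul, abs_pow, abs_neg, abs_one, one_pow, one_mul, Finset.abs_prod,
    Finset.prod_const, Finset.card_univ, Fintype.card_fin] at h3
  have h5 : |a| * |(splitPoly a α).discr| = |a| * (|a| ^ (2 * n - 2) * rootProd α) := by
    rw [h3, rootProd, ← mul_assoc, ← mul_assoc, ← pow_add, ← pow_succ']
    congr 2
    omega
  exact mul_left_cancel₀ (abs_ne_zero.mpr ha) h5

lemma nonrealRootCount_splitPoly {n : ℕ} (a : ℝ) (α : Fin n → ℝ) :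
    nonrealRootCount (splitPoly a α) = 0 := by
  by_cases ha : a = 0
  · simp [splitPoly, ha, nonrealRootCount]
  rw [nonrealRootCount, (splits_splitPoly a α).roots_map, Multiset.countP_eq_zero]
  intro z hz
  obtain ⟨x, -, rfl⟩ := Multiset.mem_map.mp hz
  simp

lemma exists_splitPoly_of_nonrealRootCount {n : ℕ} {p : ℝ[X]} (hp : p.natDegree = n)
    (h : nonrealRootCount p = 0) : ∃ α : Fin n → ℝ, p = splitPoly p.leadingCoeff α := by
  have hsp : (p.map (algebraMap ℝ ℂ)).Splits := IsAlgClosed.splits _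
  set s := (p.map (algebraMap ℝ ℂ)).roots with hs
  have hcard : (s.map Complex.re).card = n := by
    rw [Multiset.card_map, hs, ← hsp.natDegree_eq_card_roots,
      Polynomial.natDegree_map_eq_of_injective (algebraMap ℝ ℂ).injective, hp]
  have hre : s = (s.map Complex.re).map (algebraMap ℝ ℂ) := by
    rw [Multiset.map_map]
    conv_lhs => rw [← Multiset.map_id s]
    refine Multiset.map_congr rfl fun z hz => ?_
    have := Multiset.countP_eq_zero.mp h z hz
    apply Complex.ext <;> simp_all
  obtain ⟨l, hl⟩ := Quot.exists_rep (s.map Complex.re)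
  have hl' : (l : Multiset ℝ) = s.map Complex.re := hl
  have hlen : l.length = n := by rw [← hcard, ← hl', Multiset.coe_card]
  subst hlen
  refine ⟨l.get, ?_⟩
  apply Polynomial.map_injective (algebraMap ℝ ℂ) (algebraMap ℝ ℂ).injective
  rw [hsp.eq_prod_roots, ← hs, hre, ← hl', Polynomial.leadingCoeff_map, splitPoly,
    Polynomial.map_mul, Polynomial.map_C]
  congr 1
  have hl2 : (∏ k, (Polynomial.X - Polynomial.C (l.get k))) =
      (l.map fun x => Polynomial.X - Polynomial.C x).prod := by
    rw [← List.prod_ofFn]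
    congr 1
    apply List.ext_get <;> simp
  rw [hl2, Polynomial.map_list_prod]
  simp [Function.comp_def]

lemma exists_splitCoeffs {n : ℕ} {a : Fin (n + 1) → ℝ} (ha : a (Fin.last n) ≠ 0)
    (h : nonrealRootCount (polyOfCoeffs n a) = 0) :
    ∃ α : Fin n → ℝ, a = splitCoeffs (a (Fin.last n)) α := by
  obtain ⟨α, hα⟩ := exists_splitPoly_of_nonrealRootCount (natDegree_polyOfCoeffs ha) h
  rw [leadingCoeff_polyOfCoeffs ha] at hα
  refine ⟨α, polyOfCoeffs_injective n ?_⟩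
  rw [polyOfCoeffs_splitCoeffs]
  exact hα

lemma rootProd_ne_zero_iff {n : ℕ} {α : Fin n → ℝ} :
    rootProd α ≠ 0 ↔ Function.Injective α := by
  simp only [rootProd, Finset.prod_ne_zero_iff, Finset.mem_univ, true_implies, Finset.mem_erase,
    and_true, abs_ne_zero, sub_ne_zero]
  constructor
  · intro h i j hij
    by_contra hne
    exact h i j (Ne.symm hne) hij
  · intro h i j hij
    exact fun e => hij (h e).symm

lemma splitPoly_comp_perm {n : ℕ} (a : ℝ) (α : Fin n → ℝ) (σ : Equiv.Perm (Fin n)) :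
    splitPoly a (α ∘ σ) = splitPoly a α := by
  unfold splitPoly
  congr 1
  exact Equiv.prod_comp σ fun k => Polynomial.X - Polynomial.C (α k)

lemma splitCoeffs_comp_perm {n : ℕ} (a : ℝ) (α : Fin n → ℝ) (σ : Equiv.Perm (Fin n)) :
    splitCoeffs a (α ∘ σ) = splitCoeffs a α := by
  unfold splitCoeffs
  rw [splitPoly_comp_perm]

lemma rootProd_eq_det_vandermonde_sq {n : ℕ} (α : Fin n → ℝ) :
    rootProd α = (Matrix.vandermonde α).det ^ 2 := by
  have key : rootProd α =
      (∏ i, ∏ j ∈ Finset.Ioi i, |α i - α j|) * ∏ i, ∏ j ∈ Finset.Iio i, |α i - α j| := by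
    rw [rootProd, ← Finset.prod_mul_distrib]
    refine Finset.prod_congr rfl fun i _ => ?_
    rw [← Finset.prod_union]
    · congr 1
      ext j
      simpa [or_comm] using ne_iff_lt_or_gt (a := j) (b := i)
    · rw [Finset.disjoint_left]
      intro j hj hj'
      simp only [Finset.mem_Ioi, Finset.mem_Iio] at hj hj'
      exact lt_asymm hj hj'
  have h2 : ∏ i, ∏ j ∈ Finset.Iio i, |α i - α j| = ∏ i, ∏ j ∈ Finset.Ioi i, |α i - α j| := by
    rw [Finset.prod_comm' (t' := Finset.univ) (s' := fun j => Finset.Ioi j) (by simp)]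
    simp only [abs_sub_comm]
  have h3 : ∏ i, ∏ j ∈ Finset.Ioi i, |α i - α j| = |(Matrix.vandermonde α).det| := by
    rw [Matrix.det_vandermonde]
    simp only [Finset.abs_prod, abs_sub_comm]
  rw [key, h2, h3, ← sq, sq_abs]

/-! ### The Jacobian of the map from roots to coefficients -/

open Polynomial in
-- The partial derivative in the root k deletes the factor k and changes the sign. The induction
-- adds one factor at a time, splitting (X - βₖ)P into X·P, a shift of coefficients, and βₖ·P.
-- Strictness is what later makes the map open.
lemma hasStrictFDerivAt_coeff_prod {ι : Type*} [Fintype ι] [DecidableEq ι] (s : Finset ι) (α : ι → ℝ) (i : ℕ) :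
    HasStrictFDerivAt (fun β : ι → ℝ => (∏ k ∈ s, (X - C (β k))).coeff i)
      (∑ k ∈ s, (-(∏ l ∈ s.erase k, (X - C (α l))).coeff i) •
        (ContinuousLinearMap.proj k : (ι → ℝ) →L[ℝ] ℝ)) α := by
  induction s using Finset.induction_on generalizing i with
  | empty =>
    simp only [Finset.prod_empty, Finset.sum_empty]
    exact hasStrictFDerivAt_const _ _
  | insert k s hk ih =>
    have hX : HasStrictFDerivAt (fun β : ι → ℝ => (X * ∏ k ∈ s, (X - C (β k))).coeff i)
        (∑ j ∈ s, (-(X * ∏ l ∈ s.erase j, (X - C (α l))).coeff i) •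
          (ContinuousLinearMap.proj j : (ι → ℝ) →L[ℝ] ℝ)) α := by
      cases i with
      | zero =>
        simp only [coeff_X_mul_zero, neg_zero, zero_smul, Finset.sum_const_zero]
        exact hasStrictFDerivAt_const _ _
      | succ i => simpa only [coeff_X_mul] using ih i
    have hp : HasStrictFDerivAt (fun β : ι → ℝ => β k)
        (ContinuousLinearMap.proj k : (ι → ℝ) →L[ℝ] ℝ) α :=
      (ContinuousLinearMap.proj k : (ι → ℝ) →L[ℝ] ℝ).hasStrictFDerivAt
    have h := hX.sub (hp.mul (ih i))
    have hfun : (fun β : ι → ℝ => (∏ k ∈ insert k s, (X - C (β k))).coeff i) =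
        fun β => (X * ∏ k ∈ s, (X - C (β k))).coeff i -
          β k * (∏ k ∈ s, (X - C (β k))).coeff i := by
      ext β
      rw [Finset.prod_insert hk, sub_mul, coeff_sub, coeff_C_mul]
    rw [hfun]
    refine h.congr_fderiv ?_
    ext v
    simp only [Finset.sum_insert hk, Finset.erase_insert hk]
    have he : ∀ j ∈ s, (∏ l ∈ (insert k s).erase j, (X - C (α l))) =
        (X - C (α k)) * ∏ l ∈ s.erase j, (X - C (α l)) := by
      intro j hj
      have hjk : j ≠ k := fun e => hk (e ▸ hj)
      rw [Finset.erase_insert_of_ne hjk.symm, Finset.prod_insert]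
      simp [hk]
    simp only [_root_.sub_apply, _root_.add_apply,
      _root_.sum_apply, _root_.smul_apply, ContinuousLinearMap.proj_apply,
      smul_eq_mul]
    have hs : ∑ j ∈ s, -(∏ l ∈ (insert k s).erase j, (X - C (α l))).coeff i * v j =
        ∑ j ∈ s, -(X * ∏ l ∈ s.erase j, (X - C (α l))).coeff i * v j -
          α k * ∑ j ∈ s, -(∏ l ∈ s.erase j, (X - C (α l))).coeff i * v j := by
      rw [Finset.mul_sum, ← Finset.sum_sub_distrib]
      refine Finset.sum_congr rfl fun j hj => ?_
      rw [he j hj, sub_mul, coeff_sub, coeff_C_mul]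
      ring
    rw [hs]
    ring

/-- The map sending leading coefficient and roots to the coefficient vector. -/
def rootMap (n : ℕ) (x : Fin (n + 1) → ℝ) : Fin (n + 1) → ℝ := splitCoeffs (x 0) (Fin.tail x)

open Polynomial in
/-- The polynomials whose coefficient vectors are the columns of the Jacobian of `rootMap`. -/
def rootJacCol {n : ℕ} (x : Fin (n + 1) → ℝ) : Fin (n + 1) → ℝ[X] :=
  Fin.cons (∏ k : Fin n, (X - C (x k.succ)))
    fun k => C (-x 0) * ∏ l ∈ Finset.univ.erase k, (X - C (x l.succ))

/-- The Jacobian matrix of `rootMap`. -/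
def rootJac {n : ℕ} (x : Fin (n + 1) → ℝ) : Matrix (Fin (n + 1)) (Fin (n + 1)) ℝ :=
  fun i j => (rootJacCol x j).coeff i

open Polynomial in
lemma hasStrictFDerivAt_rootMap {n : ℕ} (x : Fin (n + 1) → ℝ) :
    HasStrictFDerivAt (rootMap n) (LinearMap.toContinuousLinearMap (Matrix.toLin' (rootJac x))) x := by
  rw [hasStrictFDerivAt_pi']
  intro i
  have h0 : HasStrictFDerivAt (fun y : Fin (n + 1) → ℝ => y 0)
      (ContinuousLinearMap.proj 0 : (Fin (n + 1) → ℝ) →L[ℝ] ℝ) x :=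
    (ContinuousLinearMap.proj 0 : (Fin (n + 1) → ℝ) →L[ℝ] ℝ).hasStrictFDerivAt
  let T : (Fin (n + 1) → ℝ) →L[ℝ] (Fin n → ℝ) :=
    ContinuousLinearMap.pi fun k => ContinuousLinearMap.proj k.succ
  have h1 := (hasStrictFDerivAt_coeff_prod Finset.univ (T x) i).comp x T.hasStrictFDerivAt
  have h := h0.mul h1
  have hfun : (fun y : Fin (n + 1) → ℝ => rootMap n y i) =
      fun y => y 0 * (∏ k : Fin n, (X - C (T y k))).coeff i := by
    ext y
    simp [rootMap, splitCoeffs, splitPoly, T, Fin.tail]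
  rw [hfun]
  refine h.congr_fderiv ?_
  ext v
  simp only [_root_.add_apply, _root_.smul_apply,
    ContinuousLinearMap.comp_apply, _root_.sum_apply, ContinuousLinearMap.proj_apply,
    smul_eq_mul, LinearMap.coe_toContinuousLinearMap', Matrix.toLin'_apply, Matrix.mulVec,
    dotProduct, Fin.sum_univ_succ, rootJac, rootJacCol, Fin.cons_zero, Fin.cons_succ, coeff_C_mul,
    Finset.mul_sum, T, ContinuousLinearMap.coe_pi']
  rw [add_comm]
  congr 1
  · refine Finset.sum_congr rfl fun k _ => ?_
    ring

/-- The matrix evaluating a coefficient vector at the leading coefficient and at the roots. -/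
def evalMatrix {n : ℕ} (x : Fin (n + 1) → ℝ) : Matrix (Fin (n + 1)) (Fin (n + 1)) ℝ :=
  Fin.cons (Pi.single (Fin.last n) 1) fun k i => x k.succ ^ (i : ℕ)

lemma det_evalMatrix {n : ℕ} (x : Fin (n + 1) → ℝ) :
    (evalMatrix x).det = (-1) ^ n * (Matrix.vandermonde (Fin.tail x)).det := by
  rw [Matrix.det_succ_row_zero, Finset.sum_eq_single (Fin.last n)]
  · have : (evalMatrix x).submatrix Fin.succ (Fin.last n).succAbove =
        Matrix.vandermonde (Fin.tail x) := by
      ext i j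
      rw [Matrix.submatrix_apply, Fin.succAbove_last]
      rfl
    rw [this]
    simp [evalMatrix]
  · intro j _ hj
    simp [evalMatrix, hj]
  · simp

lemma sum_mul_coeff_eq_eval {n : ℕ} {p : ℝ[X]} (hp : p.natDegree ≤ n) (t : ℝ) :
    ∑ i : Fin (n + 1), t ^ (i : ℕ) * p.coeff i = p.eval t := by
  rw [Polynomial.eval_eq_sum_range' (Nat.lt_succ_of_le hp), Finset.sum_range]
  exact Finset.sum_congr rfl fun i _ => mul_comm _ _

lemma natDegree_rootJacCol_le {n : ℕ} (x : Fin (n + 1) → ℝ) (j : Fin (n + 1)) :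
    (rootJacCol x j).natDegree ≤ n := by
  refine Fin.cases ?_ (fun k => ?_) j
  · exact (natDegree_prod_X_sub_C (Fin.tail x)).le
  · refine (Polynomial.natDegree_C_mul_le _ _).trans ?_
    rw [Polynomial.natDegree_finsetProd_X_sub_C_eq_card]
    exact (Finset.card_le_univ _).trans (by simp)

/-- Each column of the Jacobian is a polynomial that vanishes at all roots, or at all but one;
reading off its leading coefficient and its values at the roots therefore gives a diagonal matrix,
and no minor has to be expanded. -/
lemma evalMatrix_mul_rootJac {n : ℕ} (x : Fin (n + 1) → ℝ) :
    evalMatrix x * rootJac x = Matrix.diagonal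
      (Fin.cons 1 fun k => -x 0 * ∏ l ∈ Finset.univ.erase k, (x k.succ - x l.succ)) := by
  ext i j
  rw [Matrix.mul_apply]
  refine Fin.cases ?_ (fun k => ?_) i
  · simp only [evalMatrix, Fin.cons_zero, rootJac]
    rw [Finset.sum_eq_single (Fin.last n) (by simp +contextual) (by simp)]
    refine Fin.cases ?_ (fun k => ?_) j
    · have h := (monic_prod_X_sub_C' (Fin.tail x)).coeff_natDegree
      rw [natDegree_prod_X_sub_C] at h
      simpa [rootJacCol, Fin.tail] using h
    · rw [Polynomial.coeff_eq_zero_of_natDegree_lt]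
      · simp [Matrix.diagonal, (Fin.succ_ne_zero k).symm]
      · refine (Polynomial.natDegree_C_mul_le _ _).trans_lt ?_
        rw [Polynomial.natDegree_finsetProd_X_sub_C_eq_card, Finset.card_erase_of_mem (by simp)]
        have := k.2
        simp
        omega
  · simp only [evalMatrix, Fin.cons_succ, rootJac]
    rw [sum_mul_coeff_eq_eval (natDegree_rootJacCol_le x j)]
    refine Fin.cases ?_ (fun l => ?_) j
    · simp only [rootJacCol, Fin.cons_zero, Polynomial.eval_prod]
      rw [Finset.prod_eq_zero (Finset.mem_univ k) (by simp)]
      simp [Matrix.diagonal]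
    · by_cases hkl : k = l
      · subst hkl
        simp [rootJacCol, Polynomial.eval_prod]
      · simp only [rootJacCol, Fin.cons_succ, Polynomial.eval_mul, Polynomial.eval_prod]
        rw [Finset.prod_eq_zero (i := k) (by simp [hkl]) (by simp)]
        simp [Matrix.diagonal, hkl]

/-- In absolute value the evaluation matrix has determinant V and the diagonal one |a|^n V^2.
Injectivity of the roots allows division by V. -/
lemma abs_det_rootJac {n : ℕ} {x : Fin (n + 1) → ℝ} (hx : Function.Injective (Fin.tail x)) :
    |(rootJac x).det| = |x 0| ^ n * |(Matrix.vandermonde (Fin.tail x)).det| := by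
  have h := congrArg (fun M => |M.det|) (evalMatrix_mul_rootJac x)
  simp only [Matrix.det_mul, Matrix.det_diagonal, det_evalMatrix, abs_mul, Fin.prod_univ_succ,
    Fin.cons_zero, Fin.cons_succ, Finset.prod_mul_distrib, abs_pow, abs_neg, abs_one, one_pow,
    one_mul, Finset.prod_const, Finset.card_univ, Fintype.card_fin, Finset.abs_prod] at h
  have h2 : ∏ k : Fin n, ∏ l ∈ Finset.univ.erase k, |x k.succ - x l.succ| =
      |(Matrix.vandermonde (Fin.tail x)).det| ^ 2 := by
    rw [sq_abs, ← rootProd_eq_det_vandermonde_sq]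
    rfl
  rw [h2] at h
  have h3 : |(Matrix.vandermonde (Fin.tail x)).det| ≠ 0 := by
    rw [abs_ne_zero]
    exact Matrix.det_vandermonde_ne_zero_iff.mpr hx
  apply mul_left_cancel₀ h3
  rw [h]
  ring

lemma rootMap_injOn (n : ℕ) :
    Set.InjOn (rootMap n) {x | x 0 ≠ 0 ∧ StrictMono (Fin.tail x)} := by
  intro x hx y hy hxy
  have h0 : x 0 = y 0 := by
    rw [← splitCoeffs_last (x 0) (Fin.tail x), ← splitCoeffs_last (y 0) (Fin.tail y)]
    exact congrFun hxy _
  have hp := congrArg (fun a => (polyOfCoeffs n a).roots) hxy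
  simp only [rootMap, polyOfCoeffs_splitCoeffs, roots_splitPoly hx.1, roots_splitPoly hy.1] at hp
  have hr : Set.range (Fin.tail x) = Set.range (Fin.tail y) := by
    ext t
    have := congrArg (fun s => t ∈ s) hp
    simpa using this
  have ht : Fin.tail x = Fin.tail y := (StrictMono.range_inj hx.2 hy.2).mp hr
  rw [← Fin.cons_self_tail x, ← Fin.cons_self_tail y, h0, ht]

lemma continuous_rootMap (n : ℕ) : Continuous (rootMap n) :=
  continuous_iff_continuousAt.mpr fun x => (hasStrictFDerivAt_rootMap x).continuousAt

/-- The Jacobian is invertible where a ≠ 0 and the roots are distinct, so the map is locally open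
there. -/
lemma isOpen_image_rootMap {n : ℕ} {s : Set (Fin (n + 1) → ℝ)} (hs : IsOpen s)
    (h : ∀ x ∈ s, x 0 ≠ 0 ∧ Function.Injective (Fin.tail x)) : IsOpen (rootMap n '' s) := by
  rw [isOpen_iff_mem_nhds]
  rintro _ ⟨x, hx, rfl⟩
  have hdet : (rootJac x).det ≠ 0 := by
    rw [← abs_ne_zero, abs_det_rootJac (h x hx).2]
    exact mul_ne_zero (pow_ne_zero _ (abs_ne_zero.mpr (h x hx).1))
      (abs_ne_zero.mpr (Matrix.det_vandermonde_ne_zero_iff.mpr (h x hx).2))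
  rw [← (hasStrictFDerivAt_rootMap x).map_nhds_eq_of_surj]
  · exact image_mem_map (hs.mem_nhds hx)
  · rw [LinearMap.range_eq_top]
    intro y
    refine ⟨(rootJac x)⁻¹.mulVec y, ?_⟩
    change (rootJac x).mulVec _ = y
    rw [Matrix.mulVec_mulVec, Matrix.mul_nonsing_inv _ (isUnit_iff_ne_zero.mpr hdet),
      Matrix.one_mulVec]

/-! ### Volume as an integral over leading coefficient and ordered roots -/

/-- Coefficient vectors of degree `n` polynomials with `n` distinct real roots and `|D| ≤ δ`. -/
def distinctRegion (n : ℕ) (δ : ℝ) : Set (Fin (n + 1) → ℝ) :=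
  {a | a (Fin.last n) ≠ 0 ∧ nonrealRootCount (polyOfCoeffs n a) = 0 ∧
    (polyOfCoeffs n a).discr ≠ 0 ∧ |(polyOfCoeffs n a).discr| ≤ δ}

/-- Parameters (leading coefficient, increasing roots) of the elements of `distinctRegion n δ`. -/
def orderedParams (n : ℕ) (δ : ℝ) : Set (Fin (n + 1) → ℝ) :=
  {x | x 0 ≠ 0 ∧ StrictMono (Fin.tail x) ∧
    |x 0| ^ (n - 1) * (Matrix.vandermonde (Fin.tail x)).det ≤ √δ}

lemma discr_splitPoly_ne_zero_iff {n : ℕ} (hn : 1 ≤ n) {c : ℝ} (hc : c ≠ 0) (α : Fin n → ℝ) :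
    (splitPoly c α).discr ≠ 0 ↔ Function.Injective α := by
  rw [← abs_ne_zero, abs_discr_splitPoly hn hc, ← rootProd_ne_zero_iff]
  simp [hc]

lemma splitCoeffs_mem_distinctRegion {n : ℕ} (hn : 1 ≤ n) {c δ : ℝ} {α : Fin n → ℝ} :
    splitCoeffs c α ∈ distinctRegion n δ ↔
      c ≠ 0 ∧ Function.Injective α ∧ |c| ^ (2 * n - 2) * rootProd α ≤ δ := by
  simp only [distinctRegion, Set.mem_ofPred_eq, splitCoeffs_last, polyOfCoeffs_splitCoeffs,
    nonrealRootCount_splitPoly, true_and]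
  refine and_congr_right fun hc => ?_
  rw [discr_splitPoly_ne_zero_iff hn hc, abs_discr_splitPoly hn hc]

lemma det_vandermonde_pos {n : ℕ} {α : Fin n → ℝ} (h : StrictMono α) :
    0 < (Matrix.vandermonde α).det := by
  rw [Matrix.det_vandermonde]
  refine Finset.prod_pos fun i _ => Finset.prod_pos fun j hj => ?_
  exact sub_pos.mpr (h (Finset.mem_Ioi.mp hj))

/-- Sorting picks one ordering of the roots, which makes the parametrization injective. Taking
square roots of |a|^(2n-2) V^2 ≤ δ is harmless because V > 0 on increasing tuples. -/
lemma image_orderedParams {n : ℕ} (hn : 1 ≤ n) (δ : ℝ) :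
    rootMap n '' orderedParams n δ = distinctRegion n δ := by
  have key : ∀ (c : ℝ) (α : Fin n → ℝ), c ≠ 0 → StrictMono α →
      (|c| ^ (2 * n - 2) * rootProd α ≤ δ ↔
        |c| ^ (n - 1) * (Matrix.vandermonde α).det ≤ √δ) := by
    intro c α hc hα
    rw [Real.le_sqrt' (mul_pos (pow_pos (abs_pos.mpr hc) _) (det_vandermonde_pos hα)), rootProd_eq_det_vandermonde_sq, mul_pow, ← pow_mul]
    rw [show (n - 1) * 2 = 2 * n - 2 by omega]
  ext a
  constructor
  · rintro ⟨x, ⟨h0, hm, hx⟩, rfl⟩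
    exact (splitCoeffs_mem_distinctRegion hn).mpr ⟨h0, hm.injective, (key _ _ h0 hm).mpr hx⟩
  · intro ha
    obtain ⟨α, hα⟩ := exists_splitCoeffs ha.1 ha.2.1
    set σ := Tuple.sort α
    rw [← splitCoeffs_comp_perm _ _ σ] at hα
    rw [hα] at ha
    obtain ⟨h0, hinj, hle⟩ := (splitCoeffs_mem_distinctRegion hn).mp ha
    have hm : StrictMono (α ∘ σ) := (Tuple.monotone_sort α).strictMono_of_injective hinj
    refine ⟨Fin.cons (a (Fin.last n)) (α ∘ σ), ⟨?_, ?_, ?_⟩, ?_⟩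
    · simpa using h0
    · simpa using hm
    · simpa using (key _ _ h0 hm).mp hle
    · rw [rootMap, Fin.tail_cons, Fin.cons_zero, ← hα]

lemma measurableSet_strictMono (n : ℕ) : MeasurableSet {α : Fin n → ℝ | StrictMono α} := by
  have : {α : Fin n → ℝ | StrictMono α} =
      ⋂ (i : Fin n) (j : Fin n) (_ : i < j), {α | α i < α j} := by
    ext α
    simp [StrictMono]
  rw [this]
  refine MeasurableSet.iInter fun i => MeasurableSet.iInter fun j => MeasurableSet.iInter fun _ =>
    measurableSet_lt (measurable_pi_apply i) (measurable_pi_apply j)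

lemma continuous_tail (n : ℕ) : Continuous (fun x : Fin (n + 1) → ℝ => Fin.tail x) :=
  continuous_pi fun _ => continuous_apply _

lemma continuous_det_vandermonde (n : ℕ) :
    Continuous fun α : Fin n → ℝ => (Matrix.vandermonde α).det := by
  simp only [Matrix.det_vandermonde]
  fun_prop

lemma measurableSet_orderedParams (n : ℕ) (δ : ℝ) : MeasurableSet (orderedParams n δ) := by
  refine MeasurableSet.inter ?_ (MeasurableSet.inter ?_ ?_)
  · exact (measurableSet_eq_fun (f := fun x : Fin (n + 1) → ℝ => x 0) (g := fun _ => 0)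
      (measurable_pi_apply 0) measurable_const).compl
  · exact (continuous_tail n).measurable (measurableSet_strictMono n)
  · have h1 : Continuous fun x : Fin (n + 1) → ℝ => |x 0| ^ (n - 1) := by fun_prop
    exact measurableSet_le (h1.mul ((continuous_det_vandermonde n).comp
      (continuous_tail n))).measurable (measurable_const (a := √δ))

lemma orderedParams_subset (n : ℕ) (δ : ℝ) :
    orderedParams n δ ⊆ {x | x 0 ≠ 0 ∧ StrictMono (Fin.tail x)} := fun _ hx => ⟨hx.1, hx.2.1⟩

lemma measurableSet_distinctRegion {n : ℕ} (hn : 1 ≤ n) (δ : ℝ) :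
    MeasurableSet (distinctRegion n δ) := by
  rw [← image_orderedParams hn]
  exact measurable_image_of_fderivWithin (measurableSet_orderedParams n δ)
    (fun x _ => (hasStrictFDerivAt_rootMap x).hasFDerivAt.hasFDerivWithinAt)
    ((rootMap_injOn n).mono (orderedParams_subset n δ))

lemma volume_inter_distinctRegion {n : ℕ} (hn : 1 ≤ n) (δ : ℝ) {K : Set (Fin (n + 1) → ℝ)}
    (hK : MeasurableSet K) :
    volume (K ∩ distinctRegion n δ) = ∫⁻ x in orderedParams n δ ∩ rootMap n ⁻¹' K,
      ENNReal.ofReal (|x 0| ^ n * (Matrix.vandermonde (Fin.tail x)).det) := by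
  have hm : MeasurableSet (orderedParams n δ ∩ rootMap n ⁻¹' K) :=
    (measurableSet_orderedParams n δ).inter ((continuous_rootMap n).measurable hK)
  rw [Set.inter_comm, ← image_orderedParams hn, ← Set.image_inter_preimage,
    ← lintegral_abs_det_fderiv_eq_addHaar_image volume hm
      (fun x _ => (hasStrictFDerivAt_rootMap x).hasFDerivAt.hasFDerivWithinAt)
      ((rootMap_injOn n).mono (Set.inter_subset_left.trans (orderedParams_subset n δ)))]
  refine setLIntegral_congr_fun hm fun x hx => ?_
  have hx' := hx.1.2.1
  have : (LinearMap.toContinuousLinearMap (Matrix.toLin' (rootJac x))).det = (rootJac x).det := by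
    rw [ContinuousLinearMap.det]
    simp
  simp only [this]
  rw [abs_det_rootJac hx'.injective, abs_of_pos (det_vandermonde_pos hx')]

/-- These vectors lie in the image of the hyperplanes xᵢ = xⱼ under a differentiable map between
spaces of equal dimension, and such an image of a null set is null. -/
lemma volume_repeated_root_eq_zero {n : ℕ} (hn : 1 ≤ n) :
    volume {a : Fin (n + 1) → ℝ | a (Fin.last n) ≠ 0 ∧
      nonrealRootCount (polyOfCoeffs n a) = 0 ∧ (polyOfCoeffs n a).discr = 0} = 0 := by
  set Z : Set (Fin (n + 1) → ℝ) := ⋃ (i : Fin n) (j : Fin n) (_ : i ≠ j),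
    {x | x i.succ = x j.succ}
  have hZ : volume Z = 0 := by
    refine measure_iUnion_null fun i => measure_iUnion_null fun j => measure_iUnion_null fun hij => ?_
    let f : (Fin (n + 1) → ℝ) →ₗ[ℝ] ℝ := LinearMap.proj (R := ℝ) (φ := fun _ => ℝ) i.succ -
      LinearMap.proj (R := ℝ) (φ := fun _ => ℝ) j.succ
    have : {x : Fin (n + 1) → ℝ | x i.succ = x j.succ} = (LinearMap.ker f : Set _) := by
      ext x
      simp [f, sub_eq_zero]
    rw [this]
    refine Measure.addHaar_submodule _ _ fun h => ?_
    have h1 : Pi.single i.succ (1 : ℝ) ∈ LinearMap.ker f := h ▸ Submodule.mem_top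
    simp [f, hij] at h1
  refine measure_mono_null ?_ (addHaar_image_eq_zero_of_differentiableOn_of_addHaar_eq_zero volume
    (f := rootMap n) (s := Z)
    (fun x _ => (hasStrictFDerivAt_rootMap x).hasFDerivAt.differentiableAt.differentiableWithinAt)
    hZ)
  rintro a ⟨ha, hr, hd⟩
  obtain ⟨α, hα⟩ := exists_splitCoeffs ha hr
  have hni : ¬ Function.Injective α := by
    rw [← discr_splitPoly_ne_zero_iff hn ha, not_not, ← polyOfCoeffs_splitCoeffs, ← hα]
    exact hd
  rw [Function.not_injective_iff] at hni
  obtain ⟨i, j, hij, hne⟩ := hni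
  refine ⟨Fin.cons (a (Fin.last n)) α, ?_, by rw [rootMap, Fin.tail_cons, Fin.cons_zero, ← hα]⟩
  simp only [Z, Set.mem_iUnion]
  exact ⟨i, j, hne, by simpa using hij⟩

lemma volume_discrRegion {n : ℕ} (hn : 1 ≤ n) (h : (Fin (n + 1) → ℝ) → ℝ) (δ : ℝ) :
    volume (discrRegion n h 0 δ) = volume ({a | h a ≤ 1} ∩ distinctRegion n δ) := by
  refine le_antisymm ?_ (measure_mono fun a ha => ⟨ha.2.1, by simpa using ha.2.2.1, ha.1, ha.2.2.2.2⟩)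
  have := measure_union_le (μ := volume) ({a | h a ≤ 1} ∩ distinctRegion n δ)
    {a : Fin (n + 1) → ℝ | a (Fin.last n) ≠ 0 ∧
      nonrealRootCount (polyOfCoeffs n a) = 0 ∧ (polyOfCoeffs n a).discr = 0}
  rw [volume_repeated_root_eq_zero hn, add_zero] at this
  refine le_trans (measure_mono fun a ha => ?_) this
  by_cases hd : (polyOfCoeffs n a).discr = 0
  · exact Or.inr ⟨ha.1, by simpa using ha.2.1, hd⟩
  · exact Or.inl ⟨ha.2.2.1, ha.1, by simpa using ha.2.1, hd, ha.2.2.2⟩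

/-! ### Gap coordinates -/

/-- The points with first element `b` and consecutive differences `g`. -/
def gapRoots {m : ℕ} (b : ℝ) (g : Fin m → ℝ) : Fin (m + 1) → ℝ :=
  fun k => b + ∑ l : Fin m, if l.castSucc < k then g l else 0

/-- The Vandermonde determinant as a function of the consecutive differences. -/
def gapDelta {m : ℕ} (g : Fin m → ℝ) : ℝ := (Matrix.vandermonde (gapRoots 0 g)).det

lemma gapRoots_zero {m : ℕ} (b : ℝ) (g : Fin m → ℝ) : gapRoots b g 0 = b := by
  simp [gapRoots]

lemma gapRoots_sub {m : ℕ} (b : ℝ) (g : Fin m → ℝ) (i j : Fin (m + 1)) :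
    gapRoots b g j - gapRoots b g i = gapRoots 0 g j - gapRoots 0 g i := by
  simp [gapRoots]

lemma det_vandermonde_gapRoots {m : ℕ} (b : ℝ) (g : Fin m → ℝ) :
    (Matrix.vandermonde (gapRoots b g)).det = gapDelta g := by
  simp only [gapDelta, Matrix.det_vandermonde]
  exact Finset.prod_congr rfl fun i _ => Finset.prod_congr rfl fun j _ => gapRoots_sub b g i j

lemma gapRoots_succ_sub_castSucc {m : ℕ} (b : ℝ) (g : Fin m → ℝ) (i j : Fin m) (hij : i ≤ j) :
    gapRoots b g j.succ - gapRoots b g i.castSucc = ∑ l ∈ Finset.Icc i j, g l := by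
  simp only [gapRoots, add_sub_add_left_eq_sub, ← Finset.sum_sub_distrib]
  rw [← Finset.sum_subset (Finset.subset_univ (Finset.Icc i j))]
  · refine Finset.sum_congr rfl fun l hl => ?_
    obtain ⟨h1, h2⟩ := Finset.mem_Icc.mp hl
    rw [if_pos (Fin.castSucc_lt_succ_iff.mpr h2),
      if_neg (fun h => h1.not_gt (Fin.castSucc_lt_castSucc_iff.mp h)), sub_zero]
  · intro l _ hl
    simp only [Finset.mem_Icc, not_and_or, not_le] at hl
    rcases hl with hl | hl
    · rw [if_pos (Fin.castSucc_lt_succ_iff.mpr (hl.trans_le hij).le),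
        if_pos (Fin.castSucc_lt_castSucc_iff.mpr hl), sub_self]
    · rw [if_neg (fun h => hl.not_ge (Fin.castSucc_lt_succ_iff.mp h)),
        if_neg (fun h => (hij.trans_lt hl).not_gt (Fin.castSucc_lt_castSucc_iff.mp h)), sub_zero]

lemma strictMono_gapRoots_iff {m : ℕ} {b : ℝ} {g : Fin m → ℝ} :
    StrictMono (gapRoots b g) ↔ ∀ l, 0 < g l := by
  rw [Fin.strictMono_iff_lt_succ]
  refine forall_congr' fun l => ?_
  rw [← sub_pos, gapRoots_succ_sub_castSucc b g l l le_rfl]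
  simp

lemma gapRoots_smul {m : ℕ} (r : ℝ) (g : Fin m → ℝ) (k : Fin (m + 1)) :
    gapRoots 0 (r • g) k = r * gapRoots 0 g k := by
  simp [gapRoots, Finset.mul_sum, mul_ite]

/-- The Vandermonde product has one factor, linear in the gaps, for each of the (m+1)m/2 pairs of
roots. -/
lemma gapDelta_smul {m : ℕ} (r : ℝ) (g : Fin m → ℝ) :
    gapDelta (r • g) = r ^ ((m + 1) * m / 2) * gapDelta g := by
  simp only [gapDelta, Matrix.det_vandermonde, gapRoots_smul, ← mul_sub, Finset.prod_mul_distrib,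
    Finset.prod_const, Fin.card_Ioi]
  congr 1
  rw [Finset.prod_pow_eq_pow_sum]
  congr 1
  rw [Fin.sum_univ_eq_sum_range (fun i => m + 1 - 1 - i) (m + 1),
    Finset.sum_range_reflect (fun i => i) (m + 1), Finset.sum_range_id]
  simp

lemma gapDelta_pos {m : ℕ} {g : Fin m → ℝ} (hg : ∀ l, 0 < g l) : 0 < gapDelta g :=
  det_vandermonde_pos (strictMono_gapRoots_iff.mpr hg)

lemma continuous_gapRoots (m : ℕ) :
    Continuous fun x : ℝ × (Fin m → ℝ) => gapRoots x.1 x.2 := by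
  refine continuous_pi fun k => ?_
  unfold gapRoots
  refine continuous_fst.add (continuous_finsetSum _ fun l _ => ?_)
  split_ifs <;> fun_prop

lemma continuous_gapDelta (m : ℕ) : Continuous (gapDelta : (Fin m → ℝ) → ℝ) :=
  (continuous_det_vandermonde (m + 1)).comp
    ((continuous_gapRoots m).comp (Continuous.prodMk_right (0 : ℝ)))

/-- Passing from smallest root and gaps to roots is a partial summation, whose matrix is lower
triangular with unit diagonal. -/
lemma measurePreserving_gapRoots (m : ℕ) :
    MeasurePreserving (fun x : ℝ × (Fin m → ℝ) => gapRoots x.1 x.2) := by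
  let T : Matrix (Fin (m + 1)) (Fin (m + 1)) ℝ := Matrix.of fun k i => if i ≤ k then 1 else 0
  have hT : T.det = 1 := by
    rw [Matrix.det_of_isLowerTriangular T]
    · simp [T]
    · intro i j hij
      simp [T] at hij ⊢
      exact hij
  have h1 : MeasurePreserving (Matrix.toLin' T) := by
    refine ⟨(Matrix.toLin' T).continuous_of_finiteDimensional.measurable, ?_⟩
    rw [Real.map_matrix_volume_pi_eq_smul_volume_pi (by simp [hT])]
    simp [hT]
  have h2 := (volume_preserving_piFinSuccAbove (fun _ : Fin (m + 1) => ℝ) 0).symm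
  have h3 := h1.comp h2
  have he : (fun x : ℝ × (Fin m → ℝ) => gapRoots x.1 x.2) =
      Matrix.toLin' T ∘ (MeasurableEquiv.piFinSuccAbove (fun _ : Fin (m + 1) => ℝ) 0).symm := by
    ext x k
    simp only [Function.comp_apply, Matrix.toLin'_apply, Matrix.mulVec, dotProduct,
      Fin.sum_univ_succ, T, Matrix.of_apply]
    simp [gapRoots, Fin.castSucc_lt_iff_succ_le]
  rw [he]
  exact h3

/-- Coordinates `(a, b, g)`: leading coefficient, smallest root, gaps between roots. -/
def gapParam {m : ℕ} (x : ℝ × ℝ × (Fin m → ℝ)) : Fin (m + 2) → ℝ :=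
  Fin.cons x.1 (gapRoots x.2.1 x.2.2)

lemma measurePreserving_gapParam (m : ℕ) :
    MeasurePreserving (gapParam : ℝ × ℝ × (Fin m → ℝ) → Fin (m + 2) → ℝ) := by
  have h2 := (volume_preserving_piFinSuccAbove (fun _ : Fin (m + 2) => ℝ) 0).symm
  have h1 := (MeasurePreserving.id (volume : Measure ℝ)).prod (measurePreserving_gapRoots m)
  have h3 := h2.comp h1
  have he : (gapParam : ℝ × ℝ × (Fin m → ℝ) → Fin (m + 2) → ℝ) =
      (MeasurableEquiv.piFinSuccAbove (fun _ : Fin (m + 2) => ℝ) 0).symm ∘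
        Prod.map id fun x => gapRoots x.1 x.2 := by
    ext x k
    simp [gapParam]
  rw [he]
  exact h3

/-! ### Finite volume of the normalized gap vectors -/

lemma gapDelta_eq_prod {m : ℕ} (g : Fin m → ℝ) : gapDelta g =
    ∏ i : Fin m, ∏ j : Fin m, if i ≤ j then ∑ l ∈ Finset.Icc i j, g l else 1 := by
  have h : ∀ i : Fin (m + 1), ∏ j ∈ Finset.Ioi i, (gapRoots 0 g j - gapRoots 0 g i) =
      ∏ j, if i < j then gapRoots 0 g j - gapRoots 0 g i else 1 := by
    intro i
    rw [← Finset.prod_filter]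
    congr 1
    ext j
    simp
  rw [gapDelta, Matrix.det_vandermonde]
  simp only [h]
  rw [Fin.prod_univ_castSucc]
  have hl : (∏ j, if Fin.last m < j then gapRoots 0 g j - gapRoots 0 g (Fin.last m) else 1) = 1 := by
    simp [not_lt.mpr (Fin.le_last _)]
  rw [hl, mul_one]
  refine Finset.prod_congr rfl fun i _ => ?_
  rw [Fin.prod_univ_succ]
  simp only [not_lt.mpr (Fin.zero_le _), if_false, one_mul, Fin.castSucc_lt_succ_iff]
  refine Finset.prod_congr rfl fun j _ => ?_
  split_ifs with hij
  · exact gapRoots_succ_sub_castSucc 0 g i j hij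
  · rfl

/-- Each factor of the product is a sum S of consecutive gaps from i to j, so S^2 ≥ gᵢgⱼ; multiplied
over all i ≤ j this gives (∏ g)^(m+1). If i or j equals M, the better bound S^2 ≥ g_M^2 holds, which
replaces the other endpoint by g_M. These replacements contribute ∏ (g_M / gₗ) = g_M^m / ∏ g in
total. The extra factor g_M is what controls the tail at infinity. -/
lemma max_mul_prod_pow_le_gapDelta_sq {m : ℕ} {g : Fin m → ℝ} (hg : ∀ l, 0 < g l) (M : Fin m)
    (hM : ∀ l, g l ≤ g M) : (g M * ∏ l, g l) ^ m ≤ gapDelta g ^ 2 := by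
  have hterm : ∀ i j : Fin m, ((if i ≤ j then g i else 1) * (if i ≤ j then g j else 1)) *
      ((if i = M then if M ≤ j then g M / g j else 1 else 1) *
        (if j = M then if i ≤ M then g M / g i else 1 else 1)) ≤
      (if i ≤ j then ∑ l ∈ Finset.Icc i j, g l else 1) ^ 2 := by
    intro i j
    have hgi := hg i
    have hgj := hg j
    have hgM := hg M
    by_cases hij : i ≤ j
    · simp only [hij, if_true]
      have hle : ∀ l ∈ Finset.Icc i j, g l ≤ ∑ l ∈ Finset.Icc i j, g l := fun l hl =>
        Finset.single_le_sum (fun k _ => (hg k).le) hl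
      have hi := hle i (by simp [hij])
      have hj := hle j (by simp [hij])
      have hMM : M ∈ Finset.Icc i j → g M * g M ≤ (∑ l ∈ Finset.Icc i j, g l) ^ 2 := fun h => by
        rw [sq]
        exact mul_self_le_mul_self hgM.le (hle M h)
      by_cases h1 : i = M
      · subst h1
        by_cases h2 : j = i
        · subst h2
          simpa [hgj.ne'] using hMM (by simp)
        · simp only [if_true, hij, h2, if_false, mul_one]
          refine le_trans (le_of_eq ?_) (hMM (by simp [hij]))
          field_simp
      · by_cases h2 : j = M
        · subst h2
          simp only [h1, hij, if_true, if_false, one_mul]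
          refine le_trans (le_of_eq ?_) (hMM (by simp [hij]))
          field_simp
        · simp only [h1, h2, if_false, mul_one]
          rw [sq]
          exact mul_le_mul hi hj hgj.le (hgi.le.trans hi)
    · have h1 : ¬ (i = M ∧ M ≤ j) := by rintro ⟨rfl, h⟩; exact hij h
      have h2 : ¬ (j = M ∧ i ≤ M) := by rintro ⟨rfl, h⟩; exact hij h
      simp only [← ite_and, h1, h2, hij, if_false]
      norm_num
  rw [gapDelta_eq_prod, ← Finset.prod_pow]
  simp only [← Finset.prod_pow]
  refine le_trans (le_of_eq ?_) (Finset.prod_le_prod (fun i _ => Finset.prod_nonneg fun j _ => ?_)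
    fun i _ => Finset.prod_le_prod (fun j _ => ?_) fun j _ => hterm i j)
  · simp only [Finset.prod_mul_distrib]
    have e2 : ∏ i : Fin m, ∏ j : Fin m, (if i ≤ j then g j else 1) =
        ∏ i : Fin m, ∏ j : Fin m, (if j ≤ i then g i else 1) := Finset.prod_comm
    have e12 : (∏ i : Fin m, ∏ j : Fin m, (if i ≤ j then g i else 1)) *
        (∏ i : Fin m, ∏ j : Fin m, (if j ≤ i then g i else 1)) = (∏ i, g i) ^ (m + 1) := by
      rw [← Finset.prod_mul_distrib, ← Finset.prod_pow]
      refine Finset.prod_congr rfl fun i _ => ?_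
      rw [← Finset.prod_mul_distrib]
      have : ∀ j, (if i ≤ j then g i else 1) * (if j ≤ i then g i else 1) =
          g i * if j = i then g i else 1 := by
        intro j
        rcases lt_trichotomy i j with h | h | h
        · simp [h.le, h.not_ge, h.ne']
        · simp [h]
        · simp [h.le, h.not_ge, h.ne]
      simp only [this, Finset.prod_mul_distrib, Finset.prod_const, Finset.card_univ,
        Fintype.card_fin, Finset.prod_ite_eq', Finset.mem_univ, if_true, pow_succ]
    have e3 : (∏ i : Fin m, ∏ j : Fin m,
        (if i = M then if M ≤ j then g M / g j else 1 else 1)) =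
        ∏ j, if M ≤ j then g M / g j else 1 := by
      rw [Finset.prod_comm]
      simp
    have e4 : (∏ i : Fin m, ∏ j : Fin m,
        (if j = M then if i ≤ M then g M / g i else 1 else 1)) =
        ∏ i, if i ≤ M then g M / g i else 1 := by
      simp
    have e34 : (∏ j, if M ≤ j then g M / g j else 1) * (∏ i, if i ≤ M then g M / g i else 1) =
        g M ^ m / ∏ i, g i := by
      rw [← Finset.prod_mul_distrib]
      have : ∀ j, (if M ≤ j then g M / g j else 1) * (if j ≤ M then g M / g j else 1) =
          g M / g j := by
        intro j
        rcases lt_trichotomy M j with h | h | h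
        · simp [h.le, h.not_ge]
        · subst h
          simp [(hg M).ne']
        · simp [h.le, h.not_ge]
      simp [this, Finset.prod_div_distrib]
    rw [e2, e12, e3, e4, e34, mul_pow, pow_succ]
    have hp : ∏ i, g i ≠ 0 := Finset.prod_ne_zero_iff.mpr fun i _ => (hg i).ne'
    field_simp
  all_goals
    have hgi := hg i
    have hgj := hg j
    have hgM := hg M
    positivity

/-- An integrable function on the half-line whose tensor powers dominate `{gapDelta ≤ 1}`. -/
def gapWeight (s t : ℝ) : ℝ → ℝ :=
  (Set.Ioi 0).indicator fun x => x ^ (-s) * max 1 x ^ (-t)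

lemma integrable_gapWeight {s t : ℝ} (hs : s < 1) (hst : 1 < s + t) :
    Integrable (gapWeight s t) := by
  rw [gapWeight, integrable_indicator_iff measurableSet_Ioi,
    ← Set.Ioc_union_Ioi_eq_Ioi zero_le_one, integrableOn_union]
  constructor
  · have h := (intervalIntegral.intervalIntegrable_rpow' (a := 0) (b := 1)
      (by linarith : -1 < -s)).1
    refine h.congr_fun (fun x hx => ?_) measurableSet_Ioc
    simp [max_eq_left hx.2]
  · have h := integrableOn_Ioi_rpow_of_lt (a := -(s + t)) (by linarith) (zero_lt_one)
    refine h.congr_fun (fun x hx => ?_) measurableSet_Ioi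
    have hx' : (1 : ℝ) < x := hx
    simp only [max_eq_right hx'.le]
    rw [← Real.rpow_add (by linarith)]
    congr 1
    ring

/-- On this set both ∏ g and g_M ∏ g are at most 1, where g_M is the largest gap. Raising (∏
g)·max(1, g_M) ≤ 1 to the power -s and distributing the maximum over the m coordinates places the
set inside a superlevel set of an integrable product function. -/
lemma volume_gapDelta_le_one_lt_top {m : ℕ} (hm : 1 ≤ m) :
    volume {g : Fin m → ℝ | (∀ l, 0 < g l) ∧ gapDelta g ≤ 1} < ⊤ := by
  have hm' : (0 : ℝ) < m := by exact_mod_cast hm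
  -- Integrability at 0 needs s < 1 and at infinity s + s/m > 1, that is s > m/(m+1). The value
  -- chosen is the midpoint of these two bounds.
  set s : ℝ := 1 - 1 / (2 * m + 2) with hs
  have hs1 : s < 1 := by
    have : (0 : ℝ) < 1 / (2 * m + 2) := by positivity
    linarith
  have hs0 : 0 < s := by
    have : (1 : ℝ) / (2 * m + 2) < 1 := by
      rw [div_lt_one (by positivity)]
      linarith
    linarith
  have hst : 1 < s + s / m := by
    have : s + s / m = 1 + 1 / (2 * m) := by
      rw [hs]
      field_simp
      ring
    rw [this]
    have : (0 : ℝ) < 1 / (2 * m) := by positivity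
    linarith
  have hint : Integrable fun g : Fin m → ℝ => ∏ l, gapWeight s (s / m) (g l) :=
    Integrable.fintype_prod fun _ => integrable_gapWeight hs1 hst
  refine lt_of_le_of_lt (measure_mono ?_) (hint.measure_ge_lt_top one_pos)
  rintro g ⟨hg, hle⟩
  have : Nonempty (Fin m) := ⟨⟨0, hm⟩⟩
  obtain ⟨M, hM⟩ := Finite.exists_max g
  have hP : 0 < ∏ l, g l := Finset.prod_pos fun l _ => hg l
  have h1 : g M * ∏ l, g l ≤ 1 := by
    have h := max_mul_prod_pow_le_gapDelta_sq hg M hM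
    have h2 : (g M * ∏ l, g l) ^ m ≤ 1 := h.trans (pow_le_one₀ (gapDelta_pos hg).le hle)
    exact (pow_le_one_iff_of_nonneg (mul_nonneg (hg M).le hP.le) (by omega)).mp h2
  have h2 : (∏ l, g l) * max 1 (g M) ≤ 1 := by
    rcases le_total (g M) 1 with h | h
    · rw [max_eq_left h, mul_one]
      exact Finset.prod_le_one (fun l _ => (hg l).le) fun l _ => (hM l).trans h
    · rw [max_eq_right h, mul_comm]
      exact h1
  change 1 ≤ ∏ l, gapWeight s (s / m) (g l)
  have h3 : ∀ l, gapWeight s (s / m) (g l) = g l ^ (-s) * max 1 (g l) ^ (-(s / m)) := fun l => by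
    simp [gapWeight, hg l]
  simp only [h3, Finset.prod_mul_distrib]
  rw [Real.finsetProd_rpow _ _ fun l _ => (hg l).le]
  -- Every gap is at most g_M, so each of the m factors with exponent -(s/m) is at least the
  -- corresponding power of max(1, g_M).
  have h4 : max 1 (g M) ^ (-s) ≤ ∏ l, max 1 (g l) ^ (-(s / m)) := by
    have : max 1 (g M) ^ (-s) = ∏ l : Fin m, max 1 (g M) ^ (-(s / m)) := by
      rw [Finset.prod_const, ← Real.rpow_natCast, ← Real.rpow_mul (by positivity)]
      congr 1
      simp
      field_simp
    rw [this]
    refine Finset.prod_le_prod (fun l _ => by positivity) fun l _ => ?_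
    exact Real.rpow_le_rpow_of_nonpos (by positivity) (max_le_max le_rfl (hM l))
      (by rw [neg_nonpos]; positivity)
  calc (1 : ℝ) ≤ ((∏ l, g l) * max 1 (g M)) ^ (-s) :=
        Real.one_le_rpow_of_pos_of_le_one_of_nonpos (by positivity) h2 (by linarith)
    _ = (∏ l, g l) ^ (-s) * max 1 (g M) ^ (-s) := Real.mul_rpow hP.le (by positivity)
    _ ≤ _ := mul_le_mul_of_nonneg_left h4 (by positivity)

/-! ### Rescaling the gaps and dominated convergence -/

/-- The scale of the gaps for which `|a| ^ m * gapDelta` equals `√δ` after normalization. -/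
def gapScale (m : ℕ) (δ a : ℝ) : ℝ := (√δ / |a| ^ m) ^ (((((m + 1) * m / 2 : ℕ) : ℝ))⁻¹)

lemma gapScale_pos {m : ℕ} {δ a : ℝ} (hδ : 0 < δ) (ha : a ≠ 0) : 0 < gapScale m δ a := by
  have := abs_pos.mpr ha
  unfold gapScale
  positivity

lemma triangular_pos {m : ℕ} (hm : 1 ≤ m) : 0 < (m + 1) * m / 2 :=
  Nat.div_pos (by nlinarith) two_pos

lemma gapScale_pow {m : ℕ} (hm : 1 ≤ m) {δ a : ℝ} :
    gapScale m δ a ^ ((m + 1) * m / 2) = √δ / |a| ^ m :=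
  Real.rpow_inv_natCast_pow (by positivity) (triangular_pos hm).ne'

lemma tendsto_gapScale {m : ℕ} (hm : 1 ≤ m) {a : ℝ} (ha : a ≠ 0) :
    Tendsto (fun δ => gapScale m δ a) (𝓝[>] 0) (𝓝[>] 0) := by
  refine tendsto_nhdsWithin_iff.mpr ⟨?_, ?_⟩
  · have h1 : Continuous fun δ => gapScale m δ a := by
      unfold gapScale
      exact (Real.continuous_sqrt.div_const _).rpow_const fun _ => Or.inr (by positivity)
    have h2 : gapScale m 0 a = 0 := by
      have := triangular_pos hm
      rw [gapScale, Real.sqrt_zero, zero_div, Real.zero_rpow]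
      exact inv_ne_zero (by exact_mod_cast this.ne')
    have h3 := h1.tendsto 0
    rw [h2] at h3
    exact h3.mono_left nhdsWithin_le_nhds
  · filter_upwards [self_mem_nhdsWithin] with δ hδ
    exact gapScale_pos hδ ha

/-- The bookkeeping of exponents: c^m is the volume factor of rescaling m gaps, and |a|^(m+1) c^N
comes from the Jacobian. With n = m+1 the power of δ is (n+2)/(2n). The power of |a| exceeds -1, so
it is integrable at 0. -/
lemma gapScale_pow_mul {m : ℕ} (hm : 1 ≤ m) {δ a : ℝ} (hδ : 0 < δ) (ha : a ≠ 0) :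
    gapScale m δ a ^ m * (|a| ^ (m + 1) * gapScale m δ a ^ ((m + 1) * m / 2)) =
      δ ^ (((m : ℝ) + 3) / (2 * (m + 1))) * |a| ^ ((2 : ℝ) / (m + 1) - 1) := by
  have ha' := abs_pos.mpr ha
  have hm' : (0 : ℝ) < m := by exact_mod_cast hm
  have hN : ((((m + 1) * m / 2 : ℕ) : ℝ)) = (m + 1) * m / 2 := by
    rw [Nat.cast_div (by simpa [mul_comm] using (Nat.even_mul_succ_self m).two_dvd) (by norm_num)]
    push_cast
    rfl
  rw [gapScale_pow hm, gapScale, hN, ← Real.rpow_natCast, ← Real.rpow_mul (by positivity),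
    Real.sqrt_eq_rpow, ← Real.rpow_natCast |a| m, ← Real.rpow_natCast |a| (m + 1),
    Real.div_rpow (by positivity) (by positivity), ← Real.rpow_mul hδ.le, ← Real.rpow_mul ha'.le,
    div_eq_mul_inv (δ ^ _), div_eq_mul_inv (δ ^ _), ← Real.rpow_neg ha'.le,
    ← Real.rpow_neg ha'.le]
  have e : ∀ x y z w u : ℝ, x * y * (z * (w * u)) = (x * w) * (z * y * u) := by intros; ring
  rw [e, ← Real.rpow_add hδ, ← Real.rpow_add ha', ← Real.rpow_add ha']
  congr 2
  · field_simp
    ring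
  · push_cast
    field_simp
    ring

lemma lintegral_eq_mul_lintegral_comp_smul {m : ℕ} {F : (Fin m → ℝ) → ENNReal} (hF : Measurable F)
    {c : ℝ} (hc : 0 < c) : ∫⁻ g, F g = ENNReal.ofReal (c ^ m) * ∫⁻ g, F (c • g) := by
  have h := Measure.map_addHaar_smul (volume : Measure (Fin m → ℝ)) hc.ne'
  have h2 : ∫⁻ g, F (c • g) = ∫⁻ g, F g ∂(Measure.map (c • ·) volume) :=
    (lintegral_map hF (measurable_const_smul c)).symm
  rw [h2, h, lintegral_smul_measure, smul_eq_mul, ← mul_assoc, ← ENNReal.ofReal_mul (by positivity)]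
  simp only [Module.finrank_fintype_fun_eq_card, Fintype.card_fin]
  rw [abs_of_pos (by positivity), mul_inv_cancel₀ (by positivity), ENNReal.ofReal_one, one_mul]

/-- The normalized gap vectors. -/
def unitGaps (m : ℕ) : Set (Fin m → ℝ) := {g | (∀ l, 0 < g l) ∧ gapDelta g ≤ 1}

lemma measurableSet_unitGaps (m : ℕ) : MeasurableSet (unitGaps m) := by
  have : unitGaps m = (⋂ l, {g | 0 < g l}) ∩ gapDelta ⁻¹' Set.Iic 1 := by
    ext
    simp [unitGaps]
  rw [this]
  exact (MeasurableSet.iInter fun l => measurableSet_lt measurable_const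
    (measurable_pi_apply l)).inter ((continuous_gapDelta m).measurable measurableSet_Iic)

/-- The limit density in gap coordinates. -/
def gapDensity {m : ℕ} (x : ℝ × ℝ × (Fin m → ℝ)) : ENNReal :=
  (unitGaps m).indicator (fun g => ENNReal.ofReal (|x.1| ^ ((2 : ℝ) / (m + 1) - 1) * gapDelta g)) x.2.2

/-- The integrand for the volume of `K ∩ distinctRegion (m + 1) δ`, divided by the expected
power of `δ`, in normalized gap coordinates with gaps rescaled by `c`. -/
def gapIntegrand {m : ℕ} (K : Set (Fin (m + 2) → ℝ)) (c : ℝ → ℝ) (x : ℝ × ℝ × (Fin m → ℝ)) :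
    ENNReal :=
  gapDensity x * K.indicator 1 (rootMap (m + 1) (gapParam (x.1, x.2.1, c x.1 • x.2.2)))

lemma measurable_gapDensity (m : ℕ) :
    Measurable (gapDensity : ℝ × ℝ × (Fin m → ℝ) → ENNReal) := by
  have : (gapDensity : ℝ × ℝ × (Fin m → ℝ) → ENNReal) =
      Set.indicator {x | x.2.2 ∈ unitGaps m}
        fun x => ENNReal.ofReal (|x.1| ^ ((2 : ℝ) / (m + 1) - 1) * gapDelta x.2.2) := by
    ext x
    by_cases h : x.2.2 ∈ unitGaps m <;> simp [gapDensity, h]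
  rw [this]
  refine Measurable.indicator ?_ ((measurableSet_unitGaps m).preimage (by fun_prop))
  have h1 : Measurable fun x : ℝ × ℝ × (Fin m → ℝ) => |x.1| ^ ((2 : ℝ) / (m + 1) - 1) := by
    fun_prop
  exact (h1.mul ((continuous_gapDelta m).measurable.comp (by fun_prop))).ennreal_ofReal

lemma measurable_gapIntegrand {m : ℕ} {K : Set (Fin (m + 2) → ℝ)} (hK : MeasurableSet K)
    {c : ℝ → ℝ} (hc : Measurable c) : Measurable (gapIntegrand K c) := by
  refine (measurable_gapDensity m).mul ((measurable_one.indicator hK).comp ?_)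
  refine (continuous_rootMap _).measurable.comp ((measurePreserving_gapParam m).measurable.comp ?_)
  fun_prop

lemma measurable_gapScale (m : ℕ) (δ : ℝ) : Measurable (gapScale m δ) := by
  unfold gapScale
  fun_prop

/-- For fixed a ≠ 0 and b, substitute g ↦ c·g with c = `gapScale m δ a`; the condition on the
discriminant then becomes `gapDelta g ≤ 1`, free of δ and a. What still depends on δ is only the
membership in K. -/
lemma volume_inter_distinctRegion_eq {m : ℕ} (hm : 1 ≤ m) {δ : ℝ} (hδ : 0 < δ)
    {K : Set (Fin (m + 2) → ℝ)} (hK : MeasurableSet K) :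
    volume (K ∩ distinctRegion (m + 1) δ) =
      ENNReal.ofReal (δ ^ (((m : ℝ) + 3) / (2 * (m + 1)))) *
        ∫⁻ x, gapIntegrand K (gapScale m δ) x := by
  have hmeas : MeasurableSet (orderedParams (m + 1) δ ∩ rootMap (m + 1) ⁻¹' K) :=
    (measurableSet_orderedParams _ δ).inter ((continuous_rootMap _).measurable hK)
  set f : (Fin (m + 2) → ℝ) → ENNReal := (orderedParams (m + 1) δ ∩ rootMap (m + 1) ⁻¹' K).indicator
    fun x => ENNReal.ofReal (|x 0| ^ (m + 1) * (Matrix.vandermonde (Fin.tail x)).det) with hf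
  have hfm : Measurable f := by
    refine Measurable.indicator ?_ hmeas
    have h1 : Continuous fun x : Fin (m + 2) → ℝ => |x 0| ^ (m + 1) := by fun_prop
    exact (h1.mul ((continuous_det_vandermonde _).comp (continuous_tail _))).measurable.ennreal_ofReal
  have hgm : Measurable fun x : ℝ × ℝ × (Fin m → ℝ) => f (gapParam x) :=
    hfm.comp (measurePreserving_gapParam m).measurable
  rw [volume_inter_distinctRegion (by omega) δ hK, ← lintegral_indicator hmeas,
    ← (measurePreserving_gapParam m).lintegral_comp hfm,
    ← lintegral_const_mul _ (measurable_gapIntegrand hK (measurable_gapScale m δ))]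
  simp only [Measure.volume_eq_prod]
  rw [lintegral_prod _ hgm.aemeasurable, lintegral_prod _
    ((measurable_gapIntegrand hK (measurable_gapScale m δ)).const_mul _).aemeasurable]
  -- The scale is positive only for a ≠ 0, so the line a = 0 is discarded.
  have hae : ∀ᵐ a : ℝ, a ≠ 0 := by simp [ae_iff]
  refine lintegral_congr_ae ?_
  filter_upwards [hae] with a ha
  have hl := lintegral_prod (μ := (volume : Measure ℝ)) (ν := (volume : Measure (Fin m → ℝ)))
    (fun y => f (gapParam (a, y))) (hgm.comp measurable_prodMk_left).aemeasurable
  have hr := lintegral_prod (μ := (volume : Measure ℝ)) (ν := (volume : Measure (Fin m → ℝ)))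
    (fun y => ENNReal.ofReal (δ ^ (((m : ℝ) + 3) / (2 * (m + 1)))) *
      gapIntegrand K (gapScale m δ) (a, y))
    (((measurable_gapIntegrand hK (measurable_gapScale m δ)).const_mul _).comp
      measurable_prodMk_left).aemeasurable
  rw [hl, hr]
  refine lintegral_congr fun b => ?_
  set c := gapScale m δ a with hc
  have hcpos : 0 < c := gapScale_pos hδ ha
  have ha' := abs_pos.mpr ha
  have hsm : Measurable fun g : Fin m → ℝ => f (gapParam (a, b, g)) :=
    hgm.comp (measurable_prodMk_left.comp measurable_prodMk_left)
  have hsc : Measurable fun g : Fin m → ℝ => f (gapParam (a, b, c • g)) :=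
    hsm.comp (measurable_const_smul c)
  rw [lintegral_eq_mul_lintegral_comp_smul hsm hcpos, ← lintegral_const_mul _ hsc]
  refine lintegral_congr fun g => ?_
  have hmem : gapParam (a, b, c • g) ∈ orderedParams (m + 1) δ ↔ g ∈ unitGaps m := by
    simp only [orderedParams, unitGaps, Set.mem_ofPred_eq, gapParam, Fin.cons_zero, Fin.tail_cons,
      strictMono_gapRoots_iff, det_vandermonde_gapRoots, gapDelta_smul,
      Pi.smul_apply, smul_eq_mul, mul_pos_iff_of_pos_left hcpos, Nat.add_sub_cancel]
    rw [hc, gapScale_pow hm]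
    refine ⟨fun h => ⟨h.2.1, ?_⟩, fun h => ⟨ha, h.1, ?_⟩⟩
    · have h2 := h.2.2
      rw [← mul_assoc, mul_div_cancel₀ _ (by positivity)] at h2
      exact le_of_mul_le_mul_left (by simpa using h2) (Real.sqrt_pos.mpr hδ)
    · rw [← mul_assoc, mul_div_cancel₀ _ (by positivity)]
      exact mul_le_of_le_one_right (Real.sqrt_nonneg _) h.2
  by_cases h1 : g ∈ unitGaps m
  · by_cases h2 : rootMap (m + 1) (gapParam (a, b, c • g)) ∈ K
    · have h3 : gapParam (a, b, c • g) ∈ orderedParams (m + 1) δ ∩ rootMap (m + 1) ⁻¹' K :=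
        ⟨hmem.mpr h1, h2⟩
      simp only [hf, gapIntegrand, gapDensity, Set.indicator_of_mem h1, Set.indicator_of_mem h3,
        ← hc, Set.indicator_of_mem h2, Pi.one_apply, mul_one]
      rw [← ENNReal.ofReal_mul (by positivity), ← ENNReal.ofReal_mul (by positivity)]
      congr 1
      simp only [gapParam, Fin.cons_zero, Fin.tail_cons, det_vandermonde_gapRoots, gapDelta_smul]
      have := gapScale_pow_mul hm hδ ha
      rw [← hc] at this
      linear_combination (gapDelta g) * this
    · have h3 : gapParam (a, b, c • g) ∉ orderedParams (m + 1) δ ∩ rootMap (m + 1) ⁻¹' K :=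
        fun h => h2 h.2
      simp only [hf, gapIntegrand, Set.indicator_of_notMem h3, ← hc, Set.indicator_of_notMem h2,
        mul_zero]
  · have h3 : gapParam (a, b, c • g) ∉ orderedParams (m + 1) δ ∩ rootMap (m + 1) ⁻¹' K :=
      fun h => h1 (hmem.mp h.1)
    simp only [hf, gapIntegrand, gapDensity, Set.indicator_of_notMem h3,
      Set.indicator_of_notMem h1, mul_zero, zero_mul]

/-- An integrable bound for `gapIntegrand`. -/
def gapBound {m : ℕ} (A B : ℝ) (x : ℝ × ℝ × (Fin m → ℝ)) : ENNReal :=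
  (Set.Icc (-A) A).indicator (fun a => ENNReal.ofReal (|a| ^ ((2 : ℝ) / (m + 1) - 1))) x.1 *
    ((Set.Icc (-B) B).indicator 1 x.2.1 * (unitGaps m).indicator 1 x.2.2)

lemma lintegral_gapBound_ne_top {m : ℕ} (hm : 1 ≤ m) (A B : ℝ) :
    ∫⁻ x : ℝ × ℝ × (Fin m → ℝ), gapBound A B x ≠ ⊤ := by
  have h1 : Measurable ((Set.Icc (-A) A).indicator
      fun a : ℝ => ENNReal.ofReal (|a| ^ ((2 : ℝ) / (m + 1) - 1))) :=
    Measurable.indicator (by fun_prop) measurableSet_Icc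
  have h2 : Measurable ((Set.Icc (-B) B).indicator (1 : ℝ → ENNReal)) :=
    measurable_one.indicator measurableSet_Icc
  have h3 : Measurable ((unitGaps m).indicator (1 : (Fin m → ℝ) → ENNReal)) :=
    measurable_one.indicator (measurableSet_unitGaps m)
  have e2 : ∫⁻ y : ℝ × (Fin m → ℝ), (Set.Icc (-B) B).indicator (1 : ℝ → ENNReal) y.1 *
      (unitGaps m).indicator (1 : (Fin m → ℝ) → ENNReal) y.2 =
      (∫⁻ b, (Set.Icc (-B) B).indicator (1 : ℝ → ENNReal) b) *
        ∫⁻ g, (unitGaps m).indicator (1 : (Fin m → ℝ) → ENNReal) g :=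
    lintegral_prod_mul h2.aemeasurable h3.aemeasurable
  have e1 : ∫⁻ x : ℝ × ℝ × (Fin m → ℝ), gapBound A B x = _ :=
    lintegral_prod_mul (μ := (volume : Measure ℝ)) (ν := (volume : Measure (ℝ × (Fin m → ℝ))))
      h1.aemeasurable (g := fun y : ℝ × (Fin m → ℝ) => (Set.Icc (-B) B).indicator 1 y.1 *
        (unitGaps m).indicator 1 y.2)
      ((h2.comp measurable_fst).mul (h3.comp measurable_snd)).aemeasurable
  rw [e1, e2, lintegral_indicator measurableSet_Icc, lintegral_indicator_one measurableSet_Icc,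
    lintegral_indicator_one (measurableSet_unitGaps m)]
  refine ENNReal.mul_ne_top ?_ (ENNReal.mul_ne_top (by simp)
    (volume_gapDelta_le_one_lt_top hm).ne)
  have hexp : (-1 : ℝ) < (2 : ℝ) / (m + 1) - 1 := by
    have : (0 : ℝ) < 2 / (m + 1) := by positivity
    linarith
  have hI : IntegrableOn (fun a : ℝ => |a| ^ ((2 : ℝ) / (m + 1) - 1)) (Set.Icc (-A) A) := by
    have hpos : ∀ C : ℝ, IntegrableOn (fun a : ℝ => |a| ^ ((2 : ℝ) / (m + 1) - 1)) (Set.Ioc 0 C) := by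
      intro C
      refine (intervalIntegral.intervalIntegrable_rpow' (a := 0) (b := C) hexp).1.congr_fun
        (fun x hx => ?_) measurableSet_Ioc
      simp only [abs_of_pos hx.1]
    have hneg : IntegrableOn (fun a : ℝ => |a| ^ ((2 : ℝ) / (m + 1) - 1)) (Set.Ico (-A) 0) := by
      have h := (hpos A).comp_neg
      simpa using h
    have hz : IntegrableOn (fun a : ℝ => |a| ^ ((2 : ℝ) / (m + 1) - 1)) {(0 : ℝ)} :=
      integrableOn_singleton (by simp) (by simp)
    refine ((hneg.union (hpos A)).union hz).mono_set ?_
    intro x hx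
    rcases lt_trichotomy x 0 with h | h | h
    · exact Or.inl (Or.inl ⟨hx.1, h⟩)
    · exact Or.inr (Set.mem_singleton_iff.mpr h)
    · exact Or.inl (Or.inr ⟨h, hx.2⟩)
  have := hI.2
  rw [hasFiniteIntegral_iff_ofReal (Eventually.of_forall fun x => by positivity)] at this
  exact this.ne

/-- Volume asymptotics of `K ∩ distinctRegion (m + 1) δ` for sets `K` which are bounded in gap
coordinates and asymptotically insensitive to the gaps. -/
lemma tendsto_volume_inter_distinctRegion {m : ℕ} (hm : 1 ≤ m) {K : Set (Fin (m + 2) → ℝ)}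
    (hK : MeasurableSet K) (A B : ℝ)
    (hbd : ∀ (a b : ℝ) (g : Fin m → ℝ), a ≠ 0 → b ≠ 0 →
      rootMap (m + 1) (gapParam (a, b, g)) ∈ K → |a| ≤ A ∧ |b| ≤ B)
    (hlim : ∀ᵐ x : ℝ × ℝ × (Fin m → ℝ), ∀ᶠ r in 𝓝[>] (0 : ℝ),
      (rootMap (m + 1) (gapParam (x.1, x.2.1, r • x.2.2)) ∈ K ↔
        rootMap (m + 1) (gapParam (x.1, x.2.1, 0)) ∈ K)) :
    Tendsto (fun δ : ℝ => volume (K ∩ distinctRegion (m + 1) δ) /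
      ENNReal.ofReal (δ ^ (((m : ℝ) + 3) / (2 * (m + 1))))) (𝓝[>] 0)
      (𝓝 (∫⁻ x, gapIntegrand K 0 x)) ∧ ∫⁻ x, gapIntegrand K 0 x ≠ ⊤ := by
  have ha0 : ∀ᵐ x : ℝ × ℝ × (Fin m → ℝ), x.1 ≠ 0 :=
    (Measure.quasiMeasurePreserving_fst).ae (p := fun a : ℝ => a ≠ 0) (by simp [ae_iff])
  have hb0 : ∀ᵐ x : ℝ × ℝ × (Fin m → ℝ), x.2.1 ≠ 0 :=
    (Measure.quasiMeasurePreserving_snd).ae (p := fun y : ℝ × (Fin m → ℝ) => y.1 ≠ 0)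
      ((Measure.quasiMeasurePreserving_fst).ae (p := fun a : ℝ => a ≠ 0) (by simp [ae_iff]))
  have hle : ∀ (c : ℝ → ℝ) (x : ℝ × ℝ × (Fin m → ℝ)), x.1 ≠ 0 → x.2.1 ≠ 0 →
      gapIntegrand K c x ≤ gapBound A B x := by
    rintro c ⟨a, b, g⟩ ha hb
    by_cases h1 : g ∈ unitGaps m
    · by_cases h2 : rootMap (m + 1) (gapParam (a, b, c a • g)) ∈ K
      · obtain ⟨hA, hB⟩ := hbd a b _ ha hb h2
        have hA' : a ∈ Set.Icc (-A) A := abs_le.mp hA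
        have hB' : b ∈ Set.Icc (-B) B := abs_le.mp hB
        simp only [gapIntegrand, gapBound, gapDensity, Set.indicator_of_mem h1,
          Set.indicator_of_mem h2, Set.indicator_of_mem hA', Set.indicator_of_mem hB',
          Pi.one_apply, mul_one]
        exact ENNReal.ofReal_le_ofReal (mul_le_of_le_one_right (by positivity) h1.2)
      · simp [gapIntegrand, h2]
    · simp [gapIntegrand, gapDensity, h1]
  refine ⟨?_, ?_⟩
  · have hT : Tendsto (fun δ : ℝ => ∫⁻ x, gapIntegrand K (gapScale m δ) x) (𝓝[>] 0)
        (𝓝 (∫⁻ x, gapIntegrand K 0 x)) := by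
      refine tendsto_lintegral_filter_of_dominated_convergence (gapBound A B)
        (Eventually.of_forall fun δ =>
          (measurable_gapIntegrand hK (measurable_gapScale m δ)))
        (Eventually.of_forall fun δ => ?_) (lintegral_gapBound_ne_top hm A B) ?_
      · filter_upwards [ha0, hb0] with x h1 h2 using hle _ x h1 h2
      -- At almost every point the integrand already equals its limit for all small δ, because the
      -- scale tends to 0 from the right.
      · filter_upwards [ha0, hlim] with x h1 h2
        refine tendsto_const_nhds.congr' ?_
        filter_upwards [(tendsto_gapScale hm h1).eventually h2] with δ hδ
        by_cases h3 : rootMap (m + 1) (gapParam (x.1, x.2.1, 0)) ∈ K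
        · have h4 := hδ.mpr h3
          simp [gapIntegrand, h3, h4]
        · have h4 : rootMap (m + 1) (gapParam (x.1, x.2.1, gapScale m δ x.1 • x.2.2)) ∉ K :=
            fun h => h3 (hδ.mp h)
          simp [gapIntegrand, h3, h4]
    refine hT.congr' ?_
    filter_upwards [self_mem_nhdsWithin] with δ hδ
    have hδ' : (0 : ℝ) < δ := hδ
    rw [volume_inter_distinctRegion_eq hm hδ' hK, mul_comm, ENNReal.mul_div_cancel_right]
    · simp; positivity
    · simp
  · refine ne_top_of_le_ne_top (lintegral_gapBound_ne_top hm A B) (lintegral_mono_ae ?_)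
    filter_upwards [ha0, hb0] with x h1 h2 using hle _ x h1 h2

/-! ### A volume-preserving substitution making roots bounded -/

open Polynomial in
/-- The matrix of `q ↦ (x - t) ^ n q(1 / (x - t))` on coefficient vectors. -/
def mobiusMatrix (n : ℕ) (t : ℝ) : Matrix (Fin (n + 1)) (Fin (n + 1)) ℝ :=
  Matrix.of fun i k => ((X - C t) ^ (n - (k : ℕ))).coeff i

/-- The map `q ↦ (x - t) ^ n q(1 / (x - t))` on coefficient vectors. -/
def mobius (n : ℕ) (t : ℝ) : (Fin (n + 1) → ℝ) →ₗ[ℝ] (Fin (n + 1) → ℝ) :=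
  Matrix.toLin' (mobiusMatrix n t)

/-- After reversing the columns the matrix holds the coefficients of (X - t)^k, so it is upper
triangular with unit diagonal. -/
lemma abs_det_mobius (n : ℕ) (t : ℝ) : |LinearMap.det (mobius n t)| = 1 := by
  rw [mobius, LinearMap.det_toLin',
    ← Matrix.abs_det_submatrix_equiv_equiv (Equiv.refl _) Fin.revPerm (mobiusMatrix n t)]
  have h : ∀ i k, (mobiusMatrix n t).submatrix (Equiv.refl _) Fin.revPerm i k =
      ((Polynomial.X - Polynomial.C t) ^ (k : ℕ)).coeff i := by
    intro i k
    simp only [mobiusMatrix, Matrix.submatrix_apply, Matrix.of_apply, Fin.revPerm_apply,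
      Fin.val_rev, Equiv.refl_apply]
    congr 2
    omega
  rw [Matrix.det_of_isUpperTriangular]
  · rw [Finset.prod_eq_one, abs_one]
    intro i _
    rw [h]
    have := ((Polynomial.monic_X_sub_C t).pow (i : ℕ)).coeff_natDegree
    rwa [Polynomial.natDegree_pow, Polynomial.natDegree_X_sub_C, mul_one] at this
  · intro i k hki
    rw [h]
    refine Polynomial.coeff_eq_zero_of_natDegree_lt ?_
    rw [Polynomial.natDegree_pow, Polynomial.natDegree_X_sub_C, mul_one]
    exact hki

lemma det_mobius_ne_zero (n : ℕ) (t : ℝ) : LinearMap.det (mobius n t) ≠ 0 := by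
  rw [← abs_ne_zero, abs_det_mobius]
  exact one_ne_zero

lemma mobius_injective (n : ℕ) (t : ℝ) : Function.Injective (mobius n t) :=
  (LinearMap.equivOfDetNeZero _ (det_mobius_ne_zero n t)).injective

lemma continuous_mobius (n : ℕ) (t : ℝ) : Continuous (mobius n t) :=
  (mobius n t).continuous_of_finiteDimensional

lemma volume_preimage_mobius {n : ℕ} (t : ℝ) (s : Set (Fin (n + 1) → ℝ)) :
    volume (mobius n t ⁻¹' s) = volume s := by
  rw [Measure.addHaar_preimage_linearMap _ (det_mobius_ne_zero n t), abs_inv, abs_det_mobius]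
  simp

lemma polyOfCoeffs_mobius {n : ℕ} (t : ℝ) (q : Fin (n + 1) → ℝ) :
    polyOfCoeffs n (mobius n t q) =
      ∑ k : Fin (n + 1), Polynomial.C (q k) * (Polynomial.X - Polynomial.C t) ^ (n - (k : ℕ)) := by
  rw [← polyOfCoeffs_coeff_eq (p := ∑ k : Fin (n + 1), _) (n := n)]
  · congr 1
    ext i
    simp [mobius, mobiusMatrix, Matrix.mulVec, dotProduct, mul_comm]
  · refine Polynomial.natDegree_sum_le_of_forall_le _ _ fun k _ => ?_
    refine (Polynomial.natDegree_C_mul_le _ _).trans ?_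
    rw [Polynomial.natDegree_pow, Polynomial.natDegree_X_sub_C]
    omega

lemma sum_splitCoeffs_mul_pow {n : ℕ} (a : ℝ) (β : Fin n → ℝ) (y : ℝ) :
    ∑ k, splitCoeffs a β k * y ^ (n - (k : ℕ)) = a * ∏ k, (1 - β k * y) := by
  by_cases hy : y = 0
  · subst hy
    rw [Finset.sum_eq_single (Fin.last n)]
    · simp [splitCoeffs_last]
    · intro k _ hk
      have : n - (k : ℕ) ≠ 0 := by
        have := Fin.val_lt_last hk
        omega
      simp [this]
    · simp
  · have h := eval_splitPoly a β y⁻¹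
    rw [← polyOfCoeffs_splitCoeffs, eval_polyOfCoeffs] at h
    calc ∑ k, splitCoeffs a β k * y ^ (n - (k : ℕ))
        = y ^ n * ∑ k, splitCoeffs a β k * y⁻¹ ^ (k : ℕ) := by
          rw [Finset.mul_sum]
          refine Finset.sum_congr rfl fun k _ => ?_
          rw [pow_sub₀ _ hy (Nat.lt_succ_iff.mp k.2), inv_pow]
          ring
      _ = a * ∏ k, (y * (y⁻¹ - β k)) := by
          rw [h, Finset.prod_mul_distrib]
          simp
          ring
      _ = a * ∏ k, (1 - β k * y) := by
          congr 1
          refine Finset.prod_congr rfl fun k _ => ?_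
          rw [mul_sub, mul_inv_cancel₀ hy, mul_comm]

lemma eval_mobius_splitCoeffs {n : ℕ} (t a : ℝ) (β : Fin n → ℝ) (x : ℝ) :
    (polyOfCoeffs n (mobius n t (splitCoeffs a β))).eval x = a * ∏ k, (1 - β k * (x - t)) := by
  rw [polyOfCoeffs_mobius, ← sum_splitCoeffs_mul_pow]
  simp [Polynomial.eval_finsetSum]

lemma mobius_splitCoeffs {n : ℕ} (t a : ℝ) {β : Fin n → ℝ} (hβ : ∀ k, β k ≠ 0) :
    mobius n t (splitCoeffs a β) = splitCoeffs (a * ∏ k, (-β k)) fun k => t + (β k)⁻¹ := by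
  refine polyOfCoeffs_injective n (Polynomial.funext fun x => ?_)
  rw [eval_mobius_splitCoeffs, polyOfCoeffs_splitCoeffs, eval_splitPoly, mul_assoc,
    ← Finset.prod_mul_distrib]
  congr 1
  refine Finset.prod_congr rfl fun k _ => ?_
  have := hβ k
  field_simp
  ring

/-- Since 1/βᵢ - 1/βⱼ = -(βᵢ - βⱼ)/(βᵢβⱼ), each |βₖ| occurs 2(n-1) times in the denominators. This
is exactly what the new leading coefficient a ∏ (-βₖ) contributes to the discriminant, so |D| is
preserved. -/
lemma rootProd_inv {n : ℕ} (t : ℝ) {β : Fin n → ℝ} (hβ : ∀ k, β k ≠ 0) :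
    (∏ k, |β k|) ^ (2 * n - 2) * rootProd (fun k => t + (β k)⁻¹) = rootProd β := by
  have h1 : ∏ i : Fin n, ∏ _j ∈ Finset.univ.erase i, |β i| = (∏ k, |β k|) ^ (n - 1) := by
    simp [Finset.card_erase_of_mem, Finset.prod_pow]
  have h2 : ∏ i : Fin n, ∏ j ∈ Finset.univ.erase i, |β j| = (∏ k, |β k|) ^ (n - 1) := by
    rw [← h1]
    exact Finset.prod_comm' (by simp [eq_comm])
  rw [show 2 * n - 2 = (n - 1) + (n - 1) by omega, pow_add]
  nth_rw 1 [← h1]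
  rw [← h2, rootProd, rootProd, ← Finset.prod_mul_distrib, ← Finset.prod_mul_distrib]
  refine Finset.prod_congr rfl fun i _ => ?_
  rw [← Finset.prod_mul_distrib, ← Finset.prod_mul_distrib]
  refine Finset.prod_congr rfl fun j _ => ?_
  rw [← abs_mul, ← abs_mul, ← abs_neg]
  congr 1
  have hi := hβ i
  have hj := hβ j
  field_simp
  ring

lemma mobius_mem_distinctRegion_iff {n : ℕ} (hn : 1 ≤ n) (t : ℝ) {a δ : ℝ} {β : Fin n → ℝ}
    (hβ : ∀ k, β k ≠ 0) :
    mobius n t (splitCoeffs a β) ∈ distinctRegion n δ ↔ splitCoeffs a β ∈ distinctRegion n δ := by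
  rw [mobius_splitCoeffs t a hβ, splitCoeffs_mem_distinctRegion hn,
    splitCoeffs_mem_distinctRegion hn]
  refine and_congr ?_ (and_congr ?_ ?_)
  · simp [Finset.prod_eq_zero_iff, hβ]
  · constructor
    · intro h i j hij
      exact h (by simp [hij])
    · intro h i j hij
      exact h (by simpa using hij)
  · rw [← rootProd_inv t hβ, abs_mul, mul_pow, Finset.abs_prod]
    simp only [abs_neg, mul_assoc]

lemma exists_mobius_eq {n : ℕ} (t c : ℝ) {α : Fin n → ℝ} (hα : ∀ k, α k ≠ t) :
    ∃ (a : ℝ) (β : Fin n → ℝ), (∀ k, β k ≠ 0) ∧ mobius n t (splitCoeffs a β) = splitCoeffs c α := by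
  have hβ : ∀ k, (α k - t)⁻¹ ≠ 0 := fun k => inv_ne_zero (sub_ne_zero.mpr (hα k))
  refine ⟨c / ∏ k, (-(α k - t)⁻¹), fun k => (α k - t)⁻¹, hβ, ?_⟩
  rw [mobius_splitCoeffs _ _ hβ, div_mul_cancel₀]
  · congr
    ext k
    simp
  · exact Finset.prod_ne_zero_iff.mpr fun k _ => neg_ne_zero.mpr (hβ k)

/-! ### Decomposition into cells without roots near an integer -/

/-- Coefficient vectors of polynomials without roots near the integer `j`. -/
def noRootNear (n j : ℕ) : Set (Fin (n + 1) → ℝ) :=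
  {p | ∀ x ∈ Set.Icc ((j : ℝ) - 1 / 4) (j + 1 / 4), (polyOfCoeffs n p).eval x ≠ 0}

lemma continuous_eval_polyOfCoeffs (n : ℕ) :
    Continuous fun z : (Fin (n + 1) → ℝ) × ℝ => (polyOfCoeffs n z.1).eval z.2 := by
  simp only [eval_polyOfCoeffs]
  fun_prop

lemma isOpen_noRootNear (n j : ℕ) : IsOpen (noRootNear n j) := by
  rw [isOpen_iff_mem_nhds]
  intro p hp
  have h := (isCompact_Icc (a := (j : ℝ) - 1 / 4) (b := j + 1 / 4)).eventually_forall_of_forall_eventually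
    (x₀ := p) (P := fun q x => (polyOfCoeffs n q).eval x ≠ 0) (fun x hx =>
      (continuous_eval_polyOfCoeffs n).continuousAt.eventually_ne (hp x hx))
  exact h

/-- A disjoint family of sets covering the polynomials of degree at most `n`. -/
def rootCell (n j : ℕ) : Set (Fin (n + 1) → ℝ) := noRootNear n j ∩ ⋂ i ∈ Finset.range j, (noRootNear n i)ᶜ

lemma measurableSet_rootCell (n j : ℕ) : MeasurableSet (rootCell n j) :=
  (isOpen_noRootNear n j).measurableSet.inter
    (Finset.measurableSet_biInter _ fun i _ => (isOpen_noRootNear n i).measurableSet.compl)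

lemma disjoint_rootCell {n i j : ℕ} (hij : i ≠ j) : Disjoint (rootCell n i) (rootCell n j) := by
  wlog h : i < j generalizing i j
  · exact (this hij.symm (by omega)).symm
  rw [Set.disjoint_left]
  intro p hi hj
  exact Set.mem_iInter₂.mp hj.2 i (Finset.mem_range.mpr h) hi.1

/-- The n+1 intervals of radius 1/4 about 0, ..., n are disjoint and at most n roots are available,
so some interval is free of roots; the least such index gives the cell. -/
lemma exists_mem_rootCell {n : ℕ} {p : Fin (n + 1) → ℝ} (hp : p ≠ 0) :
    ∃ j ∈ Finset.range (n + 1), p ∈ rootCell n j := by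
  have hex : ∃ j, j < n + 1 ∧ p ∈ noRootNear n j := by
    by_contra! hcon
    have hcon' : ∀ j : Fin (n + 1), ∃ x ∈ Set.Icc (((j : ℕ) : ℝ) - 1 / 4) ((j : ℕ) + 1 / 4),
        (polyOfCoeffs n p).eval x = 0 := by
      intro j
      have := hcon j j.2
      simpa [noRootNear, and_assoc] using this
    choose x hx hx0 using hcon'
    have hP : polyOfCoeffs n p ≠ 0 := by
      intro h
      apply hp
      ext i
      rw [← polyOfCoeffs_coeff p, h]
      simp
    have hinj : Function.Injective x := by
      intro i j hij
      have h1 := hx i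
      have h2 := hx j
      rw [hij] at h1
      rw [Set.mem_Icc] at h1 h2
      have h3 : ((i : ℕ) : ℝ) < (j : ℕ) + 1 := by linarith [h1.1, h2.2]
      have h4 : ((j : ℕ) : ℝ) < (i : ℕ) + 1 := by linarith [h2.1, h1.2]
      have h5 : (i : ℕ) < j + 1 := by exact_mod_cast h3
      have h6 : (j : ℕ) < i + 1 := by exact_mod_cast h4
      exact Fin.ext (by omega)
    have hcard : (Finset.univ.image x).card ≤ (polyOfCoeffs n p).roots.toFinset.card := by
      refine Finset.card_le_card fun y hy => ?_
      obtain ⟨j, -, rfl⟩ := Finset.mem_image.mp hy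
      simpa [hP] using hx0 j
    rw [Finset.card_image_of_injective _ hinj, Finset.card_univ, Fintype.card_fin] at hcard
    have := (Multiset.toFinset_card_le _).trans
      ((polyOfCoeffs n p).card_roots'.trans (natDegree_polyOfCoeffs_le p))
    omega
  classical
  refine ⟨Nat.find hex, Finset.mem_range.mpr (Nat.find_spec hex).1, (Nat.find_spec hex).2, ?_⟩
  refine Set.mem_iInter₂.mpr fun i hi hmem => ?_
  exact Nat.find_min hex (Finset.mem_range.mp hi)
    ⟨(Finset.mem_range.mp hi).trans (Nat.find_spec hex).1, hmem⟩

/-- The part of the unit height region with roots in the cell `j`, transformed such that its roots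
are bounded. -/
def cellRegion (n : ℕ) (h : (Fin (n + 1) → ℝ) → ℝ) (j : ℕ) : Set (Fin (n + 1) → ℝ) :=
  mobius n j ⁻¹' (rootCell n j ∩ {p | h p ≤ 1})

lemma measurableSet_cellRegion {n : ℕ} {h : (Fin (n + 1) → ℝ) → ℝ} (hh : Continuous h) (j : ℕ) :
    MeasurableSet (cellRegion n h j) :=
  (continuous_mobius n j).measurable
    ((measurableSet_rootCell n j).inter (hh.measurable measurableSet_Iic))

lemma volume_coord_zero (n : ℕ) : ∀ᵐ q : Fin (n + 1) → ℝ, q 0 ≠ 0 := by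
  let f : (Fin (n + 1) → ℝ) →ₗ[ℝ] ℝ := LinearMap.proj (R := ℝ) (φ := fun _ => ℝ) 0
  have h := Measure.addHaar_submodule (volume : Measure (Fin (n + 1) → ℝ)) (LinearMap.ker f)
    (fun h => by
      have h1 : Pi.single 0 (1 : ℝ) ∈ LinearMap.ker f := h ▸ Submodule.mem_top
      simp [f] at h1)
  rw [ae_iff]
  refine measure_mono_null (fun q hq => ?_) h
  simpa [f] using hq

/-- The two sets agree up to the null set `q 0 = 0`, where q has the root 0 and the substitution
lowers the degree. Conversely, a polynomial in the cell has no root at j and so comes from nonzero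
β. -/
lemma volume_rootCell_inter {n : ℕ} (hn : 1 ≤ n) (h : (Fin (n + 1) → ℝ) → ℝ) (j : ℕ) (δ : ℝ) :
    volume ((rootCell n j ∩ {p | h p ≤ 1}) ∩ distinctRegion n δ) =
      volume (cellRegion n h j ∩ distinctRegion n δ) := by
  rw [← volume_preimage_mobius (j : ℝ), Set.preimage_inter]
  refine measure_congr ?_
  filter_upwards [volume_coord_zero n] with q hq
  refine propext (and_congr_right fun hK => ?_)
  constructor
  · intro hq2
    have hq3 : mobius n j q ∈ distinctRegion n δ := hq2
    obtain ⟨α, hα⟩ := exists_splitCoeffs hq3.1 hq3.2.1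
    have hαt : ∀ k, α k ≠ j := by
      intro k hk
      refine hK.1.1 j (by constructor <;> linarith) ?_
      rw [hα, polyOfCoeffs_splitCoeffs, eval_splitPoly,
        Finset.prod_eq_zero (Finset.mem_univ k) (by rw [hk, sub_self]), mul_zero]
    obtain ⟨a, β, hβ, he⟩ := exists_mobius_eq (j : ℝ) (mobius n j q (Fin.last n)) hαt
    rw [← hα] at he
    rw [← mobius_injective n j he]
    rw [← mobius_injective n j he] at hq3
    exact (mobius_mem_distinctRegion_iff hn j hβ).mp hq3
  · intro hq2
    have hq3 : q ∈ distinctRegion n δ := hq2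
    obtain ⟨β, hβ⟩ := exists_splitCoeffs hq3.1 hq3.2.1
    have hβ0 : ∀ k, β k ≠ 0 := by
      intro k hk
      apply hq
      have h1 := eval_polyOfCoeffs q 0
      rw [hβ, polyOfCoeffs_splitCoeffs, eval_splitPoly,
        Finset.prod_eq_zero (Finset.mem_univ k) (by rw [hk, sub_self]), mul_zero, ← hβ,
        Finset.sum_eq_single 0] at h1
      · simpa using h1.symm
      · intro i _ hi
        simp [Fin.val_ne_zero_iff.mpr hi]
      · simp
    change mobius n j q ∈ distinctRegion n δ
    rw [hβ] at hq3 ⊢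
    exact (mobius_mem_distinctRegion_iff hn j hβ0).mpr hq3

/-! ### The limit in each cell and the constant -/

/-- The constant is the minimum of H on the compact unit sphere, extended by homogeneity. -/
lemma exists_mul_norm_le {E : Type*} [NormedAddCommGroup E] [NormedSpace ℝ E]
    [FiniteDimensional ℝ E] {H : E → ℝ} (hc : Continuous H)
    (hhom : ∀ (t : ℝ) (w : E), H (t • w) = |t| * H w) (hpos : ∀ w, w ≠ 0 → 0 < H w) :
    ∃ c > 0, ∀ w, c * ‖w‖ ≤ H w := by
  have : ProperSpace E := FiniteDimensional.proper ℝ E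
  have hH0 : H 0 = 0 := by simpa using hhom 0 0
  rcases (Metric.sphere (0 : E) 1).eq_empty_or_nonempty with he | hne
  · refine ⟨1, one_pos, fun w => ?_⟩
    by_cases hw : w = 0
    · simp [hw, hH0]
    · have : (‖w‖⁻¹ • w) ∈ Metric.sphere (0 : E) 1 := by
        simp [norm_smul, hw]
      rw [he] at this
      exact this.elim
  · obtain ⟨u, hu, hmin⟩ := (isCompact_sphere (0 : E) 1).exists_isMinOn hne hc.continuousOn
    have hu0 : u ≠ 0 := by
      rintro rfl
      simp at hu
    refine ⟨H u, hpos u hu0, fun w => ?_⟩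
    by_cases hw : w = 0
    · simp [hw, hH0]
    · have h1 : (‖w‖⁻¹ • w) ∈ Metric.sphere (0 : E) 1 := by
        simp [norm_smul, hw]
      have h2 := hmin h1
      have h3 : H u ≤ |‖w‖⁻¹| * H w := (hhom _ w) ▸ h2
      rw [abs_of_nonneg (by positivity)] at h3
      have hw' : 0 < ‖w‖ := norm_pos_iff.mpr hw
      calc H u * ‖w‖ ≤ (‖w‖⁻¹ * H w) * ‖w‖ := mul_le_mul_of_nonneg_right h3 hw'.le
        _ = H w := by field_simp

lemma IsHeightFunction.pos {n : ℕ} {h : (Fin (n + 1) → ℝ) → ℝ} (hh : IsHeightFunction n h)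
    {w : Fin (n + 1) → ℝ} (hw : w ≠ 0) : 0 < h w :=
  lt_of_le_of_ne (hh.nonneg w) fun e => hw ((hh.eq_zero_iff w).mp e.symm)

lemma rootMap_gapParam {m : ℕ} (a b : ℝ) (g : Fin m → ℝ) :
    rootMap (m + 1) (gapParam (a, b, g)) = splitCoeffs a (gapRoots b g) := by
  simp [rootMap, gapParam]

lemma continuous_gapParam (m : ℕ) :
    Continuous (gapParam : ℝ × ℝ × (Fin m → ℝ) → Fin (m + 2) → ℝ) := by
  refine continuous_pi fun k => Fin.cases ?_ (fun k => ?_) k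
  · exact continuous_fst
  · have h := (continuous_apply k).comp ((continuous_gapRoots m).comp
      (continuous_snd (X := ℝ) (Y := ℝ × (Fin m → ℝ))))
    exact h

lemma eval_mobius_gap_eq_zero {m : ℕ} (t a b : ℝ) (g : Fin m → ℝ) (hb : b ≠ 0) :
    (polyOfCoeffs (m + 1) (mobius (m + 1) t (splitCoeffs a (gapRoots b g)))).eval (t + b⁻¹) = 0 := by
  rw [eval_mobius_splitCoeffs, Finset.prod_eq_zero (Finset.mem_univ 0), mul_zero]
  rw [gapRoots_zero, add_sub_cancel_left, mul_inv_cancel₀ hb, sub_self]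

lemma eval_mobius_zero_gap {m : ℕ} (t a b x : ℝ) :
    (polyOfCoeffs (m + 1) (mobius (m + 1) t (splitCoeffs a (gapRoots b (0 : Fin m → ℝ))))).eval x =
      a * (1 - b * (x - t)) ^ (m + 1) := by
  rw [eval_mobius_splitCoeffs]
  simp [gapRoots]

lemma splitCoeffs_smul {n : ℕ} (a : ℝ) (α : Fin n → ℝ) :
    splitCoeffs a α = a • splitCoeffs 1 α := by
  ext i
  simp [splitCoeffs, splitPoly, Polynomial.coeff_C_mul]

/-- The height bounds the coefficient vector and with it a. A root b with |b| > 4 would become the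
root j + 1/b, within 1/4 of j. -/
lemma cellRegion_bounded {m : ℕ} {h : (Fin (m + 2) → ℝ) → ℝ} (hh : IsHeightFunction (m + 1) h)
    (j : ℕ) : ∃ A : ℝ, ∀ (a b : ℝ) (g : Fin m → ℝ), a ≠ 0 → b ≠ 0 →
      rootMap (m + 1) (gapParam (a, b, g)) ∈ cellRegion (m + 1) h j → |a| ≤ A ∧ |b| ≤ 4 := by
  obtain ⟨c, hc, hle⟩ := exists_mul_norm_le (H := fun w => h (mobius (m + 1) j w))
    (hh.continuous.comp (continuous_mobius _ _)) (fun t w => by simp [hh.homogeneous])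
    (fun w hw => hh.pos fun e => hw (mobius_injective _ _ (by rw [e, map_zero])))
  refine ⟨c⁻¹, fun a b g ha hb hmem => ?_⟩
  rw [rootMap_gapParam] at hmem
  obtain ⟨⟨hno, -⟩, hh1⟩ := hmem
  constructor
  · have h1 := (hle (splitCoeffs a (gapRoots b g))).trans hh1
    have h2 := norm_le_pi_norm (splitCoeffs a (gapRoots b g)) (Fin.last _)
    rw [splitCoeffs_last, Real.norm_eq_abs] at h2
    rw [← one_div, le_div_iff₀ hc, mul_comm]
    exact (mul_le_mul_of_nonneg_left h2 hc.le).trans h1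
  · by_contra! hb4
    have h1 : |b⁻¹| ≤ 1 / 4 := by
      rw [abs_inv, one_div]
      exact inv_anti₀ (by norm_num) hb4.le
    rw [abs_le] at h1
    exact hno ((j : ℝ) + b⁻¹) ⟨by linarith, by linarith⟩ (eval_mobius_gap_eq_zero _ a b g hb)

/-- Having no root near i is an open condition, so it survives small gaps. The converse is exact:
the only root of the collapsed polynomial is t + 1/b, and it remains a root for every r because b is
the smallest root before the substitution whatever the gaps. -/
lemma noRootNear_eventually_iff {m : ℕ} (i : ℕ) (t a b : ℝ) (hb : b ≠ 0) (ha : a ≠ 0)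
    (g : Fin m → ℝ) : ∀ᶠ r in 𝓝 (0 : ℝ),
      (mobius (m + 1) t (rootMap (m + 1) (gapParam (a, b, r • g))) ∈ noRootNear (m + 1) i ↔
        mobius (m + 1) t (rootMap (m + 1) (gapParam (a, b, 0))) ∈ noRootNear (m + 1) i) := by
  by_cases h0 : mobius (m + 1) t (rootMap (m + 1) (gapParam (a, b, (0 : Fin m → ℝ)))) ∈
      noRootNear (m + 1) i
  · have hc : Continuous fun r : ℝ => mobius (m + 1) t (rootMap (m + 1) (gapParam (a, b, r • g))) :=
      (continuous_mobius _ _).comp ((continuous_rootMap _).comp ((continuous_gapParam m).comp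
        (by fun_prop)))
    have := hc.continuousAt.preimage_mem_nhds ((isOpen_noRootNear (m + 1) i).mem_nhds
      (x := mobius (m + 1) t (rootMap (m + 1) (gapParam (a, b, (0 : ℝ) • g)))) (by simpa using h0))
    filter_upwards [this] with r hr
    exact ⟨fun _ => h0, fun _ => hr⟩
  · refine Eventually.of_forall fun r => ⟨fun hr => ?_, fun h => absurd h h0⟩
    exfalso
    simp only [noRootNear, Set.mem_ofPred_eq, not_forall, not_not] at h0
    obtain ⟨x, hx, h0⟩ := h0
    rw [rootMap_gapParam, eval_mobius_zero_gap] at h0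
    have h1 : 1 - b * (x - t) = 0 := by
      rcases mul_eq_zero.mp h0 with h | h
      · exact absurd h ha
      · exact pow_eq_zero_iff (by omega) |>.mp h
    have h2 : x = t + b⁻¹ := by
      field_simp
      linarith
    rw [rootMap_gapParam] at hr
    exact hr x hx (h2 ▸ eval_mobius_gap_eq_zero t a b (r • g) hb)

lemma cellRegion_eventually_iff {m : ℕ} {h : (Fin (m + 2) → ℝ) → ℝ} (hh : Continuous h)
    (j : ℕ) {a b : ℝ} (hb : b ≠ 0) (ha : a ≠ 0)
    (h1 : h (mobius (m + 1) j (splitCoeffs a (gapRoots b (0 : Fin m → ℝ)))) ≠ 1)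
    (g : Fin m → ℝ) : ∀ᶠ r in 𝓝 (0 : ℝ),
      (rootMap (m + 1) (gapParam (a, b, r • g)) ∈ cellRegion (m + 1) h j ↔
        rootMap (m + 1) (gapParam (a, b, 0)) ∈ cellRegion (m + 1) h j) := by
  have hA : ∀ᶠ r in 𝓝 (0 : ℝ), ∀ i ∈ Finset.range (j + 1),
      (mobius (m + 1) j (rootMap (m + 1) (gapParam (a, b, r • g))) ∈ noRootNear (m + 1) i ↔
        mobius (m + 1) j (rootMap (m + 1) (gapParam (a, b, 0))) ∈ noRootNear (m + 1) i) := by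
    rw [Finset.eventually_all]
    exact fun i _ => noRootNear_eventually_iff i j a b hb ha g
  have hc : Continuous fun r : ℝ =>
      h (mobius (m + 1) j (rootMap (m + 1) (gapParam (a, b, r • g)))) :=
    hh.comp ((continuous_mobius _ _).comp ((continuous_rootMap _).comp ((continuous_gapParam m).comp
      (by fun_prop))))
  have hc0 : h (mobius (m + 1) j (rootMap (m + 1) (gapParam (a, b, (0 : ℝ) • g)))) ≠ 1 := by
    rwa [zero_smul, rootMap_gapParam]
  have hB : ∀ᶠ r in 𝓝 (0 : ℝ),
      (h (mobius (m + 1) j (rootMap (m + 1) (gapParam (a, b, r • g)))) ≤ 1 ↔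
        h (mobius (m + 1) j (rootMap (m + 1) (gapParam (a, b, 0)))) ≤ 1) := by
    rcases lt_or_gt_of_ne hc0 with hlt | hgt
    · filter_upwards [hc.continuousAt.eventually_lt_const hlt] with r hr
      rw [zero_smul] at hlt
      exact ⟨fun _ => hlt.le, fun _ => hr.le⟩
    · filter_upwards [hc.continuousAt.eventually_const_lt hgt] with r hr
      rw [zero_smul] at hgt
      exact ⟨fun h => absurd h hr.not_ge, fun h => absurd h hgt.not_ge⟩
  filter_upwards [hA, hB] with r hr1 hr2
  simp only [cellRegion, rootCell, Set.mem_preimage, Set.mem_inter_iff, Set.mem_iInter,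
    Set.mem_compl_iff, Set.mem_ofPred_eq]
  refine and_congr (and_congr (hr1 j (by simp)) ?_) hr2
  refine forall_congr' fun i => forall_congr' fun hi => ?_
  rw [hr1 i (by simp at hi ⊢; omega)]

/-- By homogeneity the height is |a| times a function of the other variables, so for fixed other
variables at most two values of a give height 1. -/
lemma ae_height_ne_one {m : ℕ} {h : (Fin (m + 2) → ℝ) → ℝ} (hh : IsHeightFunction (m + 1) h)
    (t : ℝ) : ∀ᵐ x : ℝ × ℝ × (Fin m → ℝ),
      h (mobius (m + 1) t (splitCoeffs x.1 (gapRoots x.2.1 (0 : Fin m → ℝ)))) ≠ 1 := by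
  set w : ℝ × (Fin m → ℝ) → ℝ := fun y =>
    h (mobius (m + 1) t (rootMap (m + 1) (gapParam (1, y.1, (0 : Fin m → ℝ))))) with hw
  have hwc : Continuous w := hh.continuous.comp ((continuous_mobius _ _).comp
    ((continuous_rootMap _).comp ((continuous_gapParam m).comp (by fun_prop))))
  have heq : ∀ x : ℝ × ℝ × (Fin m → ℝ),
      h (mobius (m + 1) t (splitCoeffs x.1 (gapRoots x.2.1 (0 : Fin m → ℝ)))) = |x.1| * w x.2 := by
    intro x
    simp only [hw, rootMap_gapParam]
    rw [splitCoeffs_smul, map_smul, hh.homogeneous]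
  simp only [heq]
  rw [ae_iff]
  have hmeas : MeasurableSet {x : ℝ × ℝ × (Fin m → ℝ) | ¬ |x.1| * w x.2 ≠ 1} := by
    have h1 : Continuous fun x : ℝ × ℝ × (Fin m → ℝ) => |x.1| * w x.2 := by fun_prop
    have h2 := h1.measurable (measurableSet_singleton 1)
    convert h2 using 1
    ext x
    simp
  rw [Measure.volume_eq_prod, Measure.prod_apply_symm hmeas, lintegral_eq_zero_iff
    (measurable_measure_prodMk_right hmeas)]
  refine Eventually.of_forall fun y => ?_
  refine measure_mono_null (t := {(w y)⁻¹, -(w y)⁻¹}) (fun a ha => ?_)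
    ((Set.toFinite _).measure_zero _)
  have ha' : |a| * w y = 1 := by simpa using ha
  have h2 : |a| = (w y)⁻¹ := eq_inv_of_mul_eq_one_left ha'
  rcases abs_choice a with h3 | h3
  · left; rw [← h2, h3]
  · right; simp [← h2, h3]

lemma tendsto_volume_cellRegion {m : ℕ} (hm : 1 ≤ m) {h : (Fin (m + 2) → ℝ) → ℝ}
    (hh : IsHeightFunction (m + 1) h) (j : ℕ) :
    Tendsto (fun δ : ℝ => volume (cellRegion (m + 1) h j ∩ distinctRegion (m + 1) δ) /
      ENNReal.ofReal (δ ^ (((m : ℝ) + 3) / (2 * (m + 1))))) (𝓝[>] 0)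
      (𝓝 (∫⁻ x, gapIntegrand (cellRegion (m + 1) h j) 0 x)) ∧
      ∫⁻ x, gapIntegrand (cellRegion (m + 1) h j) 0 x ≠ ⊤ := by
  obtain ⟨A, hA⟩ := cellRegion_bounded hh j
  refine tendsto_volume_inter_distinctRegion hm (measurableSet_cellRegion hh.continuous j) A 4 hA ?_
  have ha0 : ∀ᵐ x : ℝ × ℝ × (Fin m → ℝ), x.1 ≠ 0 :=
    (Measure.quasiMeasurePreserving_fst).ae (p := fun a : ℝ => a ≠ 0) (by simp [ae_iff])
  have hb0 : ∀ᵐ x : ℝ × ℝ × (Fin m → ℝ), x.2.1 ≠ 0 :=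
    (Measure.quasiMeasurePreserving_snd).ae (p := fun y : ℝ × (Fin m → ℝ) => y.1 ≠ 0)
      ((Measure.quasiMeasurePreserving_fst).ae (p := fun a : ℝ => a ≠ 0) (by simp [ae_iff]))
  filter_upwards [ha0, hb0, ae_height_ne_one hh (j : ℝ)] with x h1 h2 h3
  exact nhdsWithin_le_nhds (cellRegion_eventually_iff hh.continuous j h2 h1 h3 x.2.2)

/-- Cell 0 imposes no condition from earlier integers. For 1 < b < 2 the collapsed polynomial a(1 -
bx)^(m+1) has its root beyond 1/2, and a small a makes the height small, so the density is positive
on a nonempty open set. -/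
lemma lintegral_cellRegion_zero_ne_zero {m : ℕ} (hm : 1 ≤ m) {h : (Fin (m + 2) → ℝ) → ℝ}
    (hh : IsHeightFunction (m + 1) h) :
    ∫⁻ x, gapIntegrand (m := m) (cellRegion (m + 1) h 0) 0 x ≠ 0 := by
  have hmeas := measurable_gapIntegrand (m := m) (measurableSet_cellRegion hh.continuous 0)
    (c := 0) measurable_zero
  rw [ne_eq, lintegral_eq_zero_iff hmeas]
  intro hae
  set w : ℝ × ℝ × (Fin m → ℝ) → ℝ := fun x =>
    h (mobius (m + 1) (0 : ℕ) (rootMap (m + 1) (gapParam (x.1, x.2.1, (0 : Fin m → ℝ))))) with hw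
  have hwc : Continuous w := hh.continuous.comp ((continuous_mobius _ _).comp
    ((continuous_rootMap _).comp ((continuous_gapParam m).comp (by fun_prop))))
  set U : Set (ℝ × ℝ × (Fin m → ℝ)) := {x | 0 < x.1} ∩ ({x | 1 < x.2.1} ∩ ({x | x.2.1 < 2} ∩
    ((⋂ l, {x | 0 < x.2.2 l}) ∩ ({x | gapDelta x.2.2 < 1} ∩ {x | w x < 1})))) with hU
  have hgc := continuous_gapDelta m
  have hUo : IsOpen U := by
    refine (isOpen_lt (by fun_prop) (by fun_prop)).inter ((isOpen_lt (by fun_prop)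
      (by fun_prop)).inter ((isOpen_lt (by fun_prop) (by fun_prop)).inter
      ((isOpen_iInter_of_finite fun l => isOpen_lt (by fun_prop) (by fun_prop)).inter
        ((isOpen_lt (by fun_prop) (by fun_prop)).inter (isOpen_lt (by fun_prop) (by fun_prop))))))
  have hUne : U.Nonempty := by
    have h1 : ∀ᶠ r in 𝓝[>] (0 : ℝ), gapDelta (r • (1 : Fin m → ℝ)) < 1 := by
      have hc : Continuous fun r : ℝ => gapDelta (r • (1 : Fin m → ℝ)) :=
        hgc.comp (by fun_prop)
      refine nhdsWithin_le_nhds (hc.continuousAt.eventually_lt_const ?_)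
      simp only [gapDelta_smul]
      rw [zero_pow (triangular_pos hm).ne', zero_mul]
      exact one_pos
    have h2 : ∀ᶠ a in 𝓝[>] (0 : ℝ), w (a, 3 / 2, 0) < 1 := by
      have hc : Continuous fun a : ℝ => w (a, 3 / 2, 0) := hwc.comp (by fun_prop)
      refine nhdsWithin_le_nhds (hc.continuousAt.eventually_lt_const ?_)
      rw [hw]
      simp only [rootMap_gapParam]
      rw [splitCoeffs_smul, zero_smul, map_zero, (hh.eq_zero_iff 0).mpr rfl]
      exact one_pos
    obtain ⟨r, hr1, hr2⟩ := (h1.and self_mem_nhdsWithin).exists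
    obtain ⟨a, ha1, ha2⟩ := (h2.and self_mem_nhdsWithin).exists
    refine ⟨(a, 3 / 2, r • 1), ha2, by norm_num, by norm_num, ?_, hr1, ha1⟩
    simp only [Set.mem_iInter]
    intro l
    simpa using hr2
  have hpos := hUo.measure_pos volume hUne
  refine hpos.ne' (measure_mono_null (fun x hx => ?_) (ae_iff.mp hae))
  obtain ⟨h1, h2, h3, h4, h5, h6⟩ := hx
  have h1 : 0 < x.1 := h1
  have h2 : 1 < x.2.1 := h2
  have h3 : x.2.1 < 2 := h3
  have h5 : gapDelta x.2.2 < 1 := h5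
  have h6 : w x < 1 := h6
  have h4 : ∀ l, 0 < x.2.2 l := fun l => Set.mem_iInter.mp h4 l
  have hg : x.2.2 ∈ unitGaps m := ⟨h4, h5.le⟩
  have hK : rootMap (m + 1) (gapParam (x.1, x.2.1, (0 : Fin m → ℝ))) ∈ cellRegion (m + 1) h 0 := by
    refine ⟨⟨fun y hy => ?_, by simp⟩, h6.le⟩
    rw [rootMap_gapParam, eval_mobius_zero_gap]
    refine mul_ne_zero h1.ne' (pow_ne_zero _ ?_)
    have hy2 := hy.2
    simp only [Nat.cast_zero, zero_add, sub_zero] at hy2 ⊢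
    nlinarith
  change ¬ (gapIntegrand (cellRegion (m + 1) h 0) 0 x = 0)
  have hd := gapDelta_pos h4
  have ha := abs_pos.mpr h1.ne'
  simp only [gapIntegrand, gapDensity, Pi.zero_apply, zero_smul, Set.indicator_of_mem hg,
    Set.indicator_of_mem hK, Pi.one_apply, mul_one, ENNReal.ofReal_eq_zero, not_le]
  positivity

/-- Asymptotics of the limit distribution function of the discriminant of real-rooted
polynomials. -/
theorem exists_tendsto_limitDistr {m : ℕ} (hm : 1 ≤ m) {h : (Fin (m + 2) → ℝ) → ℝ}
    (hh : IsHeightFunction (m + 1) h) : ∃ lam : ℝ, 0 < lam ∧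
      Tendsto (fun δ : ℝ => limitDistr (m + 1) h 0 δ / δ ^ (((m : ℝ) + 3) / (2 * (m + 1))))
        (𝓝[>] 0) (𝓝 lam) := by
  set I : ℕ → ENNReal := fun j => ∫⁻ x, gapIntegrand (m := m) (cellRegion (m + 1) h j) 0 x
  have hI : ∀ j, I j ≠ ⊤ := fun j => (tendsto_volume_cellRegion hm hh j).2
  have htop : ∑ j ∈ Finset.range (m + 2), I j ≠ ⊤ := by
    simpa [ENNReal.sum_eq_top] using fun j _ => hI j
  refine ⟨(∑ j ∈ Finset.range (m + 2), I j).toReal, ENNReal.toReal_pos ?_ htop, ?_⟩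
  · intro h0
    exact lintegral_cellRegion_zero_ne_zero hm hh
      (Finset.sum_eq_zero_iff.mp h0 0 (Finset.mem_range.mpr (by omega)))
  · have hT := tendsto_finsetSum (Finset.range (m + 2))
      fun j _ => (tendsto_volume_cellRegion hm hh j).1
    refine ((ENNReal.tendsto_toReal htop).comp hT).congr' ?_
    filter_upwards [self_mem_nhdsWithin] with δ hδ
    have hδ' : (0 : ℝ) < δ := hδ
    have hvol : volume (discrRegion (m + 1) h 0 δ) = ∑ j ∈ Finset.range (m + 2),
        volume (cellRegion (m + 1) h j ∩ distinctRegion (m + 1) δ) := by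
      have hset : {a | h a ≤ 1} ∩ distinctRegion (m + 1) δ = ⋃ j ∈ Finset.range (m + 2),
          (rootCell (m + 1) j ∩ {p | h p ≤ 1}) ∩ distinctRegion (m + 1) δ := by
        ext a
        simp only [Set.mem_iUnion]
        constructor
        · intro ha
          have hne : a ≠ 0 := by
            rintro rfl
            exact ha.2.1 rfl
          obtain ⟨j, hj, hcell⟩ := exists_mem_rootCell hne
          exact ⟨j, hj, ⟨hcell, ha.1⟩, ha.2⟩
        · rintro ⟨j, -, ⟨-, h1⟩, h2⟩
          exact ⟨h1, h2⟩
      rw [volume_discrRegion (by omega), hset, measure_biUnion_finset]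
      · exact Finset.sum_congr rfl fun j _ => volume_rootCell_inter (by omega) h j δ
      · intro i _ j _ hij
        exact (disjoint_rootCell hij).mono
          (Set.inter_subset_left.trans Set.inter_subset_left)
          (Set.inter_subset_left.trans Set.inter_subset_left)
      · intro j _
        exact ((measurableSet_rootCell _ j).inter
          (hh.continuous.measurable measurableSet_Iic)).inter
            (measurableSet_distinctRegion (by omega) δ)
    simp only [Function.comp_apply, div_eq_mul_inv]
    rw [← Finset.sum_mul, ← hvol, ENNReal.toReal_mul, ENNReal.toReal_inv,
      ENNReal.toReal_ofReal (by positivity)]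
    rfl

/-! ### Axis-parallel lines and the region of bounded discriminant -/

/-- The coefficient vectors on an axis-parallel line, as a polynomial over `ℝ[t]`. -/
def linePoly (n : ℕ) (y : Fin (n + 1) → ℝ) (i : Fin (n + 1)) : ℝ[X][X] :=
  ∑ k : Fin (n + 1), Polynomial.C (Function.update (fun k => Polynomial.C (y k)) i Polynomial.X k) *
    Polynomial.X ^ (k : ℕ)

/-- The resultant of a polynomial and its derivative along an axis-parallel line. -/
def lineResultant (n : ℕ) (y : Fin (n + 1) → ℝ) (i : Fin (n + 1)) : ℝ[X] :=
  Polynomial.resultant (linePoly n y i) (linePoly n y i).derivative n (n - 1)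

lemma map_linePoly {n : ℕ} (y : Fin (n + 1) → ℝ) (i : Fin (n + 1)) (t : ℝ) :
    (linePoly n y i).map (Polynomial.evalRingHom t) = polyOfCoeffs n (Function.update y i t) := by
  simp only [linePoly, polyOfCoeffs, Polynomial.map_sum, Polynomial.map_mul, Polynomial.map_C,
    Polynomial.map_pow, Polynomial.map_X]
  refine Finset.sum_congr rfl fun k _ => ?_
  by_cases h : k = i
  · subst h; simp
  · simp [h]

lemma abs_resultant_derivative {n : ℕ} (hn : 1 ≤ n) {a : Fin (n + 1) → ℝ}
    (ha : a (Fin.last n) ≠ 0) :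
    |Polynomial.resultant (polyOfCoeffs n a) (polyOfCoeffs n a).derivative n (n - 1)| =
      |a (Fin.last n)| * |(polyOfCoeffs n a).discr| := by
  have hdeg : 0 < (polyOfCoeffs n a).degree := by
    rw [← Polynomial.natDegree_pos_iff_degree_pos, natDegree_polyOfCoeffs ha]; omega
  have h1 := Polynomial.resultant_deriv hdeg
  rw [natDegree_polyOfCoeffs ha, leadingCoeff_polyOfCoeffs ha] at h1
  rw [h1]
  simp [abs_mul]

lemma abs_eval_lineResultant {n : ℕ} (hn : 1 ≤ n) (y : Fin (n + 1) → ℝ) (i : Fin (n + 1)) {t : ℝ}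
    (ha : Function.update y i t (Fin.last n) ≠ 0) :
    |(lineResultant n y i).eval t| = |Function.update y i t (Fin.last n)| *
      |(polyOfCoeffs n (Function.update y i t)).discr| := by
  rw [← abs_resultant_derivative hn ha, ← map_linePoly, Polynomial.derivative_map,
    Polynomial.resultant_map_map]
  rfl

lemma natDegree_coeff_linePoly_le {n : ℕ} (y : Fin (n + 1) → ℝ) (i : Fin (n + 1)) (k : ℕ) :
    ((linePoly n y i).coeff k).natDegree ≤ 1 := by
  simp only [linePoly, Polynomial.finsetSum_coeff, Polynomial.coeff_C_mul_X_pow]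
  refine Polynomial.natDegree_sum_le_of_forall_le _ _ fun l _ => ?_
  split_ifs
  · by_cases h : l = i
    · subst h; simp
    · simp [h]
  · simp

lemma natDegree_det_le {ι : Type*} [Fintype ι] [DecidableEq ι] (M : Matrix ι ι ℝ[X])
    (hM : ∀ i j, (M i j).natDegree ≤ 1) : M.det.natDegree ≤ Fintype.card ι := by
  rw [Matrix.det_apply]
  refine Polynomial.natDegree_sum_le_of_forall_le _ _ fun σ _ => ?_
  refine (Polynomial.natDegree_smul_le _ _).trans ((Polynomial.natDegree_prod_le _ _).trans ?_)
  refine (Finset.sum_le_card_nsmul _ _ 1 fun i _ => hM _ _).trans ?_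
  simp

/-- The Sylvester matrix has size n + (n-1) and entries of degree at most 1 in t. Fixing the formal
degrees n and n-1 keeps the resultant polynomial in t even where the leading coefficient vanishes.
-/
lemma natDegree_lineResultant_le {n : ℕ} (y : Fin (n + 1) → ℝ) (i : Fin (n + 1)) :
    (lineResultant n y i).natDegree ≤ 2 * n := by
  refine (natDegree_det_le _ fun k l => ?_).trans (by simp; omega)
  rw [Polynomial.sylvester, Matrix.of_apply]
  refine Fin.addCases (fun l => ?_) (fun l => ?_) l
  · rw [Fin.addCases_left]
    split_ifs
    · rw [Polynomial.coeff_derivative]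
      refine Polynomial.natDegree_mul_le.trans ?_
      have h1 := natDegree_coeff_linePoly_le y i ((k : ℕ) - l + 1)
      have h2 : (((k - l : ℕ) : ℝ[X]) + 1).natDegree = 0 := by
        exact_mod_cast Polynomial.natDegree_natCast _
      omega
    · simp
  · rw [Fin.addCases_right]
    split_ifs
    · exact natDegree_coeff_linePoly_le y i _
    · simp

/-- Coefficient vectors of degree `n` polynomials with `n` distinct real roots. -/
def distinctReal (n : ℕ) : Set (Fin (n + 1) → ℝ) :=
  {a | a (Fin.last n) ≠ 0 ∧ nonrealRootCount (polyOfCoeffs n a) = 0 ∧ (polyOfCoeffs n a).discr ≠ 0}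

/-- All orderings of the roots are allowed here, since only openness of the root map is used and not
its injectivity. -/
lemma isOpen_distinctReal {n : ℕ} (hn : 1 ≤ n) : IsOpen (distinctReal n) := by
  have hset : distinctReal n =
      rootMap n '' ({x | x 0 ≠ 0} ∩ {x | (Matrix.vandermonde (Fin.tail x)).det ≠ 0}) := by
    ext a
    constructor
    · rintro ⟨ha, hr, hd⟩
      obtain ⟨α, hα⟩ := exists_splitCoeffs ha hr
      have hinj : Function.Injective α := by
        rw [← discr_splitPoly_ne_zero_iff hn ha, ← polyOfCoeffs_splitCoeffs, ← hα]
        exact hd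
      refine ⟨Fin.cons (a (Fin.last n)) α, ⟨ha, ?_⟩,
        by rw [rootMap, Fin.tail_cons, Fin.cons_zero, ← hα]⟩
      exact Matrix.det_vandermonde_ne_zero_iff.mpr hinj
    · rintro ⟨x, ⟨h0, h1⟩, rfl⟩
      have hinj := Matrix.det_vandermonde_ne_zero_iff.mp h1
      exact ⟨by rwa [rootMap, splitCoeffs_last],
        by rw [rootMap, polyOfCoeffs_splitCoeffs, nonrealRootCount_splitPoly],
        by rw [rootMap, polyOfCoeffs_splitCoeffs]
           exact (discr_splitPoly_ne_zero_iff hn h0 _).mpr hinj⟩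
  rw [hset]
  refine isOpen_image_rootMap ?_ fun x hx => ⟨hx.1, Matrix.det_vandermonde_ne_zero_iff.mp hx.2⟩
  exact (isOpen_ne_fun (continuous_apply 0) continuous_const).inter
    (isOpen_ne_fun ((continuous_det_vandermonde n).comp (continuous_tail n)) continuous_const)

/-- An open condition which for polynomials of degree `n` detects non-real roots. -/
def nonrealWitness (n : ℕ) : Set (Fin (n + 1) → ℝ) :=
  ⋃ z : ℂ, {a | ‖∑ i, (a i : ℂ) * z ^ (i : ℕ)‖ < |a (Fin.last n)| * |z.im| ^ n}

lemma isOpen_nonrealWitness (n : ℕ) : IsOpen (nonrealWitness n) :=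
  isOpen_iUnion fun z => isOpen_lt (by fun_prop) (by fun_prop)

lemma eval_map_polyOfCoeffs {n : ℕ} (a : Fin (n + 1) → ℝ) (z : ℂ) :
    ((polyOfCoeffs n a).map (algebraMap ℝ ℂ)).eval z = ∑ i, (a i : ℂ) * z ^ (i : ℕ) := by
  simp [polyOfCoeffs, Polynomial.map_sum, Polynomial.eval_finsetSum]

/-- If all roots are real, each factor satisfies |z - αₖ| ≥ |Im z|, so the strict inequality fails
for every z; at a non-real root its left side is 0 and its right side positive. -/
lemma mem_nonrealWitness_iff {n : ℕ} {a : Fin (n + 1) → ℝ}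
    (ha : a (Fin.last n) ≠ 0) :
    a ∈ nonrealWitness n ↔ nonrealRootCount (polyOfCoeffs n a) ≠ 0 := by
  constructor
  · intro h hr
    obtain ⟨z, hz⟩ := Set.mem_iUnion.mp h
    obtain ⟨α, hα⟩ := exists_splitCoeffs ha hr
    have hz' : ‖∑ i, (a i : ℂ) * z ^ (i : ℕ)‖ < |a (Fin.last n)| * |z.im| ^ n := hz
    refine hz'.not_ge ?_
    rw [← eval_map_polyOfCoeffs]
    conv_rhs => rw [hα, polyOfCoeffs_splitCoeffs, splitPoly]
    simp only [Polynomial.map_mul, Polynomial.map_C, Polynomial.map_prod, Polynomial.map_sub,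
      Polynomial.map_X, Polynomial.eval_mul, Polynomial.eval_C, Polynomial.eval_prod,
      Polynomial.eval_sub, Polynomial.eval_X, norm_mul, norm_prod]
    have h1 : |z.im| ^ n = ∏ _k : Fin n, |z.im| := by simp
    rw [h1]
    refine mul_le_mul (by simp) (Finset.prod_le_prod (fun _ _ => abs_nonneg _) fun k _ => ?_)
      (by positivity) (norm_nonneg _)
    have := Complex.abs_im_le_norm (z - algebraMap ℝ ℂ (α k))
    simpa using this
  · intro h
    rw [nonrealRootCount, ne_eq, Multiset.countP_eq_zero] at h
    push Not at h
    obtain ⟨z, hz, him⟩ := h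
    refine Set.mem_iUnion.mpr ⟨z, ?_⟩
    have h0 := Polynomial.isRoot_of_mem_roots hz
    rw [Polynomial.IsRoot, eval_map_polyOfCoeffs] at h0
    change ‖∑ i, (a i : ℂ) * z ^ (i : ℕ)‖ < |a (Fin.last n)| * |z.im| ^ n
    rw [h0, norm_zero]
    have := abs_pos.mpr ha
    have := abs_pos.mpr him
    positivity

lemma eval_le_zero_iff_of_no_roots {p : ℝ[X]} {s s' : ℝ} (hs : s ≤ s')
    (h : ∀ f ∈ p.roots, f ∉ Set.Icc s s') : p.eval s ≤ 0 ↔ p.eval s' ≤ 0 := by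
  by_cases hp : p = 0
  · simp [hp]
  have hno : ∀ x ∈ Set.Icc s s', p.eval x ≠ 0 := fun x hx h0 =>
    h x ((Polynomial.mem_roots hp).mpr h0) hx
  have hc : ContinuousOn (fun x => p.eval x) (Set.Icc s s') := p.continuous.continuousOn
  constructor
  · intro h1
    by_contra! h2
    obtain ⟨x, hx, hx0⟩ := intermediate_value_Icc hs hc ⟨h1, h2.le⟩
    exact hno x hx hx0
  · intro h1
    by_contra! h2
    obtain ⟨x, hx, hx0⟩ := intermediate_value_Icc' hs hc ⟨h1, h2.le⟩
    exact hno x hx hx0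

/-- Along an axis-parallel line, membership in `distinctRegion n δ` changes only at boundedly many
points. -/
lemma exists_finset_line {n : ℕ} (hn : 1 ≤ n) {δ : ℝ} (hδ : 0 ≤ δ) (y : Fin (n + 1) → ℝ)
    (i : Fin (n + 1)) : ∃ F : Finset ℝ, F.card ≤ 6 * n + 3 ∧ ∀ s s', s ≤ s' →
      (∀ f ∈ F, f ∉ Set.Icc s s') →
      (Function.update y i s ∈ distinctRegion n δ ↔ Function.update y i s' ∈ distinctRegion n δ) := by
  classical
  set l : ℝ[X] := Function.update (fun k => Polynomial.C (y k)) i Polynomial.X (Fin.last n) with hl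
  set d := lineResultant n y i with hd
  -- As |d| = |l|·|D|, the sign of this polynomial decides |D| ≤ δ wherever l ≠ 0. The roots of l, d
  -- and e number at most 1 + 2n + (4n+2) = 6n + 3.
  set e := d ^ 2 - Polynomial.C (δ ^ 2) * l ^ 2 with he
  have hleval : ∀ t, l.eval t = Function.update y i t (Fin.last n) := by
    intro t
    by_cases h : Fin.last n = i
    · rw [hl, h]; simp
    · rw [hl]; simp [h]
  have hldeg : l.natDegree ≤ 1 := by
    by_cases h : Fin.last n = i
    · rw [hl, h]; simp
    · rw [hl]; simp [h]
  have hddeg : d.natDegree ≤ 2 * n := natDegree_lineResultant_le y i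
  have hedeg : e.natDegree ≤ 4 * n + 2 := by
    refine (Polynomial.natDegree_sub_le _ _).trans (max_le ?_ ?_)
    · refine Polynomial.natDegree_pow_le.trans ?_
      omega
    · refine (Polynomial.natDegree_C_mul_le _ _).trans (Polynomial.natDegree_pow_le.trans ?_)
      omega
  have hroots : ∀ {p : ℝ[X]} {k : ℕ}, p.natDegree ≤ k → p.roots.toFinset.card ≤ k := fun hp =>
    (Multiset.toFinset_card_le _).trans ((Polynomial.card_roots' _).trans hp)
  have hdne : ∀ t, Function.update y i t (Fin.last n) ≠ 0 →
      (d.eval t ≠ 0 ↔ (polyOfCoeffs n (Function.update y i t)).discr ≠ 0) := by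
    intro t ht
    rw [← abs_ne_zero, hd, abs_eval_lineResultant hn y i ht]
    simp [ht]
  -- If l or d vanishes identically, no point of the line has degree n and nonzero discriminant, so
  -- the line misses the region.
  by_cases hzero : l = 0 ∨ d = 0
  · refine ⟨∅, by simp, fun s s' _ _ => ?_⟩
    have : ∀ t, Function.update y i t ∉ distinctRegion n δ := by
      intro t ht
      rcases hzero with h | h
      · exact ht.1 (by rw [← hleval, h, Polynomial.eval_zero])
      · exact (hdne t ht.1).mpr ht.2.2.1 (by rw [h, Polynomial.eval_zero])
    exact iff_of_false (this s) (this s')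
  push Not at hzero
  refine ⟨l.roots.toFinset ∪ d.roots.toFinset ∪ e.roots.toFinset, ?_, fun s s' hs hF => ?_⟩
  · refine (Finset.card_union_le _ _).trans ?_
    have h1 := Finset.card_union_le l.roots.toFinset d.roots.toFinset
    have h2 := hroots hldeg
    have h3 := hroots hddeg
    have h4 := hroots hedeg
    omega
  simp only [Finset.mem_union, Multiset.mem_toFinset] at hF
  have hlne : ∀ t ∈ Set.Icc s s', Function.update y i t (Fin.last n) ≠ 0 := fun t ht h0 =>
    hF t (Or.inl (Or.inl ((Polynomial.mem_roots hzero.1).mpr ((hleval t).trans h0)))) ht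
  have hdne' : ∀ t ∈ Set.Icc s s', (polyOfCoeffs n (Function.update y i t)).discr ≠ 0 := fun t ht =>
    (hdne t (hlne t ht)).mp fun h0 =>
      hF t (Or.inl (Or.inr ((Polynomial.mem_roots hzero.2).mpr h0))) ht
  have hcont : Continuous fun t => Function.update y i t := continuous_const.update i continuous_id
  have hU := (isOpen_distinctReal hn).preimage hcont
  have hV := (isOpen_nonrealWitness n).preimage hcont
  have hdisj : Disjoint ((fun t => Function.update y i t) ⁻¹' distinctReal n)
      ((fun t => Function.update y i t) ⁻¹' nonrealWitness n) := by
    rw [Set.disjoint_left]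
    intro t h1 h2
    exact (mem_nonrealWitness_iff h1.1).mp h2 h1.2.1
  -- Where l and d have no zero, real-rootedness and its failure are both open, so the connected
  -- segment lies in one of the two sets.
  have hcov : Set.Icc s s' ⊆ ((fun t => Function.update y i t) ⁻¹' distinctReal n) ∪
      ((fun t => Function.update y i t) ⁻¹' nonrealWitness n) := by
    intro t ht
    by_cases h : nonrealRootCount (polyOfCoeffs n (Function.update y i t)) = 0
    · exact Or.inl ⟨hlne t ht, h, hdne' t ht⟩
    · exact Or.inr ((mem_nonrealWitness_iff (hlne t ht)).mpr h)
  have hprop : ∀ t ∈ Set.Icc s s', Function.update y i t ∈ distinctReal n →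
      Set.Icc s s' ⊆ (fun t => Function.update y i t) ⁻¹' distinctReal n := fun t ht h =>
    isPreconnected_Icc.subset_left_of_subset_union hU hV hdisj hcov ⟨t, ht, h⟩
  have hle : ∀ t ∈ Set.Icc s s',
      (|(polyOfCoeffs n (Function.update y i t)).discr| ≤ δ ↔ e.eval t ≤ 0) := by
    intro t ht
    have h1 := abs_eval_lineResultant hn y i (hlne t ht)
    have h2 := abs_pos.mpr (hlne t ht)
    have h3 : e.eval t = |d.eval t| ^ 2 - (|Function.update y i t (Fin.last n)| * δ) ^ 2 := by
      rw [he, mul_pow, sq_abs, sq_abs]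
      simp only [Polynomial.eval_sub, Polynomial.eval_mul, Polynomial.eval_pow, Polynomial.eval_C,
        hleval]
      ring
    rw [h3, sub_nonpos, sq_le_sq₀ (abs_nonneg _) (by positivity), hd, h1]
    exact (mul_le_mul_iff_right₀ h2).symm
  have hs1 : s ∈ Set.Icc s s' := Set.left_mem_Icc.mpr hs
  have hs2 : s' ∈ Set.Icc s s' := Set.right_mem_Icc.mpr hs
  have hbound : |(polyOfCoeffs n (Function.update y i s)).discr| ≤ δ ↔
      |(polyOfCoeffs n (Function.update y i s')).discr| ≤ δ := by
    rw [hle s hs1, hle s' hs2]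
    exact eval_le_zero_iff_of_no_roots hs fun f hf => hF f (Or.inr hf)
  constructor
  · rintro ⟨h1, h2, h3, h4⟩
    have h5 := hprop s hs1 ⟨h1, h2, h3⟩ hs2
    exact ⟨h5.1, h5.2.1, h5.2.2, hbound.mp h4⟩
  · rintro ⟨h1, h2, h3, h4⟩
    have h5 := hprop s' hs2 ⟨h1, h2, h3⟩ hs1
    exact ⟨h5.1, h5.2.1, h5.2.2, hbound.mpr h4⟩

/-! ### Lattice points, translates and volume -/

/-- The integer points of the cube `[-M, M] ^ N`. -/
def latticeBox (N M : ℕ) : Finset (Fin N → ℤ) :=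
  Fintype.piFinset fun _ => Finset.Icc (-(M : ℤ)) M

/-- The real vector of an integer vector. -/
def intVec {N : ℕ} (k : Fin N → ℤ) : Fin N → ℝ := fun i => (k i : ℝ)

/-- A set of lattice points in a box with at most `L` points on every line in a fixed coordinate
direction. -/
lemma card_le_of_card_fiber_le {N M L : ℕ} {S : Finset (Fin (N + 1) → ℤ)}
    (hS : S ⊆ latticeBox (N + 1) M) (j : Fin (N + 1))
    (hfib : ∀ k₀ : Fin (N + 1) → ℤ, ∃ T : Finset ℤ, T.card ≤ L ∧
      ∀ k ∈ S, Function.update k j 0 = k₀ → k j ∈ T) :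
    S.card ≤ L * (2 * M + 1) ^ N := by
  classical
  set B : Finset (Fin (N + 1) → ℤ) :=
    Fintype.piFinset fun i => if i = j then {0} else Finset.Icc (-(M : ℤ)) M with hB
  have hBcard : B.card = (2 * M + 1) ^ N := by
    rw [hB, Fintype.card_piFinset, ← Finset.mul_prod_erase _ _ (Finset.mem_univ j)]
    have : ∀ i ∈ Finset.univ.erase j,
        (if i = j then ({0} : Finset ℤ) else Finset.Icc (-(M : ℤ)) M).card = 2 * M + 1 := by
      intro i hi
      rw [if_neg (Finset.ne_of_mem_erase hi), Int.card_Icc]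
      omega
    rw [Finset.prod_congr rfl this]
    simp [Finset.card_erase_of_mem]
  rw [← hBcard]
  refine Finset.card_le_mul_card_image_of_maps_to (f := fun k => Function.update k j 0)
    (fun k hk => ?_) L fun k₀ _ => ?_
  · rw [hB, Fintype.mem_piFinset]
    intro i
    by_cases hi : i = j
    · subst hi; simp
    · simpa [hi] using Fintype.mem_piFinset.mp (hS hk) i
  · obtain ⟨T, hT, hmem⟩ := hfib k₀
    refine le_trans (Finset.card_le_card_of_injOn (fun k => k j) (fun k hk => ?_) ?_) hT
    · obtain ⟨h1, h2⟩ := Finset.mem_filter.mp hk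
      exact hmem k h1 h2
    · intro k hk k' hk' hkk
      have h2 := (Finset.mem_filter.mp hk).2
      have h2' := (Finset.mem_filter.mp hk').2
      ext i
      by_cases hi : i = j
      · subst hi; exact hkk
      · have := congrFun (h2.trans h2'.symm) i
        simpa [hi] using this

/-- The vector whose first `j` coordinates are those of `u`, the others being zero. -/
def truncate {N : ℕ} (u : Fin N → ℝ) (j : ℕ) : Fin N → ℝ := fun i => if (i : ℕ) < j then u i else 0

open scoped Classical in
/-- Shifting a lattice by a vector in the unit cube changes the number of lattice points in a set
by little, if axis-parallel lines meet the boundary in boundedly many points. -/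
lemma card_shift_differ_le {N M L : ℕ} {R : Set (Fin (N + 1) → ℝ)}
    (hR : ∀ (y : Fin (N + 1) → ℝ) (i : Fin (N + 1)), ∃ F : Finset ℝ, F.card ≤ L ∧ ∀ s s', s ≤ s' →
      (∀ f ∈ F, f ∉ Set.Icc s s') → (Function.update y i s ∈ R ↔ Function.update y i s' ∈ R))
    {u : Fin (N + 1) → ℝ} (hu : ∀ i, u i ∈ Set.Ico (0 : ℝ) 1) :
    ((latticeBox (N + 1) M).filter fun k => ¬ (intVec k ∈ R ↔ intVec k + u ∈ R)).card ≤
      (N + 1) * (L * (2 * M + 1) ^ N) := by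
  set A : Fin (N + 1) → Finset (Fin (N + 1) → ℤ) := fun j => (latticeBox (N + 1) M).filter fun k =>
    ¬ (intVec k + truncate u j ∈ R ↔ intVec k + truncate u (j + 1) ∈ R) with hA
  have hsub : ((latticeBox (N + 1) M).filter fun k => ¬ (intVec k ∈ R ↔ intVec k + u ∈ R)) ⊆
      Finset.univ.biUnion A := by
    intro k hk
    obtain ⟨hk1, hk2⟩ := Finset.mem_filter.mp hk
    by_contra hcon
    -- If no coordinate step from k to k + u changes membership, then k and k + u agree; each
    -- exceptional k is thus charged to one coordinate direction.
    have hstep : ∀ j : ℕ, j ≤ N + 1 → (intVec k ∈ R ↔ intVec k + truncate u j ∈ R) := by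
      intro j
      induction j with
      | zero =>
        intro _
        have : truncate u 0 = 0 := by ext; simp [truncate]
        rw [this, add_zero]
      | succ j ih =>
        intro hj
        rw [ih (by omega)]
        by_contra hne
        exact hcon (Finset.mem_biUnion.mpr ⟨⟨j, hj⟩, Finset.mem_univ _,
          Finset.mem_filter.mpr ⟨hk1, hne⟩⟩)
    apply hk2
    have h := hstep (N + 1) le_rfl
    have : truncate u (N + 1) = u := by ext i; exact if_pos i.isLt
    rwa [this] at h
  refine (Finset.card_le_card hsub).trans (Finset.card_biUnion_le.trans ?_)
  refine (Finset.sum_le_card_nsmul _ _ (L * (2 * M + 1) ^ N) fun j _ => ?_).trans (by simp)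
  refine card_le_of_card_fiber_le (Finset.filter_subset _ _) j fun k₀ => ?_
  obtain ⟨F, hF, hline⟩ := hR (intVec k₀ + truncate u j) j
  -- A change of membership forces an exceptional point in [kⱼ, kⱼ + uⱼ], and since uⱼ < 1 its floor
  -- is kⱼ.
  refine ⟨F.image fun x => ⌊x⌋, Finset.card_image_le.trans hF, fun k hk hk0 => ?_⟩
  obtain ⟨-, hk2⟩ := Finset.mem_filter.mp hk
  have e1 : intVec k + truncate u j = Function.update (intVec k₀ + truncate u j) j (k j : ℝ) := by
    ext i
    by_cases hi : i = j
    · subst hi; simp [intVec, truncate]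
    · simp [hi, ← hk0, intVec]
  have e2 : intVec k + truncate u (j + 1) =
      Function.update (intVec k₀ + truncate u j) j ((k j : ℝ) + u j) := by
    ext i
    by_cases hi : i = j
    · subst hi; simp [intVec, truncate]
    · have : (i : ℕ) ≠ j := fun h => hi (Fin.ext h)
      have h2 : (i : ℕ) < j + 1 ↔ (i : ℕ) < j := by omega
      simp only [Pi.add_apply, truncate, h2, Function.update_of_ne hi, ← hk0, intVec]
  rw [e1, e2] at hk2
  have hex : ∃ f ∈ F, f ∈ Set.Icc (k j : ℝ) (k j + u j) := by
    by_contra! hno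
    exact hk2 (hline _ _ (by linarith [(hu j).1]) hno)
  obtain ⟨f, hf, hf1, hf2⟩ := hex
  refine Finset.mem_image.mpr ⟨f, hf, ?_⟩
  rw [Int.floor_eq_iff]
  exact ⟨hf1, by linarith [(hu j).2]⟩

/-- The half-open unit cube. -/
def unitCube (N : ℕ) : Set (Fin N → ℝ) := Set.univ.pi fun _ => Set.Ico 0 1

lemma mem_unitCube {N : ℕ} {u : Fin N → ℝ} : u ∈ unitCube N ↔ ∀ i, u i ∈ Set.Ico (0 : ℝ) 1 := by
  simp [unitCube]

lemma measurableSet_unitCube (N : ℕ) : MeasurableSet (unitCube N) :=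
  MeasurableSet.univ_pi fun _ => measurableSet_Ico

lemma volume_unitCube (N : ℕ) : volume (unitCube N) = 1 := by
  simp [unitCube, volume_pi_pi]

lemma add_unitCube_disjoint {N : ℕ} {k k' : Fin N → ℤ} {x : Fin N → ℝ}
    (h : x - intVec k ∈ unitCube N) (h' : x - intVec k' ∈ unitCube N) : k = k' := by
  ext i
  have h1 := mem_unitCube.mp h i
  have h2 := mem_unitCube.mp h' i
  simp only [Pi.sub_apply, intVec, Set.mem_Ico] at h1 h2
  have e1 : ⌊x i⌋ = k i := Int.floor_eq_iff.mpr ⟨by linarith, by linarith⟩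
  have e2 : ⌊x i⌋ = k' i := Int.floor_eq_iff.mpr ⟨by linarith, by linarith⟩
  rw [← e1, e2]

open scoped Classical in
-- The translates of the unit cube by lattice points are disjoint, so averaging the number of points
-- in shifted lattices measures the part of X that they cover.
lemma lintegral_card_shift {N : ℕ} (B : Finset (Fin N → ℤ)) {X : Set (Fin N → ℝ)}
    (hX : MeasurableSet X) :
    ∫⁻ u in unitCube N, (((B.filter fun k => intVec k + u ∈ X).card : ℕ) : ENNReal) =
      volume (X ∩ ⋃ k ∈ B, {x | x - intVec k ∈ unitCube N}) := by
  have hcube : ∀ k : Fin N → ℤ, MeasurableSet {x : Fin N → ℝ | x - intVec k ∈ unitCube N} := fun k =>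
    (measurable_id.sub_const _) (measurableSet_unitCube N)
  have h1 : ∀ u : Fin N → ℝ, (((B.filter fun k => intVec k + u ∈ X).card : ℕ) : ENNReal) =
      ∑ k ∈ B, X.indicator 1 (intVec k + u) := by
    intro u
    rw [Finset.card_filter]
    push_cast
    refine Finset.sum_congr rfl fun k _ => ?_
    by_cases h : intVec k + u ∈ X <;> simp [h]
  simp only [h1]
  have hind : ∀ k : Fin N → ℤ, Measurable fun u : Fin N → ℝ =>
      X.indicator (1 : (Fin N → ℝ) → ENNReal) (intVec k + u) := fun k =>
    (measurable_one.indicator hX).comp (measurable_const_add _)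
  rw [lintegral_finsetSum _ fun k _ => hind k,
    Set.inter_iUnion₂, measure_biUnion_finset]
  · refine Finset.sum_congr rfl fun k _ => ?_
    have h2 : (fun u => X.indicator (1 : (Fin N → ℝ) → ENNReal) (intVec k + u)) =
        ((fun u => intVec k + u) ⁻¹' X).indicator 1 := by
      ext u
      by_cases h : intVec k + u ∈ X <;> simp [h]
    rw [h2, lintegral_indicator_one ((measurable_const_add _) hX),
      Measure.restrict_apply ((measurable_const_add _) hX),
      ← measure_preimage_add volume (intVec k) (X ∩ _)]
    congr 1
    ext u
    simp
  · intro k _ k' _ hkk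
    rw [Function.onFun, Set.disjoint_left]
    intro x hx hx'
    exact hkk (add_unitCube_disjoint hx.2 hx'.2)
  · exact fun k _ => hX.inter (hcube k)

open scoped Classical in
lemma le_volume_of_le_card_shift {N : ℕ} (B : Finset (Fin N → ℤ)) {X : Set (Fin N → ℝ)}
    (hX : MeasurableSet X) {c : ENNReal}
    (hc : ∀ u ∈ unitCube N, c ≤ (((B.filter fun k => intVec k + u ∈ X).card : ℕ) : ENNReal)) :
    c ≤ volume X := by
  calc c = ∫⁻ _u in unitCube N, c := by simp [volume_unitCube]
    _ ≤ _ := setLIntegral_mono' (measurableSet_unitCube N) hc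
    _ = _ := lintegral_card_shift B hX
    _ ≤ volume X := measure_mono Set.inter_subset_left

open scoped Classical in
lemma volume_le_of_card_shift_le {N M : ℕ} {X : Set (Fin N → ℝ)}
    (hX : MeasurableSet X) (hXB : ∀ x ∈ X, ∀ i, |x i| ≤ M) {c : ENNReal}
    (hc : ∀ u ∈ unitCube N,
      ((((latticeBox N M).filter fun k => intVec k + u ∈ X).card : ℕ) : ENNReal) ≤ c) :
    volume X ≤ c := by
  have hcov : X ∩ ⋃ k ∈ latticeBox N M, {x | x - intVec k ∈ unitCube N} = X := by
    refine Set.inter_eq_left.mpr fun x hx => ?_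
    refine Set.mem_iUnion₂.mpr ⟨fun i => ⌊x i⌋, ?_, ?_⟩
    · refine Fintype.mem_piFinset.mpr fun i => ?_
      have h := abs_le.mp (hXB x hx i)
      rw [Finset.mem_Icc]
      constructor
      · exact Int.le_floor.mpr (by push_cast; exact h.1)
      · have := (Int.floor_le (x i)).trans h.2
        exact_mod_cast this
    · refine mem_unitCube.mpr fun i => ?_
      simp only [Pi.sub_apply, intVec, Set.mem_Ico]
      exact ⟨by linarith [Int.floor_le (x i)], by linarith [Int.lt_floor_add_one (x i)]⟩
  calc volume X = volume (X ∩ ⋃ k ∈ latticeBox N M, {x | x - intVec k ∈ unitCube N}) := by rw [hcov]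
    _ = _ := (lintegral_card_shift (latticeBox N M) hX).symm
    _ ≤ ∫⁻ _u in unitCube N, c := setLIntegral_mono' (measurableSet_unitCube N) hc
    _ = c := by simp [volume_unitCube]

/-! ### From integer polynomials to lattice points -/

/-- The resultant with fixed formal degrees commutes with ring homomorphisms; the discriminant
follows after cancelling the nonzero leading coefficient. -/
lemma cast_discr {n : ℕ} (hn : 1 ≤ n) {P : ℤ[X]} (hP : P.degree = (n : WithBot ℕ)) :
    ((P.discr : ℤ) : ℝ) = (P.map (Int.castRingHom ℝ)).discr := by
  have hnd : P.natDegree = n := Polynomial.natDegree_eq_of_degree_eq_some hP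
  have hinj : Function.Injective (Int.castRingHom ℝ) := Int.cast_injective
  have hnd' : (P.map (Int.castRingHom ℝ)).natDegree = n := by
    rw [Polynomial.natDegree_map_eq_of_injective hinj, hnd]
  have h1 := Polynomial.resultant_deriv (f := P) (by
    rw [← Polynomial.natDegree_pos_iff_degree_pos]; omega)
  have h2 := Polynomial.resultant_deriv (f := P.map (Int.castRingHom ℝ)) (by
    rw [← Polynomial.natDegree_pos_iff_degree_pos]; omega)
  rw [hnd] at h1
  rw [hnd', Polynomial.derivative_map, Polynomial.resultant_map_map, h1,
    Polynomial.leadingCoeff_map_of_injective hinj] at h2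
  simp only [map_mul, map_pow, map_neg, map_one, eq_intCast] at h2
  have hl : ((P.leadingCoeff : ℤ) : ℝ) ≠ 0 := by
    have : P ≠ 0 := by
      rintro rfl
      simp at hnd
      omega
    exact_mod_cast Polynomial.leadingCoeff_ne_zero.mpr this
  exact mul_left_cancel₀ (mul_ne_zero (pow_ne_zero _ (by norm_num)) hl) h2

/-- Coefficient vectors of real-rooted polynomials of degree `n` with `|D| ≤ δ`. -/
def realRootedRegion (n : ℕ) (δ : ℝ) : Set (Fin (n + 1) → ℝ) :=
  {a | a (Fin.last n) ≠ 0 ∧ nonrealRootCount (polyOfCoeffs n a) = 0 ∧ |(polyOfCoeffs n a).discr| ≤ δ}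

lemma polyOfCoeffs_intCoeff {n : ℕ} {P : ℤ[X]} (hP : P.natDegree ≤ n) :
    polyOfCoeffs n (intVec fun i : Fin (n + 1) => P.coeff i) = P.map (Int.castRingHom ℝ) := by
  rw [← polyOfCoeffs_coeff_eq (p := P.map (Int.castRingHom ℝ)) (n := n)
    (Polynomial.natDegree_map_le.trans hP)]
  congr 1
  ext i
  simp [intVec]

open scoped Classical in
lemma ncard_smallDiscrClassSig {n M : ℕ} (hn : 1 ≤ n) {h : (Fin (n + 1) → ℝ) → ℝ} {Q v : ℝ}
    (hM : ∀ w, h w ≤ Q → ∀ i, |w i| ≤ M) :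
    (smallDiscrClassSig n h 0 Q v).ncard = ((latticeBox (n + 1) M).filter fun k =>
      intVec k ∈ realRootedRegion n (Q ^ (2 * (n : ℝ) - 2 - 2 * v)) ∧ h (intVec k) ≤ Q).card := by
  set φ : ℤ[X] → (Fin (n + 1) → ℤ) := fun P i => P.coeff i with hφ
  have hdeg : ∀ {P : ℤ[X]}, P.degree = (n : WithBot ℕ) → P.natDegree = n := fun h =>
    Polynomial.natDegree_eq_of_degree_eq_some h
  have hinj : Set.InjOn φ (smallDiscrClassSig n h 0 Q v) := by
    intro P hP P' hP' heq
    have h1 := hdeg hP.1.1.1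
    have h2 := hdeg hP'.1.1.1
    ext i
    by_cases hi : i < n + 1
    · exact congrFun heq ⟨i, hi⟩
    · rw [Polynomial.coeff_eq_zero_of_natDegree_lt (by omega),
        Polynomial.coeff_eq_zero_of_natDegree_lt (by omega)]
  rw [← hinj.ncard_image, ← Set.ncard_coe_finset]
  congr 1
  ext k
  simp only [Finset.coe_filter, Set.mem_ofPred_eq, Set.mem_image]
  constructor
  · rintro ⟨P, ⟨⟨⟨hd, hh⟩, hD⟩, hr⟩, rfl⟩
    have hpoly := polyOfCoeffs_intCoeff (hdeg hd).le
    have hh' : h (intVec (φ P)) ≤ Q := hh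
    refine ⟨?_, ⟨?_, ?_, ?_⟩, hh'⟩
    · refine Fintype.mem_piFinset.mpr fun i => ?_
      have : |((φ P i : ℤ) : ℝ)| ≤ M := hM _ hh' i
      rw [Finset.mem_Icc, ← abs_le]
      exact_mod_cast this
    · simp only [intVec, hφ, Fin.val_last, ne_eq, Int.cast_eq_zero]
      rw [← hdeg hd]
      refine Polynomial.leadingCoeff_ne_zero.mpr ?_
      rintro rfl
      simp at hd
    · rw [hφ, hpoly]
      simpa using hr
    · rw [hφ, hpoly, ← cast_discr hn hd]
      exact hD
  · rintro ⟨-, ⟨h1, h2, h3⟩, h4⟩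
    set P : ℤ[X] := ∑ i : Fin (n + 1), Polynomial.C (k i) * Polynomial.X ^ (i : ℕ) with hP
    have hcoeff : ∀ i : Fin (n + 1), P.coeff i = k i := by
      intro i
      simp [hP, Polynomial.coeff_X_pow, Fin.val_inj]
    have hle : P.natDegree ≤ n := by
      refine Polynomial.natDegree_sum_le_of_forall_le _ _ fun i _ => ?_
      exact (Polynomial.natDegree_C_mul_X_pow_le _ _).trans (Nat.lt_succ_iff.mp i.2)
    have hlast : P.coeff n ≠ 0 := by
      have := hcoeff (Fin.last n)
      simp only [Fin.val_last] at this
      rw [this]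
      intro h0
      exact h1 (by simp [intVec, h0])
    have hd : P.degree = (n : WithBot ℕ) := by
      rw [Polynomial.degree_eq_natDegree (by rintro h0; simp [h0] at hlast)]
      exact_mod_cast le_antisymm hle (Polynomial.le_natDegree_of_ne_zero hlast)
    have hφP : φ P = k := funext hcoeff
    have hpoly := polyOfCoeffs_intCoeff hle
    have hpoly' : polyOfCoeffs n (intVec k) = P.map (Int.castRingHom ℝ) := by
      rw [← hφP]; exact hpoly
    refine ⟨P, ⟨⟨⟨hd, ?_⟩, ?_⟩, ?_⟩, hφP⟩
    · rw [← hφP] at h4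
      exact h4
    · rw [cast_discr hn hd, ← hpoly']
      exact h3
    · rw [← hpoly']
      simpa using h2

open scoped Classical in
/-- The number of lattice points with real roots and zero discriminant. -/
lemma card_discr_zero_le {n : ℕ} (hn : 1 ≤ n) (M : ℕ) :
    ((latticeBox (n + 1) M).filter fun k => intVec k (Fin.last n) ≠ 0 ∧
      nonrealRootCount (polyOfCoeffs n (intVec k)) = 0 ∧
      (polyOfCoeffs n (intVec k)).discr = 0).card ≤ n * (2 * M + 1) ^ n := by
  refine card_le_of_card_fiber_le (Finset.filter_subset _ _) 0 fun k₀ => ?_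
  set p := polyOfCoeffs n (intVec k₀) with hp
  -- Only the constant term varies on the fibre, so the derivative is fixed. A repeated root c is
  -- one of its at most n - 1 roots, and the constant term must then be -p(c).
  refine ⟨p.derivative.roots.toFinset.image fun c => ⌊-p.eval c⌋, ?_, fun k hk hk0 => ?_⟩
  · refine Finset.card_image_le.trans ((Multiset.toFinset_card_le _).trans
      ((Polynomial.card_roots' _).trans ((Polynomial.natDegree_derivative_le _).trans ?_)))
    have : p.natDegree ≤ n := natDegree_polyOfCoeffs_le (intVec k₀)
    omega
  · obtain ⟨-, ha, hr, hd⟩ := Finset.mem_filter.mp hk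
    obtain ⟨α, hα⟩ := exists_splitCoeffs ha hr
    have hni : ¬ Function.Injective α := by
      rw [← discr_splitPoly_ne_zero_iff hn ha, not_not, ← polyOfCoeffs_splitCoeffs, ← hα]
      exact hd
    rw [Function.not_injective_iff] at hni
    obtain ⟨i, j, hij, hne⟩ := hni
    have hpk : polyOfCoeffs n (intVec k) = p + Polynomial.C ((k 0 : ℤ) : ℝ) := by
      rw [hp, polyOfCoeffs, polyOfCoeffs, Fin.sum_univ_succ, Fin.sum_univ_succ, ← hk0]
      simp [intVec, add_comm]
    have hpk' : polyOfCoeffs n (intVec k) = splitPoly (intVec k (Fin.last n)) α := by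
      rw [← polyOfCoeffs_splitCoeffs, ← hα]
    have hder : p.derivative = (splitPoly (intVec k (Fin.last n)) α).derivative := by
      rw [← hpk', hpk]
      simp
    have hdeg : p.natDegree = n := by
      have h1 := natDegree_splitPoly ha α
      rw [← hpk', hpk, Polynomial.natDegree_add_C] at h1
      exact h1
    have hder0 : p.derivative ≠ 0 := by
      intro h0
      have := Polynomial.derivative_eq_zero.mp h0
      omega
    refine Finset.mem_image.mpr ⟨α i, ?_, ?_⟩
    · rw [Multiset.mem_toFinset, Polynomial.mem_roots hder0, Polynomial.IsRoot, hder,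
        eval_derivative_splitPoly, Finset.prod_eq_zero (i := j) (by simp [hne.symm])
          (by rw [hij, sub_self]), mul_zero]
    · have h1 : (polyOfCoeffs n (intVec k)).eval (α i) = 0 := by
        rw [hpk', eval_splitPoly, Finset.prod_eq_zero (Finset.mem_univ i) (sub_self _), mul_zero]
      rw [hpk, Polynomial.eval_add, Polynomial.eval_C] at h1
      rw [show -p.eval (α i) = ((k 0 : ℤ) : ℝ) by linarith]
      exact Int.floor_intCast _

lemma smul_mem_distinctRegion {n : ℕ} (hn : 1 ≤ n) {r δ : ℝ} (hr : 0 < r) {a : Fin (n + 1) → ℝ}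
    (ha : a ∈ distinctRegion n δ) : r • a ∈ distinctRegion n (r ^ (2 * n - 2) * δ) := by
  obtain ⟨α, hα⟩ := exists_splitCoeffs ha.1 ha.2.1
  rw [hα] at ha ⊢
  rw [splitCoeffs_mem_distinctRegion hn] at ha
  rw [splitCoeffs_smul, smul_smul, ← splitCoeffs_smul, splitCoeffs_mem_distinctRegion hn]
  refine ⟨mul_ne_zero hr.ne' ha.1, ha.2.1, ?_⟩
  rw [abs_mul, mul_pow, abs_of_pos hr, mul_assoc]
  exact mul_le_mul_of_nonneg_left ha.2.2 (by positivity)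

open scoped Pointwise in
-- Scaling coefficients by r scales the height by r, the discriminant by r^(2n-2) and the volume by
-- r^(n+1).
lemma volume_height_le_inter {n : ℕ} (hn : 1 ≤ n) {h : (Fin (n + 1) → ℝ) → ℝ}
    (hh : IsHeightFunction n h) {r δ : ℝ} (hr : 0 < r) :
    volume ({a | h a ≤ r} ∩ distinctRegion n (r ^ (2 * n - 2) * δ)) =
      ENNReal.ofReal (r ^ (n + 1)) * volume (discrRegion n h 0 δ) := by
  have hset : {a | h a ≤ r} ∩ distinctRegion n (r ^ (2 * n - 2) * δ) =
      r • ({a | h a ≤ 1} ∩ distinctRegion n δ) := by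
    ext a
    rw [Set.mem_smul_set]
    constructor
    · rintro ⟨h1, h2⟩
      refine ⟨r⁻¹ • a, ⟨?_, ?_⟩, by rw [smul_smul, mul_inv_cancel₀ hr.ne', one_smul]⟩
      · change h (r⁻¹ • a) ≤ 1
        rw [hh.homogeneous, abs_inv, abs_of_pos hr]
        have h1' : h a ≤ r := h1
        rw [inv_mul_le_iff₀ hr, mul_one]
        exact h1'
      · have := smul_mem_distinctRegion hn (inv_pos.mpr hr) h2
        rwa [← mul_assoc, ← mul_pow, inv_mul_cancel₀ hr.ne', one_pow, one_mul] at this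
    · rintro ⟨b, ⟨h1, h2⟩, rfl⟩
      refine ⟨?_, smul_mem_distinctRegion hn hr h2⟩
      change h (r • b) ≤ r
      rw [hh.homogeneous, abs_of_pos hr]
      exact mul_le_of_le_one_right hr.le h1
  rw [hset, Measure.addHaar_smul_of_nonneg _ hr.le, volume_discrRegion hn]
  simp

/-! ### Comparing the count with volumes -/

open scoped Classical in
/-- The lattice point count is bounded above and below by volumes of slightly larger and smaller
regions. -/
lemma card_lattice_sandwich {n M : ℕ} (hn : 1 ≤ n) {h : (Fin (n + 1) → ℝ) → ℝ}
    (hc : Continuous h) {Q η δ : ℝ} (hQ : 0 < Q) (hη0 : 0 < η) (hη1 : η < 1) (hδ : 0 ≤ δ)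
    (hM : ∀ w, h w ≤ 2 * Q → ∀ i, |w i| ≤ M)
    (hη : ∀ w w' : Fin (n + 1) → ℝ, (∀ i, |w' i - w i| ≤ 1) → h w ≤ 2 * Q →
      |h w' - h w| ≤ η * Q) :
    ((((latticeBox (n + 1) M).filter fun k =>
        intVec k ∈ realRootedRegion n δ ∧ h (intVec k) ≤ Q).card : ℕ) : ℝ) ≤
      (volume ({a | h a ≤ (1 + η) * Q} ∩ distinctRegion n δ)).toReal +
        (8 * n + 4) ^ 2 * (2 * M + 1) ^ n ∧
    (volume ({a | h a ≤ (1 - η) * Q} ∩ distinctRegion n δ)).toReal ≤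
      ((((latticeBox (n + 1) M).filter fun k =>
        intVec k ∈ realRootedRegion n δ ∧ h (intVec k) ≤ Q).card : ℕ) : ℝ) +
        (8 * n + 4) ^ 2 * (2 * M + 1) ^ n := by
  set B := latticeBox (n + 1) M with hB
  set R := distinctRegion n δ with hR
  set T := B.filter fun k => intVec k ∈ realRootedRegion n δ ∧ h (intVec k) ≤ Q with hT
  -- Zero discriminant is allowed in the count but not in R. These points form a null set for the
  -- volume, so they need a count of their own.
  set Z := B.filter fun k => intVec k (Fin.last n) ≠ 0 ∧
      nonrealRootCount (polyOfCoeffs n (intVec k)) = 0 ∧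
      (polyOfCoeffs n (intVec k)).discr = 0 with hZ
  set E : ℕ := (n + 1) * ((6 * n + 3) * (2 * M + 1) ^ n) with hE
  have hZc : Z.card ≤ n * (2 * M + 1) ^ n := card_discr_zero_le hn M
  set F : (Fin (n + 1) → ℝ) → Finset (Fin (n + 1) → ℤ) := fun u =>
    B.filter fun k => ¬ (intVec k ∈ R ↔ intVec k + u ∈ R) with hF
  have hFc : ∀ u ∈ unitCube (n + 1), (F u).card ≤ E := fun u hu =>
    card_shift_differ_le (fun y i => exists_finset_line hn hδ y i) (mem_unitCube.mp hu)
  have hmeas : ∀ s, MeasurableSet ({a | h a ≤ s} ∩ R) := fun s =>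
    (hc.measurable measurableSet_Iic).inter (measurableSet_distinctRegion hn δ)
  have hEreal : ((E : ℕ) : ℝ) + ((n * (2 * M + 1) ^ n : ℕ) : ℝ) ≤
      (8 * n + 4) ^ 2 * (2 * M + 1) ^ n := by
    rw [hE]
    push_cast
    have h1 : (0 : ℝ) ≤ (2 * M + 1) ^ n := by positivity
    have h2 : (0 : ℝ) ≤ n := by positivity
    nlinarith [mul_nonneg h1 h2, mul_nonneg h1 (mul_nonneg h2 h2)]
  have hfin : ∀ s, s ≤ 2 * Q → volume ({a | h a ≤ s} ∩ R) ≠ ⊤ := by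
    intro s hs
    have hsub : {a | h a ≤ s} ∩ R ⊆ Set.Icc (fun _ => -(M : ℝ)) (fun _ => (M : ℝ)) := by
      rintro a ⟨ha, -⟩
      have ha' : h a ≤ s := ha
      exact ⟨fun i => (abs_le.mp (hM a (ha'.trans hs) i)).1,
        fun i => (abs_le.mp (hM a (ha'.trans hs) i)).2⟩
    exact ((measure_mono hsub).trans_lt isCompact_Icc.measure_lt_top).ne
  have hclose : ∀ u ∈ unitCube (n + 1), ∀ (k : Fin (n + 1) → ℝ) (i : Fin (n + 1)),
      |(k + u) i - k i| ≤ 1 := by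
    intro u hu k i
    have := mem_unitCube.mp hu i
    rw [Pi.add_apply, add_sub_cancel_left, abs_of_nonneg this.1]
    exact this.2.le
  constructor
  · have key : ∀ u ∈ unitCube (n + 1), T.card ≤
        (B.filter fun k => intVec k + u ∈ {a | h a ≤ (1 + η) * Q} ∩ R).card +
          (E + n * (2 * M + 1) ^ n) := by
      intro u hu
      have hsub : T ⊆ (B.filter fun k => intVec k + u ∈ {a | h a ≤ (1 + η) * Q} ∩ R) ∪ (F u ∪ Z) := by
        intro k hk
        obtain ⟨hk1, ⟨ha, hr, hD⟩, hk3⟩ := Finset.mem_filter.mp hk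
        simp only [Finset.mem_union]
        by_cases hd : (polyOfCoeffs n (intVec k)).discr = 0
        · exact Or.inr (Or.inr (Finset.mem_filter.mpr ⟨hk1, ha, hr, hd⟩))
        by_cases hu2 : intVec k + u ∈ R
        · refine Or.inl (Finset.mem_filter.mpr ⟨hk1, ?_, hu2⟩)
          have h1 := abs_le.mp (hη (intVec k) (intVec k + u) (hclose u hu _) (by linarith))
          change h (intVec k + u) ≤ (1 + η) * Q
          linarith [h1.2]
        · refine Or.inr (Or.inl (Finset.mem_filter.mpr ⟨hk1, fun hiff => hu2 (hiff.mp ?_)⟩))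
          exact ⟨ha, hr, hd, hD⟩
      refine (Finset.card_le_card hsub).trans ((Finset.card_union_le _ _).trans ?_)
      have h1 := Finset.card_union_le (F u) Z
      have h2 := hFc u hu
      omega
    -- The subtraction is truncated; it only has to bound the count of every translate from below.
    have hle : ((T.card - (E + n * (2 * M + 1) ^ n) : ℕ) : ENNReal) ≤
        volume ({a | h a ≤ (1 + η) * Q} ∩ R) := by
      refine le_volume_of_le_card_shift B (hmeas _) fun u hu => ?_
      have := key u hu
      exact_mod_cast (by omega)
    have hreal := ENNReal.toReal_mono (hfin _ (by nlinarith)) hle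
    rw [ENNReal.toReal_natCast] at hreal
    have h3 : (T.card : ℝ) ≤ ((T.card - (E + n * (2 * M + 1) ^ n) : ℕ) : ℝ) +
        ((E + n * (2 * M + 1) ^ n : ℕ) : ℝ) := by
      exact_mod_cast le_tsub_add
    rw [Nat.cast_add E] at h3
    linarith
  · have key : ∀ u ∈ unitCube (n + 1),
        (B.filter fun k => intVec k + u ∈ {a | h a ≤ (1 - η) * Q} ∩ R).card ≤ T.card + E := by
      intro u hu
      have hsub : (B.filter fun k => intVec k + u ∈ {a | h a ≤ (1 - η) * Q} ∩ R) ⊆ T ∪ F u := by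
        intro k hk
        obtain ⟨hk1, hk2, hk3⟩ := Finset.mem_filter.mp hk
        have hk2' : h (intVec k + u) ≤ (1 - η) * Q := hk2
        rw [Finset.mem_union]
        by_cases hkR : intVec k ∈ R
        · refine Or.inl (Finset.mem_filter.mpr ⟨hk1, ⟨hkR.1, hkR.2.1, hkR.2.2.2⟩, ?_⟩)
          have h1 := abs_le.mp (hη (intVec k + u) (intVec k)
            (fun i => by rw [abs_sub_comm]; exact hclose u hu _ i) (by nlinarith))
          linarith [h1.2]
        · exact Or.inr (Finset.mem_filter.mpr ⟨hk1, fun hiff => hkR (hiff.mpr hk3)⟩)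
      refine (Finset.card_le_card hsub).trans ((Finset.card_union_le _ _).trans ?_)
      have h2 := hFc u hu
      omega
    have hle : volume ({a | h a ≤ (1 - η) * Q} ∩ R) ≤ ((T.card + E : ℕ) : ENNReal) := by
      refine volume_le_of_card_shift_le (M := M) (hmeas _) (fun x hx i => ?_) fun u hu => ?_
      · have hx1 : h x ≤ (1 - η) * Q := hx.1
        exact hM x (by nlinarith) i
      · exact_mod_cast key u hu
    have hreal := ENNReal.toReal_mono (by simp) hle
    rw [ENNReal.toReal_natCast, Nat.cast_add] at hreal
    have : (0 : ℝ) ≤ ((n * (2 * M + 1) ^ n : ℕ) : ℝ) := by positivity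
    linarith

/-- A height function varies slowly, relative to its size, on the unit scale. -/
lemma IsHeightFunction.eventually_abs_sub_le {n : ℕ} {h : (Fin (n + 1) → ℝ) → ℝ}
    (hh : IsHeightFunction n h) {η : ℝ} (hη : 0 < η) :
    ∀ᶠ Q : ℝ in atTop, ∀ w w' : Fin (n + 1) → ℝ, (∀ i, |w' i - w i| ≤ 1) → h w ≤ 2 * Q →
      |h w' - h w| ≤ η * Q := by
  obtain ⟨c, hc, hle⟩ := exists_mul_norm_le hh.continuous hh.homogeneous fun w hw => hh.pos hw
  -- After division by Q both vectors lie in this fixed ball when Q ≥ 1, and their distance is at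
  -- most 1/Q.
  have huc : UniformContinuousOn h (Metric.closedBall 0 (2 / c + 1)) :=
    (isCompact_closedBall _ _).uniformContinuousOn_of_continuous hh.continuous.continuousOn
  obtain ⟨d, hd, hclose⟩ := Metric.uniformContinuousOn_iff.mp huc η hη
  filter_upwards [eventually_ge_atTop 1, eventually_gt_atTop d⁻¹] with Q hQ1 hQd w w' hww hw
  have hQ : 0 < Q := by linarith
  have hdist : ‖w' - w‖ ≤ 1 := (pi_norm_le_iff_of_nonneg zero_le_one).mpr hww
  have hwn : ‖w‖ ≤ 2 * Q / c := by
    rw [le_div_iff₀ hc, mul_comm]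
    exact (hle w).trans hw
  have hwn' : ‖w'‖ ≤ 2 * Q / c + 1 := by
    have := norm_le_norm_add_norm_sub' w' w
    linarith
  have hnorm : ∀ x : Fin (n + 1) → ℝ, ‖x‖ ≤ 2 * Q / c + 1 →
      Q⁻¹ • x ∈ Metric.closedBall (0 : Fin (n + 1) → ℝ) (2 / c + 1) := by
    intro x hx
    rw [mem_closedBall_zero_iff, norm_smul, norm_inv, Real.norm_of_nonneg hQ.le,
      inv_mul_le_iff₀ hQ]
    have : 2 * Q / c = Q * (2 / c) := by ring
    linarith
  have h1 := hclose _ (hnorm w' hwn') _ (hnorm w (by linarith)) (by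
    rw [dist_eq_norm, ← smul_sub, norm_smul, norm_inv, Real.norm_of_nonneg hQ.le]
    calc Q⁻¹ * ‖w' - w‖ ≤ Q⁻¹ * 1 := by gcongr
      _ < d := by rw [mul_one]; exact inv_lt_of_inv_lt₀ hd hQd)
  rw [Real.dist_eq, hh.homogeneous, hh.homogeneous, abs_inv, abs_of_pos hQ, ← mul_sub, abs_mul,
    abs_inv, abs_of_pos hQ, inv_mul_lt_iff₀ hQ] at h1
  linarith

lemma toReal_volume_height_le_inter {n : ℕ} (hn : 1 ≤ n) {h : (Fin (n + 1) → ℝ) → ℝ}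
    (hh : IsHeightFunction n h) {Q s v : ℝ} (hQ : 0 < Q) (hs : 0 < s) :
    (volume ({a | h a ≤ s * Q} ∩ distinctRegion n (Q ^ (2 * (n : ℝ) - 2 - 2 * v)))).toReal =
      (s * Q) ^ (n + 1) * limitDistr n h 0 ((s ^ (2 * n - 2))⁻¹ * Q ^ (-(2 * v))) := by
  have h1 : Q ^ (2 * (n : ℝ) - 2 - 2 * v) =
      (s * Q) ^ (2 * n - 2) * ((s ^ (2 * n - 2))⁻¹ * Q ^ (-(2 * v))) := by
    have h2 : Q ^ (2 * n - 2) = Q ^ (2 * (n : ℝ) - 2) := by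
      rw [← Real.rpow_natCast, Nat.cast_sub (by omega)]
      push_cast
      rfl
    rw [mul_pow, h2, sub_eq_add_neg, Real.rpow_add hQ]
    field_simp
  rw [h1, volume_height_le_inter hn hh (mul_pos hs hQ), ENNReal.toReal_mul,
    ENNReal.toReal_ofReal (by positivity), limitDistr]

/-- The number of real-rooted integer polynomials is the volume of the corresponding region up to
an error one power of `Q` below the trivial bound, after a small change of the height. -/
lemma exists_ncard_le_limitDistr {n : ℕ} (hn : 1 ≤ n) {h : (Fin (n + 1) → ℝ) → ℝ}
    (hh : IsHeightFunction n h) :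
    ∃ C > 0, ∀ η : ℝ, 0 < η → η < 1 → ∀ᶠ Q : ℝ in atTop, ∀ v : ℝ,
      ((smallDiscrClassSig n h 0 Q v).ncard : ℝ) ≤ ((1 + η) * Q) ^ (n + 1) *
        limitDistr n h 0 (((1 + η) ^ (2 * n - 2))⁻¹ * Q ^ (-(2 * v))) + C * Q ^ n ∧
      ((1 - η) * Q) ^ (n + 1) *
        limitDistr n h 0 (((1 - η) ^ (2 * n - 2))⁻¹ * Q ^ (-(2 * v))) ≤
        ((smallDiscrClassSig n h 0 Q v).ncard : ℝ) + C * Q ^ n := by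
  classical
  obtain ⟨c, hc, hle⟩ := exists_mul_norm_le hh.continuous hh.homogeneous fun w hw => hh.pos hw
  -- Vectors of height at most 2Q have entries bounded by M = ⌈2Q/c⌉, and 2M + 1 ≤ (4/c + 3)Q for Q
  -- ≥ 1; this C therefore depends on neither η nor v.
  refine ⟨(8 * n + 4) ^ 2 * (4 / c + 3) ^ n, by positivity, fun η hη0 hη1 => ?_⟩
  filter_upwards [eventually_ge_atTop 1, hh.eventually_abs_sub_le hη0] with Q hQ1 hQη v
  have hQ : 0 < Q := by linarith
  set M := ⌈2 * Q / c⌉₊ with hMdef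
  have hM : ∀ w, h w ≤ 2 * Q → ∀ i, |w i| ≤ M := by
    intro w hw i
    refine (norm_le_pi_norm w i).trans (le_trans ?_ (Nat.le_ceil _))
    rw [le_div_iff₀ hc, mul_comm]
    exact (hle w).trans hw
  have hMQ : 2 * (M : ℝ) + 1 ≤ (4 / c + 3) * Q := by
    have h1 : (M : ℝ) < 2 * Q / c + 1 := Nat.ceil_lt_add_one (by positivity)
    have h2 : (4 / c + 3) * Q = 2 * (2 * Q / c) + 3 * Q := by ring
    linarith
  have herr : (8 * (n : ℝ) + 4) ^ 2 * (2 * M + 1) ^ n ≤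
      (8 * n + 4) ^ 2 * (4 / c + 3) ^ n * Q ^ n := by
    rw [mul_assoc, ← mul_pow]
    gcongr
  obtain ⟨h1, h2⟩ := card_lattice_sandwich hn hh.continuous hQ hη0 hη1
    (Real.rpow_nonneg hQ.le (2 * (n : ℝ) - 2 - 2 * v)) hM hQη
  rw [toReal_volume_height_le_inter hn hh hQ (by linarith),
    ← ncard_smallDiscrClassSig hn fun w hw => hM w (by linarith)] at h1 h2
  exact ⟨by linarith, by linarith⟩

/-! ### Uniform asymptotics -/

lemma tendsto_pow_mul_inv_pow_rpow (k l : ℕ) (κ : ℝ) :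
    Tendsto (fun s : ℝ => s ^ k * ((s ^ l)⁻¹) ^ κ) (𝓝 1) (𝓝 1) := by
  have : ContinuousAt (fun s : ℝ => s ^ k * ((s ^ l)⁻¹) ^ κ) 1 := by
    refine (continuousAt_id.pow k).mul (ContinuousAt.rpow_const ?_ (Or.inl (by simp)))
    exact (continuousAt_id.pow l).inv₀ (by simp)
  simpa [ContinuousAt] using this

/-- If `f δ ∼ lam * δ ^ κ`, the rescaled main term is uniformly close to the expected one. -/
lemma eventually_mul_limit_close {f : ℝ → ℝ} {lam κ ε e s : ℝ} {n l : ℕ} (hlam : 0 < lam)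
    (hf : Tendsto (fun δ => f δ / (lam * δ ^ κ)) (𝓝[>] 0) (𝓝 1)) (hε : 0 < ε) (hs : 0 < s)
    (he : 0 < e) (he1 : e ≤ 1) (hA : |s ^ n * ((s ^ l)⁻¹) ^ κ - 1| < e) :
    ∀ᶠ Q : ℝ in atTop, ∀ v, ε ≤ v →
      |(s * Q) ^ n * f ((s ^ l)⁻¹ * Q ^ (-(2 * v))) / (lam * (Q ^ n * Q ^ (-(2 * v * κ)))) - 1| <
        3 * e := by
  obtain ⟨d, hd, hcl⟩ := Metric.tendsto_nhdsWithin_nhds.mp hf e he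
  have ht : Tendsto (fun Q : ℝ => (s ^ l)⁻¹ * Q ^ (-(2 * ε))) atTop (𝓝 0) := by
    simpa using (tendsto_rpow_neg_atTop (y := 2 * ε) (by linarith)).const_mul (s ^ l)⁻¹
  filter_upwards [eventually_ge_atTop 1, ht.eventually (gt_mem_nhds hd)] with Q hQ1 hQd v hv
  have hQ : 0 < Q := by linarith
  set x := Q ^ (-(2 * v)) with hx
  have hx0 : 0 < x := Real.rpow_pos_of_pos hQ _
  have hsl : 0 < (s ^ l)⁻¹ := by positivity
  have hδ : 0 < (s ^ l)⁻¹ * x := by positivity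
  -- Uniformity in v: since v ≥ ε and Q ≥ 1, the argument of f is bounded by its value at v = ε,
  -- which tends to 0.
  have hxle : x ≤ Q ^ (-(2 * ε)) := Real.rpow_le_rpow_of_exponent_le hQ1 (by linarith)
  have hδd : (s ^ l)⁻¹ * x < d := (mul_le_mul_of_nonneg_left hxle hsl.le).trans_lt hQd
  have h1 := hcl (x := (s ^ l)⁻¹ * x) hδ (by simpa [abs_of_pos hx0, abs_of_pos hs] using hδd)
  rw [Real.dist_eq] at h1
  set A := s ^ n * ((s ^ l)⁻¹) ^ κ with hAdef
  set G := f ((s ^ l)⁻¹ * x) / (lam * ((s ^ l)⁻¹ * x) ^ κ) with hG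
  have hxκ : Q ^ (-(2 * v * κ)) = x ^ κ := by
    rw [hx, ← Real.rpow_mul hQ.le]
    ring_nf
  have hprod : (s * Q) ^ n * f ((s ^ l)⁻¹ * x) / (lam * (Q ^ n * Q ^ (-(2 * v * κ)))) = A * G := by
    have hp1 : 0 < x ^ κ := Real.rpow_pos_of_pos hx0 _
    have hp2 : 0 < ((s ^ l)⁻¹) ^ κ := Real.rpow_pos_of_pos hsl _
    rw [hxκ, hAdef, hG, Real.mul_rpow hsl.le hx0.le, mul_pow]
    generalize ((s ^ l)⁻¹) ^ κ = y at *
    field_simp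
  rw [hprod]
  -- A is the distortion caused by s and G the normalized value of f; both lie within e ≤ 1 of 1, so
  -- the three terms sum to less than 3e.
  have h2 : A * G - 1 = (A - 1) * (G - 1) + (A - 1) + (G - 1) := by ring
  rw [h2]
  refine (abs_add_three _ _ _).trans_lt ?_
  rw [abs_mul]
  have h3 : |A - 1| * |G - 1| ≤ e * 1 :=
    mul_le_mul hA.le (h1.le.trans he1) (abs_nonneg _) he.le
  linarith

end

theorem mainTheorem3 (n : ℕ) (hn : 2 ≤ n) (h : (Fin (n + 1) → ℝ) → ℝ)
    (hh : IsHeightFunction n h) :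
    ∃ lam : ℝ, 0 < lam ∧
      Tendsto (fun δ : ℝ => limitDistr n h 0 δ / (lam * δ ^ (((n : ℝ) + 2) / (2 * (n : ℝ)))))
        (𝓝[>] 0) (𝓝 1) ∧
      ∀ ε : ℝ, 0 < ε → ε < 1 →
        TendstoUniformlyOn
          (fun (Q v : ℝ) => ((smallDiscrClassSig n h 0 Q v).ncard : ℝ) /
            (lam * Q ^ ((n : ℝ) + 1 - ((n : ℝ) + 2) / (n : ℝ) * v)))
          (fun _ => 1) atTop (Set.Icc ε ((1 - ε) * ((n : ℝ) / ((n : ℝ) + 2)))) := by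
  have hn0 : (0 : ℝ) < n := by exact_mod_cast (by omega : 0 < n)
  set κ : ℝ := ((n : ℝ) + 2) / (2 * (n : ℝ)) with hκ
  obtain ⟨lam, hlam, hlim⟩ : ∃ lam : ℝ, 0 < lam ∧
      Tendsto (fun δ => limitDistr n h 0 δ / δ ^ κ) (𝓝[>] 0) (𝓝 lam) := by
    obtain ⟨m, rfl⟩ : ∃ m, n = m + 1 := ⟨n - 1, by omega⟩
    convert exists_tendsto_limitDistr (m := m) (by omega) hh using 7
    rw [hκ]
    push_cast
    ring
  have hlim1 : Tendsto (fun δ => limitDistr n h 0 δ / (lam * δ ^ κ)) (𝓝[>] 0) (𝓝 1) := by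
    have := hlim.div_const lam
    rw [div_self hlam.ne'] at this
    refine this.congr fun δ => ?_
    rw [div_div, mul_comm]
  refine ⟨lam, hlam, hlim1, fun ε hε hε1 => ?_⟩
  rw [Metric.tendstoUniformlyOn_iff]
  intro e he
  obtain ⟨C, hC, hcount⟩ := exists_ncard_le_limitDistr (by omega) hh
  -- The main term deviates by less than 3e' and the counting error contributes less than e', for a
  -- total below 4e' < e.
  set e' : ℝ := min 1 (e / 5) with he'
  have he'0 : 0 < e' := lt_min one_pos (by linarith)
  have he'1 : e' ≤ 1 := min_le_left _ _
  have he'e : e' ≤ e / 5 := min_le_right _ _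
  obtain ⟨d, hd, hA⟩ := Metric.tendsto_nhds_nhds.mp
    (tendsto_pow_mul_inv_pow_rpow (n + 1) (2 * n - 2) κ) e' he'0
  obtain ⟨η, hη0, hη⟩ := exists_between (lt_min hd one_pos)
  have hηd : η < d := hη.trans_le (min_le_left _ _)
  have hη1 : η < 1 := hη.trans_le (min_le_right _ _)
  have hA1 := hA (x := 1 + η) (by rwa [Real.dist_eq, add_sub_cancel_left, abs_of_pos hη0])
  have hA2 := hA (x := 1 - η) (by
    rwa [dist_comm, Real.dist_eq, sub_sub_cancel, abs_of_pos hη0])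
  rw [Real.dist_eq] at hA1 hA2
  have hsmall : Tendsto (fun Q : ℝ => C / lam * Q ^ (-ε)) atTop (𝓝 0) := by
    simpa using (tendsto_rpow_neg_atTop hε).const_mul (C / lam)
  filter_upwards [eventually_ge_atTop 1, hcount η hη0 hη1,
    hsmall.eventually (gt_mem_nhds he'0),
    eventually_mul_limit_close hlam hlim1 hε (by linarith) he'0 he'1 hA1,
    eventually_mul_limit_close hlam hlim1 hε (by linarith) he'0 he'1 hA2]
    with Q hQ1 hQc hQs hQ3 hQ4 v hv
  have hQ : 0 < Q := by linarith
  obtain ⟨hup, hlow⟩ := hQc v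
  have h3 := (abs_lt.mp (hQ3 v hv.1)).2
  have h4 := (abs_lt.mp (hQ4 v hv.1)).1
  have hden : Q ^ ((n : ℝ) + 1 - ((n : ℝ) + 2) / (n : ℝ) * v) =
      Q ^ (n + 1) * Q ^ (-(2 * v * κ)) := by
    rw [← Real.rpow_natCast, ← Real.rpow_add hQ, hκ]
    congr 1
    push_cast
    field_simp
    ring
  -- The upper end of the range of v is used here: the exponent of the main term is at least n + ε,
  -- so the error C·Q^n is smaller by a factor of order Q^(-ε).
  have hvle : ((n : ℝ) + 2) / (n : ℝ) * v ≤ 1 - ε := by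
    calc ((n : ℝ) + 2) / (n : ℝ) * v
        ≤ ((n : ℝ) + 2) / (n : ℝ) * ((1 - ε) * ((n : ℝ) / ((n : ℝ) + 2))) := by
          gcongr
          exact hv.2
      _ = 1 - ε := by field_simp
  set D := lam * Q ^ ((n : ℝ) + 1 - ((n : ℝ) + 2) / (n : ℝ) * v) with hD
  have hD0 : 0 < D := mul_pos hlam (Real.rpow_pos_of_pos hQ _)
  rw [← hden, ← hD] at h3 h4
  have herr : C * Q ^ n / D < e' := by
    refine lt_of_le_of_lt ?_ hQs
    rw [div_le_iff₀ hD0, hD]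
    have h5 : Q ^ n ≤ Q ^ (-ε) * Q ^ ((n : ℝ) + 1 - ((n : ℝ) + 2) / (n : ℝ) * v) := by
      rw [← Real.rpow_natCast, ← Real.rpow_add hQ]
      exact Real.rpow_le_rpow_of_exponent_le hQ1 (by linarith)
    calc C * Q ^ n ≤ C * (Q ^ (-ε) * Q ^ ((n : ℝ) + 1 - ((n : ℝ) + 2) / (n : ℝ) * v)) := by
          gcongr
      _ = _ := by field_simp
  have hup' := div_le_div_of_nonneg_right hup hD0.le
  have hlow' := div_le_div_of_nonneg_right hlow hD0.le
  rw [add_div] at hup' hlow'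
  rw [dist_comm, Real.dist_eq, abs_lt]
  constructor <;> linarith
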